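/- Call a measurable function $f:\mathbb R\to\mathbb R$ that is positive near $+\infty$ regularly varying with index $\rho$ if $f(sx)/f(x)\to s^{\rho}$ as $x\to\infty$ for every $s>0$, and call a random variable $X$ regularly varying with index $\rho$ if $x\mapsto P(X>x)$ is. Let $X_i$, $i\in\mathbb N$, be i.i.d. non-negative random variables that are regularly varying with index $-1$. Let $\alpha_i,\beta_i\ge 0$, $i\in\mathbb N$, satisfy $\sup_i\alpha_i>0$, $\sup_i\beta_i>0$, $\sum_i\alpha_i<\infty$ and $\sum_i\beta_i<\infty$. Then $\prod_{i=1}^n X_i^{\alpha_i}$ and $\prod_{i=1}^n X_i^{\beta_i}$ converge almost surely in $\mathbb R$ as $n\to\infty$; denote the limits by $Y_0$ and $Y_1$. Moreover, the linear program $$\sum_{i}\kappa_i\to\min!\quad\text{subject to}\quad \sum_i\alpha_i\kappa_i\ge 1,\quad \sum_i\beta_i\kappa_i\ge 1,\quad \kappa_i\ge 0\ \ \forall i\in\mathbb N$$ has a solution $(\kappa_i)_{i\in\mathbb N}$. Assume from now on that $Y_0>0$ and $Y_1>0$ almost surely. If the solution $(\kappa_i)$ is unique, then at most two of the $\kappa_i$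 are strictly positive and $\min\{Y_0,Y_1\}$ is regularly varying with index $-\sum_i\kappa_i$. Moreover (all infinite products below converging almost surely, and all expectations below being finite): (i) If the solution is unique and $\kappa_i,\kappa_j>0$ for some $i\ne j$, then for all $s_0,s_1>0$ $$\lim_{x\to\infty}\frac{P(Y_0>s_0x,\,Y_1>s_1x)}{P(X_i>x^{\kappa_i})\,P(X_j>x^{\kappa_j})}=D\,s_0^{(\beta_i-\beta_j)/(\alpha_i\beta_j-\alpha_j\beta_i)}\,s_1^{(\alpha_j-\alpha_i)/(\alpha_i\beta_j-\alpha_j\beta_i)},$$ $$D=\frac{|\alpha_i\beta_j-\alpha_j\beta_i|}{(\alpha_i-\alpha_j)(\beta_j-\beta_i)}\,E\Big(\prod_{m\in\mathbb N\setminus\{i,j\}}X_m^{(\alpha_m(\beta_j-\beta_i)+\beta_m(\alpha_i-\alpha_j))/(\alpha_i\beta_j-\alpha_j\beta_i)}\Big).$$ (ii) If the solution is unique and $\kappa_i>0$ for exactly one $i$, then for all $s_0,s_1>0$ $$\lim_{x\to\infty}\frac{P(Y_0>s_0x,\,Y_1>s_1x)}{P(X_i>x^{\kappa_i})}=\begin{cases}E\Big(\min\Big(s_0^{-1}\prod_{j\ne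 i}X_j^{\alpha_j},\,s_1^{-1}\prod_{j\ne i}X_j^{\beta_j}\Big)^{1/\beta_i}\Big),&\alpha_i=\beta_i,\\[1ex] E\Big(\prod_{j\ne i}X_j^{\beta_j/\beta_i}\Big)s_1^{-1/\beta_i},&\alpha_i>\beta_i,\\[1ex] E\Big(\prod_{j\ne i}X_j^{\alpha_j/\alpha_i}\Big)s_0^{-1/\alpha_i},&\alpha_i<\beta_i.\end{cases}$$ (iii) In any case (whether or not the solution is unique), every solution $(\kappa_i)$ satisfies $\sum_i\kappa_i<\infty$, and for all $\varepsilon>0$, as $x\to\infty$, $$P(Y_0>x,Y_1>x)=o\big(x^{\varepsilon-\sum_i\kappa_i}\big),\qquad x^{-\varepsilon-\sum_i\kappa_i}=o\big(P(Y_0>x,Y_1>x)\big).$$ -/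

import Mathlib

open MeasureTheory ProbabilityTheory Filter Topology Asymptotics
open scoped ENNReal

/-- `f` is regularly varying (at infinity) with index `ρ`. -/
def IsRegularlyVarying (f : ℝ → ℝ) (ρ : ℝ) : Prop :=
  Measurable f ∧ (∀ᶠ x in atTop, 0 < f x) ∧
    ∀ s : ℝ, 0 < s → Tendsto (fun x => f (s * x) / f x) atTop (𝓝 (s ^ ρ))

/-- A random variable is regularly varying with index `ρ` if its tail function
`x ↦ P(X > x)` is. -/
def IsRegularlyVaryingRV {Ω : Type*} [MeasurableSpace Ω] (P : Measure Ω) (X : Ω → ℝ)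
    (ρ : ℝ) : Prop :=
  IsRegularlyVarying (fun x => P.real {ω | x < X ω}) ρ

/-- Feasibility for the infinite linear program with coefficients `α, β ≥ 0`. The series have
nonnegative terms and are evaluated in `[0, ∞]`. -/
def LPFeasible (α β κ : ℕ → ℝ) : Prop :=
  (∀ i, 0 ≤ κ i) ∧
    1 ≤ ∑' i, ENNReal.ofReal (α i * κ i) ∧
    1 ≤ ∑' i, ENNReal.ofReal (β i * κ i)

/-- `κ` is a solution of the infinite linear program: it is feasible and minimizes
`∑ κ i` (in `[0, ∞]`) among all feasible sequences. -/
def LPSolution (α β κ : ℕ → ℝ) : Prop :=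
  LPFeasible α β κ ∧
    ∀ κ', LPFeasible α β κ' → ∑' i, ENNReal.ofReal (κ i) ≤ ∑' i, ENNReal.ofReal (κ' i)

/-- `κ` is the unique solution of the infinite linear program. -/
def LPUniqueSolution (α β κ : ℕ → ℝ) : Prop :=
  LPSolution α β κ ∧ ∀ κ', LPSolution α β κ' → κ' = κ

set_option linter.unusedSectionVars false

/-! ### The infinite linear program -/

/-! The cheapest way to make both products exceed `x` is to let `X i` be of order `x ^ κ i`. Both
demands are met when `∑ α i κ i ≥ 1` and `∑ β i κ i ≥ 1`, and the probability is roughly `x ^ (-∑ κ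
i)` because the tails have index `-1`. The joint tail is thus governed by the linear program, and
the proof combines its duality with two facts on heavy tails: moments of order below one are finite,
and `T (c t) / T t` tends to `1 / c` under Potter's domination by the powers `c ^ (-(1 ± δ))`.

The program is finite in disguise, since the coefficients tend to zero. Its value is `1 / t`, where
`t` is the largest minimum of the two coordinates over the convex hull of the origin and finitely
many coefficient pairs, and separation of convex sets gives nearly optimal dual weights
(`LPData.exists_solution`). Markov's inequality for a power of `Y₀ ^ l * Y₁ ^ (1 - l)` whose
exponents stay below one gives the upper bound in (iii) (`exists_joint_tail_le`); forcing finitely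
many independent variables to be large gives the lower bound (`exists_le_joint_tail`).

Uniqueness says that every non-zero admissible finite perturbation raises the cost
(`direction_eq_zero`). Perturbing at most three coordinates yields the bound on the support, tight
constraints, positive dual variables and strict reduced costs. Because the coefficients vanish at
infinity, the strict bounds are uniform, so the product of the remaining variables has slightly more
moments than the limit formula needs. This is the hypothesis of Breiman's lemma. For one dominating
variable one conditions on the remainder (`HeavyTail.tendsto_measureReal_div`). For two, scaled
quantiles couple `(X i / x ^ κ i, X j / x ^ κ j)` to Lebesgue measure on a quadrant; in logarithmic
coordinates both constraints are linear, the dual identities turn the density into `exp (-(y₀ p + y₁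
q))`, and integrating it over a translated quadrant produces the constant `D`
(`HeavyTail.tendsto_lintegral_jointSet`). -/

theorem one_le_tsum_ofReal_iff {f : ℕ → ℝ} (h0 : ∀ i, 0 ≤ f i) (hs : Summable f) :
    1 ≤ ∑' i, ENNReal.ofReal (f i) ↔ 1 ≤ ∑' i, f i := by
  rw [← ENNReal.ofReal_tsum_of_nonneg h0 hs, ENNReal.one_le_ofReal]

theorem Summable.mul_of_nonneg_pointwise {a κ : ℕ → ℝ} (ha : ∀ i, 0 ≤ a i) (hκ : ∀ i, 0 ≤ κ i)
    (has : Summable a) (hκs : Summable κ) : Summable fun i => a i * κ i :=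
  Summable.of_nonneg_of_le (fun i => mul_nonneg (ha i) (hκ i))
    (fun i => mul_le_mul_of_nonneg_right (has.le_tsum i fun j _ => ha j) (hκ i))
    (hκs.mul_left _)

/-- The data of the linear program: nonnegative, summable, not identically zero. -/
structure LPData (α β : ℕ → ℝ) : Prop where
  nonneg_left : ∀ i, 0 ≤ α i
  nonneg_right : ∀ i, 0 ≤ β i
  summable_left : Summable α
  summable_right : Summable β
  exists_pos_left : ∃ i, 0 < α i
  exists_pos_right : ∃ i, 0 < β i

namespace LPData

variable {α β κ : ℕ → ℝ}

theorem feasible_iff (D : LPData α β) (hκ : ∀ i, 0 ≤ κ i) (hs : Summable κ) :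
    LPFeasible α β κ ↔ 1 ≤ ∑' i, α i * κ i ∧ 1 ≤ ∑' i, β i * κ i := by
  unfold LPFeasible
  rw [one_le_tsum_ofReal_iff (fun i => mul_nonneg (D.nonneg_left i) (hκ i))
      (Summable.mul_of_nonneg_pointwise D.nonneg_left hκ D.summable_left hs),
    one_le_tsum_ofReal_iff (fun i => mul_nonneg (D.nonneg_right i) (hκ i))
      (Summable.mul_of_nonneg_pointwise D.nonneg_right hκ D.summable_right hs)]
  exact ⟨fun h => h.2, fun h => ⟨hκ, h⟩⟩

theorem exists_feasible (D : LPData α β) :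
    ∃ κ : ℕ → ℝ, (∀ i, 0 ≤ κ i) ∧ Summable κ ∧ LPFeasible α β κ := by
  obtain ⟨i, hi⟩ := D.exists_pos_left
  obtain ⟨j, hj⟩ := D.exists_pos_right
  let κ : ℕ → ℝ := fun m => (if m = i then (α i)⁻¹ else 0) + (if m = j then (β j)⁻¹ else 0)
  have hκ : ∀ m, 0 ≤ κ m := fun m => by
    have := inv_pos.2 hi
    have := inv_pos.2 hj
    positivity
  have hs : Summable κ := by
    refine summable_of_hasFiniteSupport ((Set.toFinite {i, j}).subset fun m hm => ?_)
    by_contra hmn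
    simp only [Set.mem_insert_iff, Set.mem_singleton_iff, not_or] at hmn
    exact hm (by simp [κ, hmn.1, hmn.2])
  refine ⟨κ, hκ, hs, (D.feasible_iff hκ hs).2 ⟨?_, ?_⟩⟩
  · calc (1 : ℝ) = α i * (α i)⁻¹ := (mul_inv_cancel₀ hi.ne').symm
      _ ≤ α i * κ i := by
        refine mul_le_mul_of_nonneg_left ?_ hi.le
        simp only [κ, if_true, le_add_iff_nonneg_right]
        split_ifs <;> simp [hj.le]
      _ ≤ _ := (Summable.mul_of_nonneg_pointwise D.nonneg_left hκ D.summable_left hs).le_tsum i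
          fun m _ => mul_nonneg (D.nonneg_left m) (hκ m)
  · calc (1 : ℝ) = β j * (β j)⁻¹ := (mul_inv_cancel₀ hj.ne').symm
      _ ≤ β j * κ j := by
        refine mul_le_mul_of_nonneg_left ?_ hj.le
        simp only [κ, if_true, le_add_iff_nonneg_left]
        split_ifs <;> simp [hi.le]
      _ ≤ _ := (Summable.mul_of_nonneg_pointwise D.nonneg_right hκ D.summable_right hs).le_tsum j
          fun m _ => mul_nonneg (D.nonneg_right m) (hκ m)

theorem tsum_ofReal_le_iff {κ κ' : ℕ → ℝ} (hκ : ∀ i, 0 ≤ κ i) (hs : Summable κ)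
    (hκ' : ∀ i, 0 ≤ κ' i) (hs' : Summable κ') :
    ∑' i, ENNReal.ofReal (κ i) ≤ ∑' i, ENNReal.ofReal (κ' i) ↔ ∑' i, κ i ≤ ∑' i, κ' i := by
  rw [← ENNReal.ofReal_tsum_of_nonneg hκ hs, ← ENNReal.ofReal_tsum_of_nonneg hκ' hs',
    ENNReal.ofReal_le_ofReal_iff (tsum_nonneg hκ')]

theorem summable_of_le {κ κ' : ℕ → ℝ} (hκ : ∀ i, 0 ≤ κ i) (hκ' : ∀ i, 0 ≤ κ' i)
    (hs' : Summable κ')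
    (h : ∑' i, ENNReal.ofReal (κ i) ≤ ∑' i, ENNReal.ofReal (κ' i)) : Summable κ := by
  rw [← ENNReal.ofReal_tsum_of_nonneg hκ' hs'] at h
  have := ENNReal.summable_toReal (h.trans_lt ENNReal.ofReal_lt_top).ne
  simpa only [ENNReal.toReal_ofReal (hκ _)] using this

theorem summable_solution (D : LPData α β) (h : LPSolution α β κ) : Summable κ := by
  obtain ⟨κ', h0, hs, hf⟩ := D.exists_feasible
  exact summable_of_le h.1.1 h0 hs (h.2 κ' hf)

/-- A competitor that is not summable has infinite cost and cannot win, so optimality need only be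
tested against summable sequences, with real sums throughout. -/
theorem solution_iff (D : LPData α β) (hκ : ∀ i, 0 ≤ κ i) (hs : Summable κ) :
    LPSolution α β κ ↔ (1 ≤ ∑' i, α i * κ i ∧ 1 ≤ ∑' i, β i * κ i) ∧
      ∀ κ' : ℕ → ℝ, (∀ i, 0 ≤ κ' i) → Summable κ' → 1 ≤ ∑' i, α i * κ' i →
        1 ≤ ∑' i, β i * κ' i → ∑' i, κ i ≤ ∑' i, κ' i := by
  unfold LPSolution
  rw [D.feasible_iff hκ hs]
  refine and_congr_right fun _ => ⟨fun h κ' h0 hs' h1 h2 => ?_, fun h κ' hf => ?_⟩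
  · exact (tsum_ofReal_le_iff hκ hs h0 hs').1 (h κ' ((D.feasible_iff h0 hs').2 ⟨h1, h2⟩))
  · by_cases hs' : Summable κ'
    · obtain ⟨h1, h2⟩ := (D.feasible_iff hf.1 hs').1 hf
      exact (tsum_ofReal_le_iff hκ hs hf.1 hs').2 (h κ' hf.1 hs' h1 h2)
    · by_contra hlt
      exact hs' (summable_of_le hf.1 hκ hs (not_le.1 hlt).le)

end LPData

/-- The convex hull of the origin and the first `N` coefficient pairs. -/
def coeffHull (α β : ℕ → ℝ) (N : ℕ) : Set (ℝ × ℝ) :=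
  convexHull ℝ (insert 0 ((fun m => (α m, β m)) '' Set.Iio N))

theorem isCompact_coeffHull (α β : ℕ → ℝ) (N : ℕ) : IsCompact (coeffHull α β N) :=
  Set.Finite.isCompact_convexHull ℝ (((Set.finite_Iio N).image _).insert 0)

theorem mem_coeffHull {α β : ℕ → ℝ} {N m : ℕ} (hm : m < N) : (α m, β m) ∈ coeffHull α β N :=
  subset_convexHull ℝ _ (Or.inr ⟨m, hm, rfl⟩)

theorem zero_mem_coeffHull {α β : ℕ → ℝ} {N : ℕ} : (0 : ℝ × ℝ) ∈ coeffHull α β N :=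
  subset_convexHull ℝ _ (Or.inl rfl)

/-- The pairs representable by such weights form a convex set containing all generators. The total
weight is only bounded by one because the origin is a generator. -/
theorem exists_weights_of_mem_coeffHull {α β : ℕ → ℝ} {N : ℕ} {p : ℝ × ℝ}
    (hp : p ∈ coeffHull α β N) :
    ∃ κ : ℕ → ℝ, (∀ i, 0 ≤ κ i) ∧ Summable κ ∧ ∑' i, κ i ≤ 1 ∧
      ∑' i, α i * κ i = p.1 ∧ ∑' i, β i * κ i = p.2 := by
  let S : Set (ℝ × ℝ) := {p | ∃ κ : ℕ → ℝ, (∀ i, 0 ≤ κ i) ∧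
    ∑ i ∈ Finset.range N, κ i ≤ 1 ∧ ∑ i ∈ Finset.range N, α i * κ i = p.1 ∧
      ∑ i ∈ Finset.range N, β i * κ i = p.2}
  have hS : Convex ℝ S := by
    rintro p ⟨κ, h0, h1, h2, h3⟩ q ⟨κ', h0', h1', h2', h3'⟩ a b ha hb hab
    refine ⟨fun i => a * κ i + b * κ' i, fun i => ?_, ?_, ?_, ?_⟩
    · have := h0 i
      have := h0' i
      positivity
    · rw [Finset.sum_add_distrib, ← Finset.mul_sum, ← Finset.mul_sum]
      nlinarith
    · simp only [Prod.fst_add, Prod.smul_fst, smul_eq_mul, ← h2, ← h2', Finset.mul_sum,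
        ← Finset.sum_add_distrib]
      exact Finset.sum_congr rfl fun i _ => by ring
    · simp only [Prod.snd_add, Prod.smul_snd, smul_eq_mul, ← h3, ← h3', Finset.mul_sum,
        ← Finset.sum_add_distrib]
      exact Finset.sum_congr rfl fun i _ => by ring
  have hsub : coeffHull α β N ⊆ S := by
    refine convexHull_min ?_ hS
    rintro q (rfl | ⟨m, hm, rfl⟩)
    · exact ⟨fun _ => 0, by simp⟩
    · have hm' : m < N := hm
      exact ⟨Pi.single m 1, fun i => by by_cases h : i = m <;> simp [h],
        by simp [Pi.single_apply, hm']⟩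
  obtain ⟨κ, h0, h1, h2, h3⟩ := hsub hp
  have key : ∀ f : ℕ → ℝ, ∑' i, f i * (if i < N then κ i else 0) =
      ∑ i ∈ Finset.range N, f i * κ i := fun f => by
    rw [tsum_eq_sum (s := Finset.range N) fun i hi => by
      simp [show ¬ i < N by simpa using hi]]
    exact Finset.sum_congr rfl fun i hi => by simp [Finset.mem_range.1 hi]
  refine ⟨fun i => if i < N then κ i else 0, fun i => ?_, ?_, ?_,
    (key α).trans h2, (key β).trans h3⟩
  · dsimp only
    split_ifs
    exacts [h0 i, le_rfl]
  · refine summable_of_hasFiniteSupport ((Set.finite_Iio N).subset fun i hi => ?_)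
    by_contra h
    exact hi (if_neg h)
  · simpa using (key 1).trans_le (by simpa using h1)

/-- Minimax: if no convex combination of the coefficient pairs reaches `(T, T)`, some convex
combination of the two coordinates stays uniformly below `T`. -/
theorem exists_weight_of_disjoint_coeffHull {α β : ℕ → ℝ} {N : ℕ} {T : ℝ} (hT : 0 < T)
    (h : ∀ p ∈ coeffHull α β N, ¬ (T ≤ p.1 ∧ T ≤ p.2)) :
    ∃ l : ℝ, 0 ≤ l ∧ l ≤ 1 ∧ ∃ p < T, ∀ m < N, l * α m + (1 - l) * β m ≤ p := by
  let Q : Set (ℝ × ℝ) := {p | T ≤ p.1 ∧ T ≤ p.2}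
  have hQc : Convex ℝ Q := by
    rintro p ⟨h1, h2⟩ q ⟨h3, h4⟩ a b ha hb hab
    constructor <;> simp only [Prod.fst_add, Prod.smul_fst, Prod.snd_add, Prod.smul_snd,
      smul_eq_mul] <;> nlinarith
  have hQcl : IsClosed Q :=
    (isClosed_le continuous_const continuous_fst).inter
      (isClosed_le continuous_const continuous_snd)
  obtain ⟨f, u, v, hu, huv, hv⟩ := geometric_hahn_banach_compact_closed
    (convex_convexHull ℝ _) (isCompact_coeffHull α β N) hQc hQcl
    (Set.disjoint_left.2 fun p hp hq => h p hp hq)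
  have hf : ∀ x y : ℝ, f (x, y) = x * f (1, 0) + y * f (0, 1) := fun x y => by
    have : ((x, y) : ℝ × ℝ) = x • (1, 0) + y • (0, 1) := by simp
    rw [this, map_add, map_smul, map_smul, smul_eq_mul, smul_eq_mul]
  set a := f (1, 0)
  set b := f (0, 1)
  have hu0 : 0 < u := by simpa using hu 0 zero_mem_coeffHull
  have hab : v < T * (a + b) := by
    have := hv (T, T) ⟨le_rfl, le_rfl⟩
    rw [hf] at this
    linarith
  have ha : 0 ≤ a := by
    by_contra hneg
    have hneg := not_le.1 hneg
    -- If `a` were negative, moving right along the quadrant by exactly this amount would bring `f`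
    -- to zero, although `f > v > 0` there. The shift is nonnegative because `T * (a + b) > v`.
    have := hv (T + T * (a + b) / (-a), T)
      ⟨le_add_of_nonneg_right (div_nonneg (by linarith) (by linarith)), le_rfl⟩
    rw [hf] at this
    have h2 : T * (a + b) / (-a) * a = - (T * (a + b)) := by
      have : a ≠ 0 := hneg.ne
      field_simp
    nlinarith
  have hb : 0 ≤ b := by
    by_contra hneg
    have hneg := not_le.1 hneg
    have := hv (T, T + T * (a + b) / (-b))
      ⟨le_rfl, le_add_of_nonneg_right (div_nonneg (by linarith) (by linarith))⟩
    rw [hf] at this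
    have h2 : T * (a + b) / (-b) * b = - (T * (a + b)) := by
      have : b ≠ 0 := hneg.ne
      field_simp
    nlinarith
  have hs : 0 < a + b := by
    by_contra hneg
    nlinarith
  refine ⟨a / (a + b), by positivity, (div_le_one hs).2 (by linarith), u / (a + b),
    (div_lt_iff₀ hs).2 (by linarith), fun m hm => ?_⟩
  have := hu _ (mem_coeffHull hm)
  rw [hf] at this
  rw [le_div_iff₀ hs]
  have : (a / (a + b) * α m + (1 - a / (a + b)) * β m) * (a + b) = α m * a + β m * b := by
    field_simp
    ring
  linarith

/-! ### Existence of a solution and its value -/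

namespace LPData

variable {α β κ : ℕ → ℝ}

theorem exists_forall_ge_le (D : LPData α β) {T : ℝ} (hT : 0 < T) (N₀ : ℕ) :
    ∃ N, N₀ ≤ N ∧ ∀ m, N ≤ m → α m ≤ T ∧ β m ≤ T := by
  have h1 := D.summable_left.tendsto_atTop_zero.eventually_le_const hT
  have h2 := D.summable_right.tendsto_atTop_zero.eventually_le_const hT
  obtain ⟨N, hN⟩ := (h1.and h2).exists_forall_of_atTop
  exact ⟨max N₀ N, le_max_left _ _, fun m hm => hN m ((le_max_right _ _).trans hm)⟩

/-- Weak duality: average the two constraints with weights `l` and `1 - l`, then bound each averaged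
coefficient by `q`. -/
theorem le_of_weight (D : LPData α β) (hκ : ∀ i, 0 ≤ κ i) (hs : Summable κ)
    {l q c : ℝ} (hl0 : 0 ≤ l) (hl1 : l ≤ 1) (hq : ∀ m, l * α m + (1 - l) * β m ≤ q)
    (h1 : c ≤ ∑' i, α i * κ i) (h2 : c ≤ ∑' i, β i * κ i) :
    c ≤ q * ∑' i, κ i := by
  have s1 := Summable.mul_of_nonneg_pointwise D.nonneg_left hκ D.summable_left hs
  have s2 := Summable.mul_of_nonneg_pointwise D.nonneg_right hκ D.summable_right hs
  calc c ≤ l * ∑' i, α i * κ i + (1 - l) * ∑' i, β i * κ i := by nlinarith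
    _ = ∑' i, (l * (α i * κ i) + (1 - l) * (β i * κ i)) := by
        rw [← tsum_mul_left, ← tsum_mul_left, (s1.mul_left l).tsum_add (s2.mul_left (1 - l))]
    _ ≤ ∑' i, q * κ i :=
        ((s1.mul_left l).add (s2.mul_left (1 - l))).tsum_le_tsum
          (fun i => by nlinarith [hq i, hκ i]) (hs.mul_left q)
    _ = q * ∑' i, κ i := tsum_mul_left

/-- The linear program has a solution with value `t⁻¹`, and almost optimal dual weights. -/
theorem exists_solution (D : LPData α β) :
    ∃ t : ℝ, 0 < t ∧ (∃ κ, LPSolution α β κ) ∧ (∀ κ, LPSolution α β κ → ∑' i, κ i = t⁻¹) ∧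
      ∀ ε > 0, ∃ l : ℝ, 0 ≤ l ∧ l ≤ 1 ∧ ∀ m, l * α m + (1 - l) * β m ≤ t + ε := by
  obtain ⟨i, hi⟩ := D.exists_pos_left
  obtain ⟨j, hj⟩ := D.exists_pos_right
  -- The midpoint of the coefficient pairs `i` and `j` has both coordinates at least `t₀`, so the
  -- optimum over the hull is at least `t₀`. Pairs beyond `N` have both coordinates at most `t₀` and
  -- therefore never violate the dual bound.
  set t₀ := min (α i / 2) (β j / 2) with ht₀
  have ht₀pos : 0 < t₀ := lt_min (by positivity) (by positivity)
  obtain ⟨N, hN, hNs⟩ := D.exists_forall_ge_le ht₀pos (max (i + 1) (j + 1))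
  obtain ⟨p, hp, hmax⟩ := (isCompact_coeffHull α β N).exists_isMaxOn ⟨0, zero_mem_coeffHull⟩
    (f := fun p : ℝ × ℝ => min p.1 p.2) (by fun_prop)
  set t := min p.1 p.2 with ht
  have ht₀t : t₀ ≤ t := by
    have hmid : (1 / 2 : ℝ) • (α i, β i) + (1 / 2 : ℝ) • (α j, β j) ∈ coeffHull α β N :=
      convex_convexHull ℝ _ (mem_coeffHull (by omega)) (mem_coeffHull (by omega))
        (by norm_num) (by norm_num) (by norm_num)
    refine le_trans ?_ (hmax hmid)
    have := D.nonneg_left j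
    have := D.nonneg_right i
    simp only [Prod.smul_mk, smul_eq_mul, Prod.mk_add_mk]
    exact min_le_min (by linarith) (by linarith)
  have htpos : 0 < t := ht₀pos.trans_le ht₀t
  have hdual : ∀ ε > 0, ∃ l : ℝ, 0 ≤ l ∧ l ≤ 1 ∧ ∀ m, l * α m + (1 - l) * β m ≤ t + ε := by
    intro ε hε
    obtain ⟨l, h0, h1, q, hq, hm⟩ := exists_weight_of_disjoint_coeffHull (α := α) (β := β) (N := N)
      (T := t + ε) (by positivity) (fun p' hp' hle => by
        have : min p'.1 p'.2 ≤ t := hmax hp'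
        have := le_min hle.1 hle.2
        linarith)
    refine ⟨l, h0, h1, fun m => ?_⟩
    rcases lt_or_ge m N with hmN | hmN
    · exact (hm m hmN).trans hq.le
    · obtain ⟨ha, hb⟩ := hNs m hmN
      nlinarith
  have hlb : ∀ κ : ℕ → ℝ, (∀ i, 0 ≤ κ i) → Summable κ → 1 ≤ ∑' i, α i * κ i →
      1 ≤ ∑' i, β i * κ i → t⁻¹ ≤ ∑' i, κ i := by
    intro κ hκ hs h1 h2
    rw [inv_le_iff_one_le_mul₀ htpos, mul_comm]
    refine le_of_forall_pos_le_add fun ε hε => ?_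
    have hk : 0 ≤ ∑' i, κ i := tsum_nonneg hκ
    -- Dual weights are available only up to an error, which weak duality multiplies by the cost of
    -- `κ`; dividing by `1 + ∑' i, κ i` keeps the total loss below `ε`.
    obtain ⟨l, hl0, hl1, hm⟩ := hdual (ε / (1 + ∑' i, κ i)) (by positivity)
    have := D.le_of_weight hκ hs hl0 hl1 hm h1 h2
    have h3 : ε / (1 + ∑' i, κ i) * ∑' i, κ i ≤ ε := by
      rw [div_mul_eq_mul_div, div_le_iff₀ (by positivity)]
      nlinarith
    nlinarith
  -- The weights of the maximizing hull point reach level `t` in both constraints at cost at most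
  -- one; scaled by `t⁻¹` they reach level one at cost at most `t⁻¹`.
  obtain ⟨κ, hκ, hs, h1, h2, h3⟩ := exists_weights_of_mem_coeffHull hp
  have hκ' : ∀ i, 0 ≤ t⁻¹ * κ i := fun i => mul_nonneg (inv_pos.2 htpos).le (hκ i)
  have e1 : 1 ≤ ∑' i, α i * (t⁻¹ * κ i) := by
    simp_rw [mul_left_comm _ t⁻¹]
    rw [tsum_mul_left, h2, ← div_eq_inv_mul, one_le_div htpos]
    exact min_le_left _ _
  have e2 : 1 ≤ ∑' i, β i * (t⁻¹ * κ i) := by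
    simp_rw [mul_left_comm _ t⁻¹]
    rw [tsum_mul_left, h3, ← div_eq_inv_mul, one_le_div htpos]
    exact min_le_right _ _
  have e3 : ∑' i, t⁻¹ * κ i ≤ t⁻¹ := by
    rw [tsum_mul_left]
    exact mul_le_of_le_one_right (inv_pos.2 htpos).le h1
  refine ⟨t, htpos, ⟨fun i => t⁻¹ * κ i, (D.solution_iff hκ' (hs.mul_left _)).2 ⟨⟨e1, e2⟩,
    fun κ' h0 hs' f1 f2 => e3.trans (hlb κ' h0 hs' f1 f2)⟩⟩, fun κ' h => ?_, hdual⟩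
  have hs' := D.summable_solution h
  obtain ⟨⟨f1, f2⟩, f3⟩ := (D.solution_iff h.1.1 hs').1 h
  exact le_antisymm ((f3 _ hκ' (hs.mul_left _) e1 e2).trans e3) (hlb κ' h.1.1 hs' f1 f2)

end LPData

theorem Set.two_lt_encard_iff {γ : Type*} {s : Set γ} : 2 < s.encard ↔
    ∃ i j k, i ∈ s ∧ j ∈ s ∧ k ∈ s ∧ i ≠ j ∧ i ≠ k ∧ j ≠ k := by
  constructor
  · intro h
    have h3 : (3 : ℕ∞) ≤ s.encard := by
      have := Order.add_one_le_of_lt h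
      rwa [show (2 : ℕ∞) + 1 = 3 by norm_num] at this
    obtain ⟨t, hts, ht⟩ := Set.exists_subset_encard_eq h3
    obtain ⟨i, j, k, hij, hik, hjk, rfl⟩ := Set.encard_eq_three.1 ht
    exact ⟨i, j, k, hts (by simp), hts (by simp), hts (by simp), hij, hik, hjk⟩
  · rintro ⟨i, j, k, hi, hj, hk, hij, hik, hjk⟩
    have h3 : ({i, j, k} : Set γ).encard = 3 :=
      Set.encard_eq_three.2 ⟨i, j, k, hij, hik, hjk, rfl⟩
    have hsub : ({i, j, k} : Set γ) ⊆ s := by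
      rintro m (rfl | rfl | rfl) <;> assumption
    refine lt_of_lt_of_le ?_ (h3 ▸ Set.encard_le_encard hsub)
    norm_num

/-! ### Consequences of uniqueness: support, dual positivity, slackness, reduced costs -/

namespace LPData

variable {α β κ : ℕ → ℝ}

theorem eventually_pos_add_mul {a b : ℝ} (ha : 0 < a) :
    ∀ᶠ ε in 𝓝[>] (0 : ℝ), 0 < a + ε * b := by
  have h : Tendsto (fun ε : ℝ => a + ε * b) (𝓝[>] 0) (𝓝 (a + 0 * b)) :=
    (Continuous.tendsto (by fun_prop) 0).mono_left nhdsWithin_le_nhds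
  exact h.eventually_const_lt (by simpa using ha)

/-- A unique solution admits no non-zero feasible direction along which the cost does not
increase. -/
theorem direction_eq_zero (D : LPData α β) (h : LPUniqueSolution α β κ) {d : ℕ → ℝ}
    (hfin : d.support.Finite) (h0 : ∀ i, 0 < κ i ∨ 0 ≤ d i)
    (h1 : 1 < ∑' i, α i * κ i ∨ 0 ≤ ∑' i, α i * d i)
    (h2 : 1 < ∑' i, β i * κ i ∨ 0 ≤ ∑' i, β i * d i) (h3 : ∑' i, d i ≤ 0) : d = 0 := by
  have hs := D.summable_solution h.1
  obtain ⟨⟨f1, f2⟩, f3⟩ := (D.solution_iff h.1.1.1 hs).1 h.1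
  have hκ := h.1.1.1
  have hd : Summable d := summable_of_hasFiniteSupport hfin
  have hmul : ∀ f : ℕ → ℝ, Summable fun i => f i * d i := fun f =>
    summable_of_hasFiniteSupport (hfin.subset fun i hi => right_ne_zero_of_mul hi)
  have hα := Summable.mul_of_nonneg_pointwise D.nonneg_left hκ D.summable_left hs
  have hβ := Summable.mul_of_nonneg_pointwise D.nonneg_right hκ D.summable_right hs
  have slack : ∀ f : ℕ → ℝ, Summable (fun i => f i * κ i) → 1 ≤ ∑' i, f i * κ i →
      (1 < ∑' i, f i * κ i ∨ 0 ≤ ∑' i, f i * d i) →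
      ∀ᶠ ε in 𝓝[>] (0 : ℝ), 1 ≤ ∑' i, f i * (κ i + ε * d i) := by
    intro f hf hle hor
    have e : ∀ ε : ℝ, ∑' i, f i * (κ i + ε * d i) =
        ∑' i, f i * κ i + ε * ∑' i, f i * d i := fun ε => by
      rw [← tsum_mul_left, ← hf.tsum_add ((hmul f).mul_left ε)]
      exact tsum_congr fun i => by ring
    simp_rw [e]
    rcases hor with hlt | hge
    · filter_upwards [eventually_pos_add_mul (b := ∑' i, f i * d i) (sub_pos.2 hlt)] with ε hε
      linarith
    · filter_upwards [self_mem_nhdsWithin] with ε hε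
      have : 0 < ε := hε
      nlinarith
  have hnn : ∀ᶠ ε in 𝓝[>] (0 : ℝ), ∀ i ∈ d.support, 0 ≤ κ i + ε * d i := by
    rw [eventually_all_finite hfin]
    intro i _
    rcases h0 i with hi | hi
    · exact (eventually_pos_add_mul hi).mono fun _ h => h.le
    · filter_upwards [self_mem_nhdsWithin] with ε hε
      have : 0 < ε := hε
      have := hκ i
      positivity
  -- For small `ε > 0` the perturbation `κ + ε d` is feasible and no costlier, hence again a
  -- solution, and uniqueness gives `ε d = 0`.
  obtain ⟨ε, g1, g2, g3, g4⟩ := ((slack α hα f1 h1).and ((slack β hβ f2 h2).and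
    (hnn.and self_mem_nhdsWithin))).exists
  have hε : 0 < ε := g4
  have hκ' : ∀ i, 0 ≤ κ i + ε * d i := fun i => by
    by_cases hi : d i = 0
    · simpa [hi] using hκ i
    · exact g3 i hi
  have hs' : Summable fun i => κ i + ε * d i := hs.add (hd.mul_left ε)
  have hcost : ∑' i, (κ i + ε * d i) ≤ ∑' i, κ i := by
    rw [hs.tsum_add (hd.mul_left ε), tsum_mul_left]
    nlinarith
  have hsol := (D.solution_iff hκ' hs').2 ⟨⟨g1, g2⟩, fun κ' a b c e => hcost.trans (f3 κ' a b c e)⟩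
  funext i
  have := congrFun (h.2 _ hsol) i
  simp only [add_eq_left, mul_eq_zero, hε.ne', false_or] at this
  exact this

/-- Three coordinates suffice for every later perturbation. When fewer are moved, a dummy index with
coefficient `0` fills the free slot. -/
theorem direction_three_eq_zero (D : LPData α β) (h : LPUniqueSolution α β κ) {i j k : ℕ}
    (hij : i ≠ j) (hik : i ≠ k) (hjk : j ≠ k) {a b c : ℝ} (hi : 0 < κ i ∨ 0 ≤ a)
    (hj : 0 < κ j ∨ 0 ≤ b) (hk : 0 < κ k ∨ 0 ≤ c)
    (h1 : 1 < ∑' i, α i * κ i ∨ 0 ≤ α i * a + α j * b + α k * c)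
    (h2 : 1 < ∑' i, β i * κ i ∨ 0 ≤ β i * a + β j * b + β k * c) (h3 : a + b + c ≤ 0) :
    a = 0 ∧ b = 0 ∧ c = 0 := by
  let d : ℕ → ℝ := fun m => if m = i then a else if m = j then b else if m = k then c else 0
  have hsupp : d.support ⊆ ({i, j, k} : Finset ℕ) := fun m hm => by
    by_contra hne
    simp only [Finset.coe_insert, Finset.coe_singleton, Set.mem_insert_iff,
      Set.mem_singleton_iff, not_or] at hne
    exact hm (by simp [d, hne])
  have hsum : ∀ f : ℕ → ℝ, ∑' m, f m * d m = f i * a + f j * b + f k * c := fun f => by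
    rw [tsum_eq_sum (s := {i, j, k}) fun m hm => by
      rw [show d m = 0 from by_contra fun hne => hm (hsupp hne), mul_zero]]
    rw [Finset.sum_insert (by simp [hij, hik]), Finset.sum_pair hjk]
    simp [d, hij.symm, hik.symm, hjk.symm, add_assoc]
  have hd : d = 0 := D.direction_eq_zero h ((Finset.finite_toSet _).subset hsupp)
    (fun m => by
      simp only [d]
      split_ifs with e1 e2 e3
      · exact e1 ▸ hi
      · exact e2 ▸ hj
      · exact e3 ▸ hk
      · exact Or.inr le_rfl)
    (by rwa [hsum]) (by rwa [hsum]) (by simpa using (hsum 1).trans_le (by simpa using h3))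
  have e1 := congrFun hd i
  have e2 := congrFun hd j
  have e3 := congrFun hd k
  simp only [d, if_true, Pi.zero_apply, hij.symm, hik.symm, hjk.symm, if_false] at e1 e2 e3
  exact ⟨e1, e2, e3⟩

theorem encard_pos_le_two (D : LPData α β) (h : LPUniqueSolution α β κ) :
    {i | 0 < κ i}.encard ≤ 2 := by
  by_contra hgt
  rw [not_le] at hgt
  obtain ⟨i, j, k, hi, hj, hk, hij, hik, hjk⟩ := Set.two_lt_encard_iff.1 hgt
  -- Two constraints on three positive coordinates leave a non-zero direction preserving both; it or
  -- its negative does not raise the cost. The zero third row only makes the matrix square.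
  obtain ⟨v, hv, hv0⟩ := Matrix.exists_mulVec_eq_zero_iff.2
    (show (!![α i, α j, α k; β i, β j, β k; 0, 0, 0] : Matrix (Fin 3) (Fin 3) ℝ).det = 0 by
      simp [Matrix.det_fin_three])
  have e1 := congrFun hv0 0
  have e2 := congrFun hv0 1
  simp only [Matrix.mulVec, dotProduct, Fin.sum_univ_three, Matrix.of_apply, Matrix.cons_val,
    Pi.zero_apply] at e1 e2
  have key : v 0 = 0 ∧ v 1 = 0 ∧ v 2 = 0 := by
    rcases le_total (v 0 + v 1 + v 2) 0 with hle | hle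
    · exact D.direction_three_eq_zero h hij hik hjk (Or.inl hi) (Or.inl hj) (Or.inl hk)
        (Or.inr e1.ge) (Or.inr e2.ge) hle
    · have := D.direction_three_eq_zero h hij hik hjk (a := - v 0) (b := - v 1) (c := - v 2)
        (Or.inl hi) (Or.inl hj) (Or.inl hk)
        (Or.inr (by linarith)) (Or.inr (by linarith)) (by linarith)
      simpa using this
  refine hv (funext fun m => ?_)
  fin_cases m
  exacts [key.1, key.2.1, key.2.2]

theorem eq_zero_of_two_pos (D : LPData α β) (h : LPUniqueSolution α β κ) {i j m : ℕ}
    (hij : i ≠ j) (hi : 0 < κ i) (hj : 0 < κ j) (hmi : m ≠ i) (hmj : m ≠ j) : κ m = 0 := by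
  by_contra hm
  exact (D.encard_pos_le_two h).not_gt (Set.two_lt_encard_iff.2
    ⟨i, j, m, hi, hj, (h.1.1.1 m).lt_of_ne' hm, hij, hmi.symm, hmj.symm⟩)

theorem tsum_mul_of_two_pos (D : LPData α β) (h : LPUniqueSolution α β κ) {i j : ℕ}
    (hij : i ≠ j) (hi : 0 < κ i) (hj : 0 < κ j) (f : ℕ → ℝ) :
    ∑' m, f m * κ m = f i * κ i + f j * κ j := by
  rw [tsum_eq_sum (s := {i, j}) fun m hm => ?_, Finset.sum_pair hij]
  simp only [Finset.mem_insert, Finset.mem_singleton, not_or] at hm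
  rw [D.eq_zero_of_two_pos h hij hi hj hm.1 hm.2, mul_zero]

/-- If the two coefficient pairs were linearly dependent, a non-zero exchange between coordinates
`i` and `j` would preserve both constraints, and one of its two signs would not raise the cost. -/
theorem det_ne_zero_of_two_pos (D : LPData α β) (h : LPUniqueSolution α β κ) {i j : ℕ}
    (hij : i ≠ j) (hi : 0 < κ i) (hj : 0 < κ j) : α i * β j - α j * β i ≠ 0 := by
  intro hdet
  obtain ⟨v, hv, hv0⟩ := Matrix.exists_mulVec_eq_zero_iff.2
    (show (!![α i, α j; β i, β j] : Matrix (Fin 2) (Fin 2) ℝ).det = 0 by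
      simpa [Matrix.det_fin_two] using hdet)
  have e1 := congrFun hv0 0
  have e2 := congrFun hv0 1
  simp only [Matrix.mulVec, dotProduct, Fin.sum_univ_two, Matrix.of_apply, Matrix.cons_val,
    Pi.zero_apply] at e1 e2
  have hik : i ≠ i + j + 1 := by omega
  have hjk : j ≠ i + j + 1 := by omega
  have key : v 0 = 0 ∧ v 1 = 0 := by
    rcases le_total (v 0 + v 1) 0 with hle | hle
    · have := D.direction_three_eq_zero h hij hik hjk (a := v 0) (b := v 1) (c := 0)
        (Or.inl hi) (Or.inl hj) (Or.inr le_rfl)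
        (Or.inr (by linarith)) (Or.inr (by linarith)) (by linarith)
      exact ⟨this.1, this.2.1⟩
    · have := D.direction_three_eq_zero h hij hik hjk (a := - v 0) (b := - v 1) (c := 0)
        (Or.inl hi) (Or.inl hj) (Or.inr le_rfl)
        (Or.inr (by linarith)) (Or.inr (by linarith)) (by linarith)
      exact ⟨neg_eq_zero.1 this.1, neg_eq_zero.1 this.2.1⟩
  refine hv (funext fun m => ?_)
  fin_cases m
  exacts [key.1, key.2]

/-- The quotient is the shadow price of the first constraint: the direction `(β j, -β i) / Δ` raises
that constraint by one, keeps the second, and has exactly this cost. A non-positive price would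
contradict uniqueness. -/
theorem dual_left_pos (D : LPData α β) (h : LPUniqueSolution α β κ) {i j : ℕ}
    (hij : i ≠ j) (hi : 0 < κ i) (hj : 0 < κ j) :
    0 < (β j - β i) / (α i * β j - α j * β i) := by
  have hdet := D.det_ne_zero_of_two_pos h hij hi hj
  set Δ := α i * β j - α j * β i with hΔ
  by_contra hneg
  have := D.direction_three_eq_zero h hij (k := i + j + 1) (by omega) (by omega)
    (a := β j / Δ) (b := - β i / Δ) (c := 0) (Or.inl hi) (Or.inl hj) (Or.inr le_rfl)
    (Or.inr ?_) (Or.inr ?_) ?_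
  · have hb1 : β j = 0 := by simpa [hdet] using this.1
    have hb2 : β i = 0 := by simpa [hdet] using this.2.1
    exact hdet (by rw [hΔ, hb1, hb2]; ring)
  · refine le_of_le_of_eq zero_le_one ?_
    field_simp
    rw [hΔ]
    ring
  · refine le_of_eq ?_
    field_simp
    ring
  · refine le_of_eq_of_le ?_ (not_lt.1 hneg)
    ring

end LPData

theorem LPData.symm {α β : ℕ → ℝ} (D : LPData α β) : LPData β α :=
  ⟨D.2, D.1, D.4, D.3, D.6, D.5⟩

theorem LPFeasible.symm {α β κ : ℕ → ℝ} (h : LPFeasible α β κ) : LPFeasible β α κ :=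
  ⟨h.1, h.2.2, h.2.1⟩

theorem LPSolution.symm {α β κ : ℕ → ℝ} (h : LPSolution α β κ) : LPSolution β α κ :=
  ⟨h.1.symm, fun κ' h' => h.2 κ' h'.symm⟩

theorem LPUniqueSolution.symm {α β κ : ℕ → ℝ} (h : LPUniqueSolution α β κ) :
    LPUniqueSolution β α κ :=
  ⟨h.1.symm, fun κ' h' => h.2 κ' h'.symm⟩

namespace LPData

variable {α β κ : ℕ → ℝ}

theorem dual_right_pos (D : LPData α β) (h : LPUniqueSolution α β κ) {i j : ℕ}
    (hij : i ≠ j) (hi : 0 < κ i) (hj : 0 < κ j) :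
    0 < (α i - α j) / (α i * β j - α j * β i) := by
  have := D.symm.dual_left_pos h.symm hij hi hj
  rwa [show (α j - α i) / (β i * α j - β j * α i) = (α i - α j) / (α i * β j - α j * β i) by
    rw [← neg_div_neg_eq]; ring_nf] at this

/-- Bring in index `m` with weight one and compensate on `i` and `j` by Cramer's rule so that both
constraints are kept. The cost changes by one minus the left side, which uniqueness forces to be
positive. -/
theorem reduced_cost_lt_one (D : LPData α β) (h : LPUniqueSolution α β κ) {i j m : ℕ}
    (hij : i ≠ j) (hi : 0 < κ i) (hj : 0 < κ j) (hmi : m ≠ i) (hmj : m ≠ j) :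
    (α m * (β j - β i) + β m * (α i - α j)) / (α i * β j - α j * β i) < 1 := by
  have hdet := D.det_ne_zero_of_two_pos h hij hi hj
  set Δ := α i * β j - α j * β i with hΔ
  by_contra hneg
  have := D.direction_three_eq_zero h hij hmi.symm hmj.symm
    (a := - (α m * β j - α j * β m) / Δ) (b := - (α i * β m - α m * β i) / Δ) (c := 1)
    (Or.inl hi) (Or.inl hj) (Or.inr zero_le_one)
    (Or.inr ?_) (Or.inr ?_) ?_
  · exact one_ne_zero this.2.2
  · refine le_of_eq ?_
    field_simp
    rw [hΔ]
    ring
  · refine le_of_eq ?_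
    field_simp
    rw [hΔ]
    ring
  · have := not_lt.1 hneg
    have e : - (α m * β j - α j * β m) / Δ + - (α i * β m - α m * β i) / Δ =
      - ((α m * (β j - β i) + β m * (α i - α j)) / Δ) := by ring
    linarith

/-- Complementary slackness: a slack first constraint could be lowered at fixed second constraint,
saving its positive shadow price. -/
theorem tight_left_of_two_pos (D : LPData α β) (h : LPUniqueSolution α β κ) {i j : ℕ}
    (hij : i ≠ j) (hi : 0 < κ i) (hj : 0 < κ j) : α i * κ i + α j * κ j = 1 := by
  have hdet := D.det_ne_zero_of_two_pos h hij hi hj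
  have hs := D.summable_solution h.1
  have hle := ((D.feasible_iff h.1.1.1 hs).1 h.1.1).1
  have hy := D.dual_left_pos h hij hi hj
  set Δ := α i * β j - α j * β i with hΔ
  rw [← D.tsum_mul_of_two_pos h hij hi hj α]
  refine le_antisymm (le_of_not_gt fun hlt => ?_) hle
  have := D.direction_three_eq_zero h hij (k := i + j + 1) (by omega) (by omega)
    (a := - β j / Δ) (b := β i / Δ) (c := 0) (Or.inl hi) (Or.inl hj) (Or.inr le_rfl)
    (Or.inl hlt) (Or.inr ?_) ?_
  · have hb1 : β j = 0 := by simpa [hdet] using this.1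
    have hb2 : β i = 0 := by simpa [hdet] using this.2.1
    exact hdet (by rw [hΔ, hb1, hb2]; ring)
  · refine le_of_eq ?_
    field_simp
    ring
  · have e : - β j / Δ + β i / Δ + 0 = - ((β j - β i) / Δ) := by ring
    linarith

theorem tight_right_of_two_pos (D : LPData α β) (h : LPUniqueSolution α β κ) {i j : ℕ}
    (hij : i ≠ j) (hi : 0 < κ i) (hj : 0 < κ j) : β i * κ i + β j * κ j = 1 :=
  D.symm.tight_left_of_two_pos h.symm hij hi hj

theorem tsum_mul_of_one_pos {i : ℕ} (hz : ∀ j, j ≠ i → κ j = 0) (f : ℕ → ℝ) :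
    ∑' m, f m * κ m = f i * κ i :=
  tsum_eq_single i fun m hm => by rw [hz m hm, mul_zero]

theorem one_le_of_one_pos (D : LPData α β) (h : LPUniqueSolution α β κ) {i : ℕ}
    (hz : ∀ j, j ≠ i → κ j = 0) : 1 ≤ α i * κ i ∧ 1 ≤ β i * κ i := by
  have := (D.feasible_iff h.1.1.1 (D.summable_solution h.1)).1 h.1.1
  rwa [tsum_mul_of_one_pos hz, tsum_mul_of_one_pos hz] at this

/-- Since `β i ≤ α i`, the second constraint is the harder one; if it were slack, both would be, and
`κ i` could be decreased. -/
theorem min_mul_eq_one_of_one_pos (D : LPData α β) (h : LPUniqueSolution α β κ) {i : ℕ}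
    (hi : 0 < κ i) (hz : ∀ j, j ≠ i → κ j = 0) (hle : β i ≤ α i) : β i * κ i = 1 := by
  obtain ⟨h1, h2⟩ := D.one_le_of_one_pos h hz
  refine le_antisymm (le_of_not_gt fun hlt => ?_) h2
  have := D.direction_three_eq_zero h (i := i) (j := i + 1) (k := i + 2) (by omega) (by omega)
    (by omega) (a := -1) (b := 0) (c := 0) (Or.inl hi) (Or.inr le_rfl) (Or.inr le_rfl)
    (Or.inl (by rw [tsum_mul_of_one_pos hz]; nlinarith))
    (Or.inl (by rwa [tsum_mul_of_one_pos hz])) (by norm_num)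
  norm_num at this

theorem right_lt_of_one_pos (D : LPData α β) (h : LPUniqueSolution α β κ) {i j : ℕ}
    (hi : 0 < κ i) (hz : ∀ j, j ≠ i → κ j = 0) (hlt : β i < α i) (hj : j ≠ i) : β j < β i := by
  have h2 := D.min_mul_eq_one_of_one_pos h hi hz hlt.le
  by_contra hge
  -- Moving mass from `i` to `j` is free of cost. The first constraint is slack because `β i * κ i =
  -- 1` and `β i < α i`, so only the second could object, and `β i ≤ β j` removes that.
  have := D.direction_three_eq_zero h (i := i) (j := j) (k := i + j + 1) hj.symm (by omega)
    (by omega) (a := -1) (b := 1) (c := 0) (Or.inl hi) (Or.inr zero_le_one) (Or.inr le_rfl)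
    (Or.inl (by rw [tsum_mul_of_one_pos hz]; nlinarith))
    (Or.inr (by linarith)) (by norm_num)
  norm_num at this

/-- If a single variable carries the unique solution with both constraints tight, then there are
dual weights for which all other coefficients stay uniformly below. -/
theorem exists_weight_of_one_pos (D : LPData α β) (h : LPUniqueSolution α β κ) {i : ℕ}
    (hi : 0 < κ i) (hz : ∀ j, j ≠ i → κ j = 0) (heq : α i = β i) :
    ∃ l : ℝ, 0 ≤ l ∧ l ≤ 1 ∧ ∃ p < β i, ∀ m, m ≠ i → l * α m + (1 - l) * β m ≤ p := by
  have hβκ := D.min_mul_eq_one_of_one_pos h hi hz heq.ge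
  have hβi : 0 < β i := pos_of_mul_pos_left (hβκ ▸ one_pos) hi.le
  obtain ⟨N, -, hN⟩ := D.exists_forall_ge_le (half_pos hβi) 0
  -- Zeroing the pair `i` turns it into the origin, already a vertex. If the remaining pairs reached
  -- `(β i, β i)`, their weights times `κ i` would be a solution avoiding `i` at no greater cost,
  -- contrary to uniqueness.
  obtain ⟨l, hl0, hl1, p, hp, hm⟩ := exists_weight_of_disjoint_coeffHull
      (α := Function.update α i 0) (β := Function.update β i 0) (N := N) hβi fun q hq hle => by
    obtain ⟨κ', h0, hs, h1, h2, h3⟩ := exists_weights_of_mem_coeffHull hq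
    have key : ∀ f : ℕ → ℝ, ∑' m, f m * Function.update (fun m => κ i * κ' m) i 0 m =
        κ i * ∑' m, Function.update f i 0 m * κ' m := fun f => by
      rw [← tsum_mul_left]
      refine tsum_congr fun m => ?_
      by_cases hmi : m = i
      · simp [hmi]
      · simp only [Function.update_of_ne hmi]
        ring
    have h0' : ∀ m, 0 ≤ Function.update (fun m => κ i * κ' m) i 0 m := fun m => by
      by_cases hmi : m = i
      · simp [hmi]
      · simp only [Function.update_of_ne hmi]
        exact mul_nonneg hi.le (h0 m)
    have hs' : Summable (Function.update (fun m => κ i * κ' m) i 0) :=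
      Summable.of_nonneg_of_le h0' (fun m => by
        by_cases hmi : m = i
        · simpa [hmi] using mul_nonneg hi.le (h0 i)
        · simp only [Function.update_of_ne hmi]
          exact le_rfl) (hs.mul_left (κ i))
    have hsol : LPSolution α β (Function.update (fun m => κ i * κ' m) i 0) := by
      refine (D.solution_iff h0' hs').2 ⟨⟨?_, ?_⟩, fun κ'' a b c e => ?_⟩
      · rw [key, h2]
        nlinarith [hle.1]
      · rw [key, h3]
        nlinarith [hle.2]
      · refine le_trans ?_ (((D.solution_iff h.1.1.1 (D.summable_solution h.1)).1 h.1).2 κ'' a b c e)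
        have e1 : ∑' m, κ m = κ i := tsum_eq_single i hz
        rw [e1]
        calc ∑' m, Function.update (fun m => κ i * κ' m) i 0 m ≤ ∑' m, κ i * κ' m :=
              hs'.tsum_le_tsum (fun m => by
                by_cases hmi : m = i
                · simpa [hmi] using mul_nonneg hi.le (h0 i)
                · simp only [Function.update_of_ne hmi]
                  exact le_rfl) (hs.mul_left (κ i))
          _ ≤ κ i := by
              rw [tsum_mul_left]
              exact mul_le_of_le_one_right hi.le h1
    have := congrFun (h.2 _ hsol) i
    simp only [Function.update_self] at this
    exact hi.ne this
  refine ⟨l, hl0, hl1, max p (β i / 2), max_lt hp (by linarith), fun m hmi => ?_⟩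
  rcases lt_or_ge m N with hmN | hmN
  · have := hm m hmN
    simp only [Function.update_of_ne hmi] at this
    exact this.trans (le_max_left _ _)
  · obtain ⟨ha, hb⟩ := hN m hmN
    exact le_trans (by nlinarith) (le_max_right _ _)

end LPData

/-! ### Regularly varying tails of index `-1` -/

/-- A tail function `x ↦ P(X > x)` that is regularly varying with index `-1`. -/
structure HeavyTail (T : ℝ → ℝ) : Prop where
  anti : Antitone T
  nonneg : ∀ x, 0 ≤ T x
  le_one : ∀ x, T x ≤ 1
  tendsto_zero : Tendsto T atTop (𝓝 0)
  rightCont : ∀ x, ContinuousWithinAt T (Set.Ici x) x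
  rv : IsRegularlyVarying T (-1)

theorem IsRegularlyVaryingRV.heavyTail {Ω : Type*} [MeasurableSpace Ω] {P : Measure Ω}
    [IsProbabilityMeasure P] {X : Ω → ℝ} (hX : Measurable X) (h : IsRegularlyVaryingRV P X (-1)) :
    HeavyTail fun x => P.real {ω | x < X ω} := by
  have hprob : IsProbabilityMeasure (P.map X) := Measure.isProbabilityMeasure_map hX.aemeasurable
  have e : (fun x => P.real {ω | x < X ω}) = fun x => 1 - cdf (P.map X) x := by
    funext x
    rw [cdf_eq_real, map_measureReal_apply hX measurableSet_Iic,
      ← probReal_compl_eq_one_sub (hX measurableSet_Iic)]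
    congr 1
    ext ω
    simp
  refine ⟨fun x y hxy => measureReal_mono fun ω (hω : y < X ω) => hxy.trans_lt hω,
    fun _ => measureReal_nonneg, fun _ => measureReal_le_one, ?_, fun x => ?_, h⟩
  · rw [e]
    simpa using (tendsto_cdf_atTop (P.map X)).const_sub 1
  · rw [e]
    exact continuousWithinAt_const.sub ((cdf (P.map X)).right_continuous x)

/-! ### Potter bounds and the scaled quantile coupling -/

namespace HeavyTail

variable {T : ℝ → ℝ}

theorem pos (h : HeavyTail T) (x : ℝ) : 0 < T x := by
  obtain ⟨y, hy, hxy⟩ := (h.rv.2.1.and (eventually_ge_atTop x)).exists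
  exact hy.trans_le (h.anti hxy)

/-- The ratio `T (2 x) / T x` tends to `1 / 2`, so it eventually lies between `2 ^ (-(1 + δ))` and
`2 ^ (-(1 - δ))`; iterate along powers of two. -/
theorem exists_doubling (h : HeavyTail T) {δ : ℝ} (hδ : 0 < δ) :
    ∃ t₀ : ℝ, 0 < t₀ ∧ (∀ x, t₀ ≤ x → ∀ n : ℕ, T (2 ^ n * x) ≤ ((2 : ℝ) ^ n) ^ (-(1 - δ)) * T x) ∧
      ∀ x, t₀ ≤ x → ∀ n : ℕ, T x ≤ ((2 : ℝ) ^ n) ^ (1 + δ) * T (2 ^ n * x) := by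
  have h2 := h.rv.2.2 2 two_pos
  have hlt : (2 : ℝ) ^ (-1 : ℝ) < 2 ^ (-(1 - δ)) :=
    Real.rpow_lt_rpow_of_exponent_lt one_lt_two (by linarith)
  have hgt : (2 : ℝ) ^ (-(1 + δ)) < 2 ^ (-1 : ℝ) :=
    Real.rpow_lt_rpow_of_exponent_lt one_lt_two (by linarith)
  obtain ⟨a, ha⟩ := ((h2.eventually_lt_const hlt).and
    (h2.eventually_const_lt hgt)).exists_forall_of_atTop
  refine ⟨max a 1, by positivity, fun x hx n => ?_, fun x hx n => ?_⟩
  · induction n with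
    | zero => simp
    | succ n ih =>
      have hx0 : 0 < x := lt_of_lt_of_le (by positivity) hx
      have hge : a ≤ 2 ^ n * x :=
        (le_max_left _ _).trans (hx.trans (le_mul_of_one_le_left hx0.le (one_le_pow₀ one_le_two)))
      have := (ha _ hge).1
      rw [div_lt_iff₀ (h.pos _), ← mul_assoc, ← pow_succ'] at this
      refine this.le.trans ((mul_le_mul_of_nonneg_left ih (by positivity)).trans_eq ?_)
      rw [← mul_assoc, ← Real.mul_rpow (by positivity) (by positivity), ← pow_succ']
  · induction n with
    | zero => simp
    | succ n ih =>
      have hx0 : 0 < x := lt_of_lt_of_le (by positivity) hx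
      have hge : a ≤ 2 ^ n * x :=
        (le_max_left _ _).trans (hx.trans (le_mul_of_one_le_left hx0.le (one_le_pow₀ one_le_two)))
      have := (ha _ hge).2
      rw [lt_div_iff₀ (h.pos _), ← mul_assoc, ← pow_succ', Real.rpow_neg two_pos.le,
        inv_mul_lt_iff₀ (by positivity)] at this
      refine ih.trans ((mul_le_mul_of_nonneg_left this.le (by positivity)).trans_eq ?_)
      rw [← mul_assoc, ← Real.mul_rpow (by positivity) (by positivity), ← pow_succ]

/-- Potter bounds, valid for all positive scaling factors. -/
theorem exists_potter (h : HeavyTail T) {δ : ℝ} (hδ : 0 < δ) (hδ1 : δ < 1) :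
    ∃ C t₀ : ℝ, 1 ≤ C ∧ 0 < t₀ ∧ ∀ t, t₀ ≤ t → ∀ c, 0 < c →
      T (c * t) ≤ C * max (c ^ (-(1 + δ))) (c ^ (-(1 - δ))) * T t := by
  obtain ⟨t₀, ht₀, hup, hlow⟩ := h.exists_doubling hδ
  have hlow' : ∀ x y, t₀ ≤ x → x ≤ y → T x ≤ (2 * (y / x)) ^ (1 + δ) * T y := by
    intro x y hx hxy
    have hx0 : 0 < x := ht₀.trans_le hx
    have hy0 : 0 < y := hx0.trans_le hxy
    obtain ⟨n, hn1, hn2⟩ := exists_nat_pow_near ((one_le_div hx0).2 hxy) one_lt_two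
    refine (hlow x hx (n + 1)).trans (mul_le_mul ?_ (h.anti ?_) (h.nonneg _) (by positivity))
    · refine Real.rpow_le_rpow (by positivity) ?_ (by linarith)
      rw [pow_succ']
      linarith
    · exact ((div_lt_iff₀ hx0).1 hn2).le
  have hTt : 1 ≤ (T t₀)⁻¹ := (one_le_inv₀ (h.pos _)).2 (h.le_one _)
  have h2δ : (1 : ℝ) ≤ 2 ^ (1 + δ) := Real.one_le_rpow one_le_two (by linarith)
  refine ⟨2 ^ (1 + δ) * (T t₀)⁻¹, t₀, one_le_mul_of_one_le_of_one_le h2δ hTt, ht₀,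
    fun t ht c hc => ?_⟩
  have ht0 : 0 < t := ht₀.trans_le ht
  have hTpos := h.pos t
  have hinv : ∀ s : ℝ, 0 < s → (2 * s) ^ (1 + δ) = 2 ^ (1 + δ) * s ^ (1 + δ) := fun s hs =>
    Real.mul_rpow two_pos.le hs.le
  rcases le_or_gt 1 c with hc1 | hc1
  · obtain ⟨n, hn1, hn2⟩ := exists_nat_pow_near hc1 (one_lt_two (α := ℝ))
    have e1 : T (c * t) ≤ ((2 : ℝ) ^ n) ^ (-(1 - δ)) * T t :=
      (h.anti (mul_le_mul_of_nonneg_right hn1 ht0.le)).trans (hup t ht n)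
    have e2 : ((2 : ℝ) ^ n) ^ (-(1 - δ)) ≤ 2 ^ (1 + δ) * c ^ (-(1 - δ)) := by
      have hle : c / 2 ≤ 2 ^ n := by
        rw [pow_succ] at hn2
        linarith
      calc ((2 : ℝ) ^ n) ^ (-(1 - δ)) ≤ (c / 2) ^ (-(1 - δ)) :=
            Real.rpow_le_rpow_of_nonpos (by positivity) hle (by linarith)
        _ = 2 ^ (1 - δ) * c ^ (-(1 - δ)) := by
            rw [Real.div_rpow hc.le two_pos.le, Real.rpow_neg two_pos.le, div_inv_eq_mul, mul_comm]
        _ ≤ 2 ^ (1 + δ) * c ^ (-(1 - δ)) := by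
            gcongr
            · norm_num
            · linarith
    refine e1.trans (mul_le_mul_of_nonneg_right (e2.trans ?_) hTpos.le)
    gcongr
    · exact le_mul_of_one_le_right (by positivity) hTt
    · exact le_max_right _ _
  · have hcinv : c ^ (-(1 + δ)) = (1 / c) ^ (1 + δ) := by
      rw [one_div, Real.inv_rpow hc.le, Real.rpow_neg hc.le]
    refine le_trans ?_ (mul_le_mul_of_nonneg_right
      (mul_le_mul_of_nonneg_left (le_max_left _ _) (by positivity)) hTpos.le)
    rw [hcinv]
    rcases le_or_gt t₀ (c * t) with hct | hct
    · have := hlow' (c * t) t hct (mul_le_of_le_one_left ht0.le hc1.le)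
      rw [hinv _ (by positivity), show t / (c * t) = 1 / c by field_simp] at this
      refine this.trans (mul_le_mul_of_nonneg_right ?_ hTpos.le)
      gcongr
      exact le_mul_of_one_le_right (by positivity) hTt
    -- Below `t₀` nothing is known about the tail except that it is at most one. The lower bound on
    -- `T t` in terms of `T t₀` compensates, and this is where `(T t₀)⁻¹` in the constant is needed.
    · have h1 := hlow' t₀ t le_rfl ht
      rw [hinv _ (by positivity)] at h1
      have h2 : (t / t₀) ^ (1 + δ) ≤ (1 / c) ^ (1 + δ) := by
        refine Real.rpow_le_rpow (by positivity) ?_ (by linarith)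
        rw [div_le_div_iff₀ ht₀ hc]
        linarith
      calc T (c * t) ≤ 1 := h.le_one _
        _ = (T t₀)⁻¹ * T t₀ := (inv_mul_cancel₀ (h.pos _).ne').symm
        _ ≤ (T t₀)⁻¹ * (2 ^ (1 + δ) * (1 / c) ^ (1 + δ) * T t) := by
            gcongr
            exact h1.trans (by gcongr)
        _ = _ := by ring

/-- The scaled quantile function: the inverse of `c ↦ T (c t) / T t`. -/
noncomputable def _root_.scaledQuantile (T : ℝ → ℝ) (t s : ℝ) : ℝ :=
  if 0 < s then sInf {c | 0 ≤ c ∧ T (c * t) / T t ≤ s} else 0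

theorem _root_.scaledQuantile_nonneg (T : ℝ → ℝ) (t s : ℝ) : 0 ≤ scaledQuantile T t s := by
  unfold scaledQuantile
  split_ifs
  exacts [Real.sInf_nonneg fun c hc => hc.1, le_rfl]

theorem _root_.scaledQuantile_le {T : ℝ → ℝ} {t s c : ℝ} (hs : 0 < s) (hc : 0 ≤ c)
    (h : T (c * t) / T t ≤ s) : scaledQuantile T t s ≤ c := by
  rw [scaledQuantile, if_pos hs]
  exact csInf_le ⟨0, fun c hc => hc.1⟩ ⟨hc, h⟩

/-- Right-continuity of `T` carries the strict inequality a little beyond `c`, which keeps the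
infimum away from `c`. This makes the distribution of the quantile exact, not merely almost
everywhere correct. -/
theorem lt_scaledQuantile_iff (h : HeavyTail T) {t s c : ℝ} (ht : 0 < t) (hs : 0 < s)
    (hc : 0 ≤ c) : c < scaledQuantile T t s ↔ s < T (c * t) / T t := by
  refine ⟨fun hlt => lt_of_not_ge fun hle => (scaledQuantile_le hs hc hle).not_gt hlt,
    fun hlt => ?_⟩
  rw [lt_div_iff₀ (h.pos t)] at hlt
  have hev : ∀ᶠ y in 𝓝[>] (c * t), s * T t < T y :=
    ((h.rightCont (c * t)).mono Set.Ioi_subset_Ici_self).eventually_const_lt hlt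
  obtain ⟨y, hy, hcy⟩ := (hev.and self_mem_nhdsWithin).exists
  have hcy : c * t < y := hcy
  rw [scaledQuantile, if_pos hs]
  refine ((lt_div_iff₀ ht).2 hcy).trans_le (le_csInf ?_ fun d hd => ?_)
  · have h0 : Tendsto (fun d : ℝ => T (d * t) / T t) atTop (𝓝 (0 / T t)) :=
      (h.tendsto_zero.comp (tendsto_id.atTop_mul_const ht)).div_const _
    rw [zero_div] at h0
    obtain ⟨d, hd1, hd2⟩ := ((h0.eventually_le_const hs).and (eventually_ge_atTop 0)).exists
    exact ⟨d, hd2, hd1⟩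
  · rw [div_le_iff₀ ht]
    by_contra hlt'
    have h1 := h.anti (not_le.1 hlt').le
    have h2 := (div_le_iff₀ (h.pos t)).1 hd.2
    linarith

theorem preimage_Ioi_scaledQuantile (h : HeavyTail T) {t c : ℝ} (ht : 0 < t) (hc : 0 ≤ c) :
    scaledQuantile T t ⁻¹' Set.Ioi c = Set.Ioo 0 (T (c * t) / T t) := by
  ext s
  simp only [Set.mem_preimage, Set.mem_Ioi, Set.mem_Ioo]
  by_cases hs : 0 < s
  · rw [h.lt_scaledQuantile_iff ht hs hc]
    simp [hs]
  · simp [scaledQuantile, hs, hc]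

theorem measurable_scaledQuantile (h : HeavyTail T) {t : ℝ} (ht : 0 < t) :
    Measurable (scaledQuantile T t) := by
  refine measurable_of_Ioi fun c => ?_
  by_cases hc : 0 ≤ c
  · rw [h.preimage_Ioi_scaledQuantile ht hc]
    exact measurableSet_Ioo
  · have : scaledQuantile T t ⁻¹' Set.Ioi c = Set.univ :=
      Set.eq_univ_of_forall fun s => (not_le.1 hc).trans_le (scaledQuantile_nonneg T t s)
    rw [this]
    exact MeasurableSet.univ

/-- The functions `c ↦ T (c t) / T t` converge to `c⁻¹`, so their generalized inverses converge to
the inverse function `s ↦ s⁻¹`. -/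
theorem tendsto_scaledQuantile (h : HeavyTail T) {s : ℝ} (hs : 0 < s) :
    Tendsto (fun t => scaledQuantile T t s) atTop (𝓝 s⁻¹) := by
  have hrv : ∀ c : ℝ, 0 < c → Tendsto (fun t => T (c * t) / T t) atTop (𝓝 c⁻¹) := fun c hc => by
    simpa [Real.rpow_neg_one] using h.rv.2.2 c hc
  refine tendsto_order.2 ⟨fun a ha => ?_, fun b hb => ?_⟩
  · obtain ⟨a', h1, h2⟩ := exists_between (max_lt ha (inv_pos.2 hs))
    have ha' : 0 < a' := (le_max_right _ _).trans_lt h1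
    filter_upwards [(hrv a' ha').eventually_const_lt ((lt_inv_comm₀ ha' hs).1 h2),
      eventually_gt_atTop 0] with t ht ht0
    exact ((le_max_left _ _).trans_lt h1).trans ((h.lt_scaledQuantile_iff ht0 hs ha'.le).2 ht)
  · obtain ⟨b', h1, h2⟩ := exists_between hb
    have hb' : 0 < b' := (inv_pos.2 hs).trans h1
    filter_upwards [(hrv b' hb').eventually_lt_const ((inv_lt_comm₀ hs hb').1 h1)] with t ht
    exact (scaledQuantile_le hs hb'.le ht.le).trans_lt h2

/-- Under `P(· ) / T t`, the law of `X / t` on `(0, ∞)` is the image of Lebesgue measure under the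
scaled quantile function. -/
theorem lintegral_comp_div {Ω : Type*} [MeasurableSpace Ω] {P : Measure Ω} [IsFiniteMeasure P]
    {X : Ω → ℝ} (hX : Measurable X) (h : HeavyTail T)
    (hT : ∀ x, P.real {ω | x < X ω} = T x) {t : ℝ} (ht : 0 < t)
    {g : ℝ → ℝ≥0∞} (hg : Measurable g) (hg0 : ∀ a ≤ 0, g a = 0) :
    ∫⁻ ω, g (X ω / t) ∂P =
      ENNReal.ofReal (T t) * ∫⁻ s in Set.Ioi 0, g (scaledQuantile T t s) := by
  have hq := h.measurable_scaledQuantile ht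
  have hvol : ∀ c, 0 ≤ c → volume.restrict (Set.Ioi 0) (scaledQuantile T t ⁻¹' Set.Ioi c) =
      ENNReal.ofReal (T (c * t) / T t) := fun c hc => by
    rw [Measure.restrict_apply (hq measurableSet_Ioi), h.preimage_Ioi_scaledQuantile ht hc,
      Set.inter_eq_left.2 Set.Ioo_subset_Ioi_self, Real.volume_Ioo, sub_zero]
  have hP : ∀ c, P ((fun ω => X ω / t) ⁻¹' Set.Ioi c) = ENNReal.ofReal (T (c * t)) := fun c => by
    rw [← hT, ofReal_measureReal]
    congr 1
    ext ω
    exact lt_div_iff₀ ht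
  -- The restriction matters: the quantile vanishes for all large `s`, so the image of Lebesgue
  -- measure has infinite mass at zero. On `(0, ∞)` both measures are finite and agree on
  -- half-lines.
  have hmeas : (P.map fun ω => X ω / t).restrict (Set.Ioi 0) = ENNReal.ofReal (T t) •
      ((volume.restrict (Set.Ioi 0)).map (scaledQuantile T t)).restrict (Set.Ioi 0) := by
    refine Measure.ext_of_Ioc' _ _ (fun a b _ => ?_) fun a b hab => ?_
    · exact measure_ne_top _ _
    · have e : Set.Ioc a b ∩ Set.Ioi 0 = Set.Ioi (max a 0) \ Set.Ioi (max b 0) := by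
        ext x
        simp only [Set.mem_inter_iff, Set.mem_Ioc, Set.mem_Ioi, Set.mem_sdiff, max_lt_iff, not_and,
          not_lt]
        grind
      have hsub : Set.Ioi (max b 0) ⊆ Set.Ioi (max a 0) :=
        Set.Ioi_subset_Ioi (max_le_max hab.le le_rfl)
      have m1 : ∀ c, 0 ≤ c → (P.map fun ω => X ω / t) (Set.Ioi c) = ENNReal.ofReal (T (c * t)) :=
        fun c _ => by rw [Measure.map_apply (hX.div_const t) measurableSet_Ioi, hP]
      have m2 : ∀ c, 0 ≤ c → ((volume.restrict (Set.Ioi 0)).map (scaledQuantile T t)) (Set.Ioi c) =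
          ENNReal.ofReal (T (c * t) / T t) :=
        fun c hc => by rw [Measure.map_apply hq measurableSet_Ioi, hvol c hc]
      rw [Measure.smul_apply, Measure.restrict_apply measurableSet_Ioc,
        Measure.restrict_apply measurableSet_Ioc, e,
        measure_sdiff hsub measurableSet_Ioi.nullMeasurableSet (measure_ne_top _ _),
        measure_sdiff hsub measurableSet_Ioi.nullMeasurableSet
          (by rw [m2 _ (le_max_right _ _)]; exact ENNReal.ofReal_ne_top),
        m1 _ (le_max_right _ _), m1 _ (le_max_right _ _), m2 _ (le_max_right _ _),
        m2 _ (le_max_right _ _), smul_eq_mul, ENNReal.mul_sub (fun _ _ => ENNReal.ofReal_ne_top),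
        ← ENNReal.ofReal_mul (h.nonneg t), ← ENNReal.ofReal_mul (h.nonneg t),
        mul_div_cancel₀ _ (h.pos t).ne', mul_div_cancel₀ _ (h.pos t).ne']
  have hind : ∀ ν : Measure ℝ, ∫⁻ a, g a ∂ν = ∫⁻ a in Set.Ioi 0, g a ∂ν := fun ν => by
    rw [← lintegral_indicator measurableSet_Ioi]
    refine lintegral_congr fun a => ?_
    by_cases ha : 0 < a
    · simp [ha]
    · simp [ha, hg0 a (not_lt.1 ha)]
  rw [← lintegral_map hg (hX.div_const t), ← lintegral_map hg hq, hind, hind (Measure.map _ _),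
    hmeas, lintegral_smul_measure, smul_eq_mul]

end HeavyTail

theorem lintegral_Ioc_div_rpow_lt_top {C p : ℝ} (hC : 0 < C) (hp : p < 1) :
    ∫⁻ s in Set.Ioc 0 C, ENNReal.ofReal ((C / s) ^ p) < ∞ := by
  have h1 : IntegrableOn (fun s : ℝ => C ^ p * s ^ (-p)) (Set.Ioc 0 C) := by
    rw [← intervalIntegrable_iff_integrableOn_Ioc_of_le hC.le]
    exact (intervalIntegral.intervalIntegrable_rpow' (by linarith)).const_mul _
  refine lt_of_le_of_lt (setLIntegral_mono_ae' measurableSet_Ioc (ae_of_all _ fun s hs => ?_))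
    h1.lintegral_lt_top
  rw [Real.div_rpow hC.le hs.1.le, Real.rpow_neg hs.1.le, div_eq_mul_inv]

theorem lintegral_Ioi_div_rpow_lt_top {C p : ℝ} (hC : 0 < C) (hp : 1 < p) :
    ∫⁻ s in Set.Ioi C, ENNReal.ofReal ((C / s) ^ p) < ∞ := by
  have h1 : IntegrableOn (fun s : ℝ => C ^ p * s ^ (-p)) (Set.Ioi C) :=
    (integrableOn_Ioi_rpow_of_lt (by linarith) hC).const_mul _
  refine lt_of_le_of_lt (setLIntegral_mono_ae' measurableSet_Ioi (ae_of_all _ fun s hs => ?_))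
    h1.lintegral_lt_top
  have hs0 : 0 < s := hC.trans hs
  rw [Real.div_rpow hC.le hs0.le, Real.rpow_neg hs0.le, div_eq_mul_inv]

namespace HeavyTail

variable {T : ℝ → ℝ}

/-- The scaled quantile functions are eventually dominated, in a sense that makes the powers
`1 - η` (near infinity) and `1 + η` (near zero) integrable. -/
theorem exists_scaledQuantile_bound (h : HeavyTail T) {η : ℝ} (hη : 0 < η) (hη1 : η < 1) :
    ∃ (t₀ : ℝ) (g : ℝ → ℝ≥0∞), 0 < t₀ ∧ Measurable g ∧ ∫⁻ s in Set.Ioi 0, g s < ∞ ∧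
      ∀ t, t₀ ≤ t → ∀ s, 0 < s →
        ENNReal.ofReal (min (scaledQuantile T t s ^ (1 - η)) (scaledQuantile T t s ^ (1 + η)))
          ≤ g s := by
  -- Potter's exponent `η / 2` is smaller than `η`, so `(1 - η) / (1 - δ) < 1` gives integrability
  -- near zero and `(1 + η) / (1 + δ) > 1` gives it near infinity.
  obtain ⟨C, t₀, hC, ht₀, hpot⟩ := h.exists_potter (half_pos hη) (by linarith)
  have hC0 : 0 < C := one_pos.trans_le hC
  set δ := η / 2 with hδ
  have hbound : ∀ t, t₀ ≤ t → ∀ s, 0 < s → ∀ M, 0 < M → M ^ (-(1 + δ)) ≤ s / C →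
      M ^ (-(1 - δ)) ≤ s / C → scaledQuantile T t s ≤ M := by
    intro t ht s hs M hM h1 h2
    refine scaledQuantile_le hs hM.le ((div_le_iff₀ (h.pos t)).2 ((hpot t ht M hM).trans ?_))
    refine mul_le_mul_of_nonneg_right ?_ (h.nonneg t)
    have := (le_div_iff₀ hC0).1 (max_le h1 h2)
    linarith
  have hinv : ∀ s : ℝ, 0 < s → ∀ r : ℝ, 0 < r → ((C / s) ^ (1 / r)) ^ (-r) = s / C := by
    intro s hs r hr
    rw [← Real.rpow_mul (by positivity), show 1 / r * -r = -1 by field_simp, Real.rpow_neg_one,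
      inv_div]
  -- Inverting Potter's bound estimates the quantile by `(C / s) ^ (1 / (1 - δ))` for `s ≤ C` and by
  -- `(C / s) ^ (1 / (1 + δ))` for `s > C`, according to which of the two powers is larger.
  let g : ℝ → ℝ≥0∞ := fun s =>
    (Set.Ioc 0 C).indicator (fun s => ENNReal.ofReal ((C / s) ^ ((1 - η) / (1 - δ)))) s +
    (Set.Ioi C).indicator (fun s => ENNReal.ofReal ((C / s) ^ ((1 + η) / (1 + δ)))) s
  have hm1 : Measurable fun s : ℝ => ENNReal.ofReal ((C / s) ^ ((1 - η) / (1 - δ))) := by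
    fun_prop
  have hm2 : Measurable fun s : ℝ => ENNReal.ofReal ((C / s) ^ ((1 + η) / (1 + δ))) := by
    fun_prop
  refine ⟨t₀, g, ht₀, (hm1.indicator measurableSet_Ioc).add (hm2.indicator measurableSet_Ioi),
    ?_, fun t ht s hs => ?_⟩
  · rw [lintegral_add_left (hm1.indicator measurableSet_Ioc),
      lintegral_indicator measurableSet_Ioc, lintegral_indicator measurableSet_Ioi]
    refine ENNReal.add_lt_top.2 ⟨?_, ?_⟩
    · exact (lintegral_mono' (Measure.restrict_mono le_rfl Measure.restrict_le_self) le_rfl).trans_lt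
        (lintegral_Ioc_div_rpow_lt_top hC0 ((div_lt_one (by linarith)).2 (by linarith)))
    · exact (lintegral_mono' (Measure.restrict_mono le_rfl Measure.restrict_le_self) le_rfl).trans_lt
        (lintegral_Ioi_div_rpow_lt_top hC0 ((one_lt_div (by linarith)).2 (by linarith)))
  · have hq0 := scaledQuantile_nonneg T t s
    rcases le_or_gt s C with hsC | hsC
    · have h1 : 1 ≤ C / s := (one_le_div hs).2 hsC
      have hM1 : 1 ≤ (C / s) ^ (1 / (1 - δ)) :=
        Real.one_le_rpow h1 (div_nonneg one_pos.le (by linarith))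
      have hq : scaledQuantile T t s ≤ (C / s) ^ (1 / (1 - δ)) := by
        refine hbound t ht s hs _ (by positivity) ?_ (hinv s hs _ (by linarith)).le
        rw [← hinv s hs (1 - δ) (by linarith)]
        exact Real.rpow_le_rpow_of_exponent_le hM1 (by linarith)
      have hg : g s = ENNReal.ofReal ((C / s) ^ ((1 - η) / (1 - δ))) := by
        simp [g, hs, hsC]
      rw [hg]
      refine ENNReal.ofReal_le_ofReal ((min_le_left _ _).trans
        ((Real.rpow_le_rpow hq0 hq (by linarith)).trans_eq ?_))
      rw [← Real.rpow_mul (by positivity)]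
      congr 1
      ring
    · have h1 : C / s ≤ 1 := (div_le_one hs).2 hsC.le
      have h0 : 0 < C / s := by positivity
      have hM1 : (C / s) ^ (1 / (1 + δ)) ≤ 1 :=
        Real.rpow_le_one h0.le h1 (by positivity)
      have hq : scaledQuantile T t s ≤ (C / s) ^ (1 / (1 + δ)) := by
        refine hbound t ht s hs _ (by positivity) (hinv s hs _ (by linarith)).le ?_
        rw [← hinv s hs (1 + δ) (by linarith)]
        exact Real.rpow_le_rpow_of_exponent_ge (by positivity) hM1 (by linarith)
      have hg : g s = ENNReal.ofReal ((C / s) ^ ((1 + η) / (1 + δ))) := by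
        simp [g, hsC, hsC.not_ge]
      rw [hg]
      refine ENNReal.ofReal_le_ofReal ((min_le_right _ _).trans
        ((Real.rpow_le_rpow hq0 hq (by linarith)).trans_eq ?_))
      rw [← Real.rpow_mul (by positivity)]
      congr 1
      ring

/-- Up to scale, `X ^ p` is bounded by one plus `min (a ^ p) (a ^ (2 - p))` at `a = X / t₀`, and the
quantile majorant with `η = 1 - p` integrates the second term. -/
theorem lintegral_rpow_lt_top (h : HeavyTail T) {Ω : Type*} [MeasurableSpace Ω] {P : Measure Ω}
    [IsFiniteMeasure P] {X : Ω → ℝ} (hX : Measurable X) (hX0 : ∀ᵐ ω ∂P, 0 ≤ X ω)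
    (hT : ∀ x, P.real {ω | x < X ω} = T x) {p : ℝ} (hp0 : 0 < p) (hp1 : p < 1) :
    ∫⁻ ω, ENNReal.ofReal (X ω ^ p) ∂P < ∞ := by
  obtain ⟨t₀, g, ht₀, -, hfin, hg⟩ := h.exists_scaledQuantile_bound (η := 1 - p) (by linarith)
    (by linarith)
  let f : ℝ → ℝ≥0∞ := fun a =>
    (Set.Ioi 0).indicator (fun a => ENNReal.ofReal (min (a ^ p) (a ^ (2 - p)))) a
  have hf : Measurable f := (by fun_prop : Measurable fun a : ℝ =>
    ENNReal.ofReal (min (a ^ p) (a ^ (2 - p)))).indicator measurableSet_Ioi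
  have hle : ∀ᵐ ω ∂P, ENNReal.ofReal (X ω ^ p) ≤
      ENNReal.ofReal (t₀ ^ p) * (1 + f (X ω / t₀)) := by
    filter_upwards [hX0] with ω hω
    have e : X ω ^ p = t₀ ^ p * (X ω / t₀) ^ p := by
      rw [← Real.mul_rpow ht₀.le (by positivity), mul_div_cancel₀ _ ht₀.ne']
    rw [e, ENNReal.ofReal_mul (by positivity)]
    gcongr
    rcases le_or_gt (X ω / t₀) 1 with h1 | h1
    · refine le_add_right ?_
      rw [← ENNReal.ofReal_one]
      exact ENNReal.ofReal_le_ofReal (Real.rpow_le_one (by positivity) h1 hp0.le)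
    · refine le_add_left ?_
      have : X ω / t₀ ∈ Set.Ioi (0 : ℝ) := one_pos.trans h1
      simp only [f, Set.indicator_of_mem this]
      exact ENNReal.ofReal_le_ofReal (le_min le_rfl
        (Real.rpow_le_rpow_of_exponent_le h1.le (by linarith)))
  refine (lintegral_mono_ae hle).trans_lt ?_
  have hfX : Measurable fun ω => f (X ω / t₀) := hf.comp (hX.div_const t₀)
  rw [lintegral_const_mul _ (by fun_prop), lintegral_add_left measurable_const,
    h.lintegral_comp_div hX hT ht₀ hf fun a ha => by simp [f, ha]]
  refine ENNReal.mul_lt_top ENNReal.ofReal_lt_top (ENNReal.add_lt_top.2 ⟨by simp,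
    ENNReal.mul_lt_top ENNReal.ofReal_lt_top (lt_of_le_of_lt ?_ hfin)⟩)
  refine setLIntegral_mono_ae' measurableSet_Ioi (ae_of_all _ fun s hs => ?_)
  refine le_trans ?_ (hg t₀ le_rfl s hs)
  simp only [f, Set.indicator_apply]
  split_ifs
  · refine le_of_eq ?_
    congr 3 <;> ring
  · exact zero_le

end HeavyTail

/-! ### Infinite products of powers of i.i.d. heavy-tailed variables -/

theorem multipliable_of_mem_unitInterval {f : ℕ → ℝ} (h0 : ∀ m, 0 ≤ f m) (h1 : ∀ m, f m ≤ 1) :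
    Multipliable f := by
  have hanti : Antitone fun s : Finset ℕ => ∏ m ∈ s, f m := fun s t hst => by
    dsimp only
    rw [← Finset.prod_sdiff hst]
    exact mul_le_of_le_one_left (Finset.prod_nonneg fun m _ => h0 m)
      (Finset.prod_le_one (fun m _ => h0 m) fun m _ => h1 m)
  refine ⟨⨅ s : Finset ℕ, ∏ m ∈ s, f m, ?_⟩
  unfold HasProd
  rw [SummationFilter.unconditional_filter]
  exact tendsto_atTop_ciInf hanti ⟨0, by
    rintro _ ⟨s, rfl⟩
    exact Finset.prod_nonneg fun m _ => h0 m⟩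

/-- Split each factor at one. Factors above one converge through their logarithms; those below one
have decreasing partial products, whose limit may be zero. Hence only the positive part of the
logarithm must be summable. -/
theorem multipliable_rpow {x c : ℕ → ℝ} (hx : ∀ m, 0 ≤ x m) (hc : ∀ m, 0 ≤ c m)
    (hs : Summable fun m => c m * Real.log (max (x m) 1)) : Multipliable fun m => x m ^ c m := by
  have e : (fun m => x m ^ c m) = fun m => max (x m) 1 ^ c m * min (x m) 1 ^ c m := by
    funext m
    rcases le_total (x m) 1 with h | h <;> simp [h]
  rw [e]
  refine Multipliable.mul ?_ (multipliable_of_mem_unitInterval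
    (fun m => Real.rpow_nonneg (le_min (hx m) zero_le_one) _)
    fun m => Real.rpow_le_one (le_min (hx m) zero_le_one) (min_le_right _ _) (hc m))
  obtain ⟨a, ha⟩ := hs
  have hprod := ha.rexp
  refine ⟨Real.exp a, ?_⟩
  convert hprod using 1
  funext m
  have : 0 < max (x m) 1 := lt_of_lt_of_le one_pos (le_max_right _ _)
  simp [Real.rpow_def_of_pos this, mul_comm]

theorem HasProd.rpow_of_nonneg {f : ℕ → ℝ} {y r : ℝ} (h : HasProd f y) (h0 : ∀ m, 0 ≤ f m)
    (hr : 0 ≤ r) : HasProd (fun m => f m ^ r) (y ^ r) := by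
  have ht := (Real.continuousAt_rpow_const y r (Or.inr hr)).tendsto.comp h
  refine Tendsto.congr (fun s => ?_) ht
  exact (Real.finsetProd_rpow s f (fun m _ => h0 m) r).symm

/-- A sequence of nonnegative i.i.d. random variables whose tails are regularly varying of
index `-1`. -/
structure HeavyTailedIID {Ω : Type*} [MeasurableSpace Ω] (P : Measure Ω) (X : ℕ → Ω → ℝ) :
    Prop where
  meas : ∀ i, Measurable (X i)
  indep : iIndepFun X P
  ident : ∀ i, IdentDistrib (X i) (X 0) P P
  nonneg : ∀ i, ∀ᵐ ω ∂P, 0 ≤ X i ω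
  rv : IsRegularlyVaryingRV P (X 0) (-1)

/-- The common tail function of the variables. -/
noncomputable def commonTail {Ω : Type*} [MeasurableSpace Ω] (P : Measure Ω) (X : ℕ → Ω → ℝ)
    (x : ℝ) : ℝ := P.real {ω | x < X 0 ω}

namespace HeavyTailedIID

variable {Ω : Type*} [MeasurableSpace Ω] {P : Measure Ω} [IsProbabilityMeasure P]
  {X : ℕ → Ω → ℝ}

theorem tail_eq (H : HeavyTailedIID P X) (i : ℕ) (x : ℝ) :
    P.real {ω | x < X i ω} = commonTail P X x := by
  have := (H.ident i).measure_mem_eq (measurableSet_Ioi (a := x))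
  exact congrArg ENNReal.toReal this

theorem heavyTail (H : HeavyTailedIID P X) : HeavyTail (commonTail P X) :=
  H.rv.heavyTail (H.meas 0)

theorem ae_nonneg (H : HeavyTailedIID P X) : ∀ᵐ ω ∂P, ∀ i, 0 ≤ X i ω := ae_all_iff.2 H.nonneg

theorem lintegral_comp_eq (H : HeavyTailedIID P X) (i : ℕ) {f : ℝ → ℝ≥0∞} (hf : Measurable f) :
    ∫⁻ ω, f (X i ω) ∂P = ∫⁻ ω, f (X 0 ω) ∂P :=
  ((H.ident i).comp hf).lintegral_eq

theorem moment_lt_top (H : HeavyTailedIID P X) {p : ℝ} (hp0 : 0 < p) (hp1 : p < 1) :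
    ∫⁻ ω, ENNReal.ofReal (X 0 ω ^ p) ∂P < ∞ :=
  H.heavyTail.lintegral_rpow_lt_top (H.meas 0) (H.nonneg 0) (H.tail_eq 0) hp0 hp1

/-- The positive part of `log X` has finite mean because it is at most `2 * X ^ (1 / 2)`; the
weighted series then has finite expectation. -/
theorem ae_summable_log (H : HeavyTailedIID P X) {c : ℕ → ℝ} (hc : ∀ m, 0 ≤ c m)
    (hs : Summable c) : ∀ᵐ ω ∂P, Summable fun m => c m * Real.log (max (X m ω) 1) := by
  have hm : ∀ m, Measurable fun ω => ENNReal.ofReal (Real.log (max (X m ω) 1)) := fun m => by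
    have := H.meas m
    fun_prop
  have hlog : ∀ x : ℝ, 0 ≤ Real.log (max x 1) := fun x => Real.log_nonneg (le_max_right _ _)
  have hK : ∀ m, ∫⁻ ω, ENNReal.ofReal (Real.log (max (X m ω) 1)) ∂P ≤
      ENNReal.ofReal 2 * ∫⁻ ω, ENNReal.ofReal (X 0 ω ^ (1 / 2 : ℝ)) ∂P := fun m => by
    have hmX : Measurable fun ω => ENNReal.ofReal (X 0 ω ^ (1 / 2 : ℝ)) := by
      have := H.meas 0
      fun_prop
    rw [H.lintegral_comp_eq m (f := fun x => ENNReal.ofReal (Real.log (max x 1))) (by fun_prop),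
      ← lintegral_const_mul _ hmX]
    refine lintegral_mono_ae ?_
    filter_upwards [H.nonneg 0] with ω hω
    rw [← ENNReal.ofReal_mul two_pos.le]
    refine ENNReal.ofReal_le_ofReal ?_
    rcases le_total (X 0 ω) 1 with h | h
    · simp only [max_eq_right h, Real.log_one]
      positivity
    · rw [max_eq_left h]
      refine (Real.log_le_rpow_div hω (ε := 1 / 2) (by norm_num)).trans_eq ?_
      ring
  have hfin : ∫⁻ ω, ∑' m, ENNReal.ofReal (c m) * ENNReal.ofReal (Real.log (max (X m ω) 1)) ∂P
      ≠ ∞ := by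
    rw [lintegral_tsum fun m => ((hm m).const_mul _).aemeasurable]
    have hle : ∑' m, ∫⁻ ω, ENNReal.ofReal (c m) * ENNReal.ofReal (Real.log (max (X m ω) 1)) ∂P ≤
        ∑' m, ENNReal.ofReal (c m) *
          (ENNReal.ofReal 2 * ∫⁻ ω, ENNReal.ofReal (X 0 ω ^ (1 / 2 : ℝ)) ∂P) :=
      ENNReal.tsum_le_tsum fun m => by
        rw [lintegral_const_mul _ (hm m)]
        gcongr
        exact hK m
    refine (hle.trans_lt ?_).ne
    rw [ENNReal.tsum_mul_right, ← ENNReal.ofReal_tsum_of_nonneg hc hs]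
    exact ENNReal.mul_lt_top ENNReal.ofReal_lt_top (ENNReal.mul_lt_top ENNReal.ofReal_lt_top
      (H.moment_lt_top (by norm_num) (by norm_num)))
  filter_upwards [ae_lt_top (Measurable.tsum fun m => (hm m).const_mul _) hfin] with ω hω
  have := ENNReal.summable_toReal hω.ne
  simpa only [ENNReal.toReal_mul, ENNReal.toReal_ofReal (hc _), ENNReal.toReal_ofReal (hlog _)]
    using this

theorem ae_multipliable (H : HeavyTailedIID P X) {c : ℕ → ℝ} (hc : ∀ m, 0 ≤ c m)
    (hs : Summable c) : ∀ᵐ ω ∂P, Multipliable fun m => X m ω ^ c m := by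
  filter_upwards [H.ae_summable_log hc hs, H.ae_nonneg] with ω h1 h2
  exact multipliable_rpow h2 hc h1

/-- Products whose exponents stay below some `p < 1` are integrable. -/
theorem lintegral_prod_lt_top (H : HeavyTailedIID P X) {c : ℕ → ℝ} (hc : ∀ m, 0 ≤ c m)
    (hs : Summable c) {p : ℝ} (hp0 : 0 < p) (hp1 : p < 1) (hcp : ∀ m, c m ≤ p) {Y : Ω → ℝ}
    (hY : ∀ᵐ ω ∂P, HasProd (fun m => X m ω ^ c m) (Y ω)) :
    ∫⁻ ω, ENNReal.ofReal (Y ω) ∂P < ∞ := by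
  set K := (∫⁻ ω, ENNReal.ofReal (X 0 ω ^ p) ∂P).toReal with hKdef
  have hKfin := H.moment_lt_top hp0 hp1
  have hK0 : 0 ≤ K := ENNReal.toReal_nonneg
  have hm : ∀ m, Measurable fun ω => ENNReal.ofReal (X m ω ^ c m) := fun m => by
    have := H.meas m
    fun_prop
  -- Bernoulli's inequality for `(x ^ p) ^ (c / p)` with `c / p ≤ 1` makes each mean at most `1 + c
  -- * (K / p)`. The resulting exponential bounds have a bounded product since `c` is summable, and
  -- Fatou passes to the infinite product.
  have hone : ∀ m, ∫⁻ ω, ENNReal.ofReal (X m ω ^ c m) ∂P ≤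
      ENNReal.ofReal (Real.exp (c m * (K / p))) := fun m => by
    have hmX : Measurable fun ω => ENNReal.ofReal (X 0 ω ^ p) := by
      have := H.meas 0
      fun_prop
    have hθ0 : 0 ≤ c m / p := div_nonneg (hc m) hp0.le
    calc ∫⁻ ω, ENNReal.ofReal (X m ω ^ c m) ∂P = ∫⁻ ω, ENNReal.ofReal (X 0 ω ^ c m) ∂P :=
          H.lintegral_comp_eq m (f := fun x => ENNReal.ofReal (x ^ c m)) (by fun_prop)
      _ ≤ ∫⁻ ω, (1 + ENNReal.ofReal (c m / p) * ENNReal.ofReal (X 0 ω ^ p)) ∂P := by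
          refine lintegral_mono_ae ?_
          filter_upwards [H.nonneg 0] with ω hω
          have hb := rpow_one_add_le_one_add_mul_self
            (s := X 0 ω ^ p - 1) (by linarith [Real.rpow_nonneg hω p]) hθ0
            ((div_le_one hp0).2 (hcp m))
          rw [add_sub_cancel, ← Real.rpow_mul hω, mul_div_cancel₀ _ hp0.ne'] at hb
          rw [← ENNReal.ofReal_one, ← ENNReal.ofReal_mul hθ0,
            ← ENNReal.ofReal_add one_pos.le (by positivity)]
          exact ENNReal.ofReal_le_ofReal (by linarith)
      _ = ENNReal.ofReal (1 + c m / p * K) := by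
          rw [lintegral_add_left measurable_const, lintegral_const_mul _ hmX, lintegral_const,
            measure_univ, mul_one, ENNReal.ofReal_add one_pos.le (by positivity),
            ENNReal.ofReal_mul hθ0, ENNReal.ofReal_one, hKdef, ENNReal.ofReal_toReal hKfin.ne]
      _ ≤ _ := by
          refine ENNReal.ofReal_le_ofReal ?_
          have := Real.add_one_le_exp (c m * (K / p))
          have e : c m / p * K = c m * (K / p) := by ring
          linarith
  have hn : ∀ n : ℕ, ∫⁻ ω, ∏ m ∈ Finset.range n, ENNReal.ofReal (X m ω ^ c m) ∂P ≤
      ENNReal.ofReal (Real.exp ((∑' m, c m) * (K / p))) := fun n => by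
    rw [lintegral_prod_eq_prod_lintegral_of_indepFun (Finset.range n)
      (fun m ω => ENNReal.ofReal (X m ω ^ c m))
      (H.indep.comp (fun m x => ENNReal.ofReal (x ^ c m)) fun m => by fun_prop) hm]
    refine (Finset.prod_le_prod' fun m _ => hone m).trans ?_
    rw [← ENNReal.ofReal_prod_of_nonneg fun m _ => (Real.exp_pos _).le, ← Real.exp_sum,
      ← Finset.sum_mul]
    refine ENNReal.ofReal_le_ofReal (Real.exp_le_exp.2 ?_)
    exact mul_le_mul_of_nonneg_right (hs.sum_le_tsum _ fun m _ => hc m) (by positivity)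
  have hlim : ∀ᵐ ω ∂P, ENNReal.ofReal (Y ω) =
      liminf (fun n => ∏ m ∈ Finset.range n, ENNReal.ofReal (X m ω ^ c m)) atTop := by
    filter_upwards [hY, H.ae_nonneg] with ω h1 h2
    have := (ENNReal.continuous_ofReal.tendsto (Y ω)).comp h1.tendsto_prod_nat
    refine (Tendsto.liminf_eq (this.congr fun n => ?_)).symm
    exact ENNReal.ofReal_prod_of_nonneg fun m _ => Real.rpow_nonneg (h2 m) _
  calc ∫⁻ ω, ENNReal.ofReal (Y ω) ∂P
      = ∫⁻ ω, liminf (fun n => ∏ m ∈ Finset.range n, ENNReal.ofReal (X m ω ^ c m)) atTop ∂P :=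
        lintegral_congr_ae hlim
    _ ≤ liminf (fun n => ∫⁻ ω, ∏ m ∈ Finset.range n, ENNReal.ofReal (X m ω ^ c m) ∂P) atTop :=
        lintegral_liminf_le fun n => Finset.measurable_prod _ fun m _ => hm m
    _ ≤ ENNReal.ofReal (Real.exp ((∑' m, c m) * (K / p))) :=
        (liminf_le_liminf (Eventually.of_forall hn)).trans_eq (by simp)
    _ < ∞ := ENNReal.ofReal_lt_top

theorem indepFun_restrict (H : HeavyTailedIID P X) (S : Set ℕ) :
    IndepFun (fun ω (m : S) => X m ω) (fun ω (m : (Sᶜ : Set ℕ)) => X m ω) P := by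
  have hcomap : ∀ U : Set ℕ, MeasurableSpace.comap (fun ω (m : U) => X m ω) inferInstance =
      ⨆ i ∈ U, MeasurableSpace.comap (X i) inferInstance := fun U => by
    simp only [MeasurableSpace.pi, MeasurableSpace.comap_iSup, MeasurableSpace.comap_comp]
    exact iSup_subtype (p := fun i => i ∈ U)
      (f := fun i => MeasurableSpace.comap (X i) inferInstance)
  rw [IndepFun_iff_Indep, hcomap, hcomap]
  exact indep_iSup_of_disjoint (fun i => (H.meas i).comap_le)
    ((iIndepFun_iff_iIndep _ _ _).1 H.indep) disjoint_compl_right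

/-- Expressing the limit as a measurable function of the coordinates outside `S` alone is what
transfers independence of blocks to the remainders. A `limsup` is used because it is measurable even
where the product diverges. -/
theorem exists_measurable_prod (H : HeavyTailedIID P X) (S : Set ℕ) {c : ℕ → ℝ}
    (hc : ∀ m, 0 ≤ c m) (hs : Summable c) :
    ∃ G : ((Sᶜ : Set ℕ) → ℝ) → ℝ, Measurable G ∧
      ∀ᵐ ω ∂P, HasProd (fun m => X m ω ^ Sᶜ.indicator c m) (G fun m => X m ω) := by
  classical
  let g : ℕ → ((Sᶜ : Set ℕ) → ℝ) → ℝ := fun n x =>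
    ∏ m ∈ Finset.range n, if h : m ∈ Sᶜ then x ⟨m, h⟩ ^ c m else 1
  have hg : ∀ n, Measurable (g n) := fun n => by
    refine Finset.measurable_prod _ fun m _ => ?_
    split_ifs
    · fun_prop
    · exact measurable_const
  refine ⟨fun x => limsup (fun n => g n x) atTop, Measurable.limsup hg, ?_⟩
  filter_upwards [H.ae_multipliable (c := Sᶜ.indicator c)
    (fun m => Set.indicator_nonneg (fun m _ => hc m) m) (hs.indicator _)] with ω hω
  obtain ⟨y, hy⟩ := hω
  have : limsup (fun n => g n fun m => X m ω) atTop = y := by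
    refine Tendsto.limsup_eq (hy.tendsto_prod_nat.congr fun n => ?_)
    refine Finset.prod_congr rfl fun m _ => ?_
    by_cases h : m ∈ S <;> simp [h]
  rw [this]
  exact hy

/-- The products over the complement of `S` are independent of the variables indexed by `S`. -/
theorem exists_remainders (H : HeavyTailedIID P X) (S : Set ℕ) {a b : ℕ → ℝ}
    (ha : ∀ m, 0 ≤ a m) (has : Summable a) (hb : ∀ m, 0 ≤ b m) (hbs : Summable b) :
    ∃ U V : Ω → ℝ, Measurable U ∧ Measurable V ∧
      (∀ᵐ ω ∂P, HasProd (fun m => X m ω ^ Sᶜ.indicator a m) (U ω)) ∧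
      (∀ᵐ ω ∂P, HasProd (fun m => X m ω ^ Sᶜ.indicator b m) (V ω)) ∧
      IndepFun (fun ω (m : S) => X m ω) (fun ω => (U ω, V ω)) P := by
  obtain ⟨G, hG, hGp⟩ := H.exists_measurable_prod S ha has
  obtain ⟨G', hG', hGp'⟩ := H.exists_measurable_prod S hb hbs
  have hX : Measurable fun ω (m : (Sᶜ : Set ℕ)) => X m ω :=
    measurable_pi_lambda _ fun m => H.meas m
  exact ⟨fun ω => G fun m => X m ω, fun ω => G' fun m => X m ω, hG.comp hX, hG'.comp hX, hGp, hGp',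
    (H.indepFun_restrict S).comp measurable_id (hG.prodMk hG')⟩

theorem eq_prod_mul_remainder {S : Finset ℕ} {c : ℕ → ℝ} {Y U : Ω → ℝ}
    (hY : ∀ᵐ ω ∂P, Tendsto (fun n => ∏ i ∈ Finset.range n, X i ω ^ c i) atTop (𝓝 (Y ω)))
    (hU : ∀ᵐ ω ∂P, HasProd (fun m => X m ω ^ ((S : Set ℕ)ᶜ).indicator c m) (U ω)) :
    ∀ᵐ ω ∂P, Y ω = (∏ m ∈ S, X m ω ^ c m) * U ω := by
  filter_upwards [hY, hU] with ω h1 h2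
  have h3 : HasProd (fun m => X m ω ^ (S : Set ℕ).indicator c m)
      (∏ m ∈ S, X m ω ^ (S : Set ℕ).indicator c m) :=
    hasProd_prod_of_ne_finset_one fun m hm => by
      rw [Set.indicator_of_notMem (by simpa using hm), Real.rpow_zero]
  have h4 := (h3.mul h2).tendsto_prod_nat
  refine tendsto_nhds_unique h1 ?_
  have e : ∏ m ∈ S, X m ω ^ c m = ∏ m ∈ S, X m ω ^ (S : Set ℕ).indicator c m :=
    Finset.prod_congr rfl fun m hm => by rw [Set.indicator_of_mem (by simpa using hm)]
  rw [e]
  refine h4.congr fun n => Finset.prod_congr rfl fun m _ => ?_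
  by_cases h : m ∈ S <;> simp [h]

end HeavyTailedIID

/-! ### Order of the joint tail -/

theorem isLittleO_rpow_rpow_atTop {a b : ℝ} (h : a < b) :
    (fun x : ℝ => x ^ a) =o[atTop] fun x : ℝ => x ^ b := by
  refine isLittleO_of_tendsto' ?_ ?_
  · filter_upwards [eventually_gt_atTop 0] with x hx h0
    exact absurd h0 (Real.rpow_pos_of_pos hx b).ne'
  · refine (tendsto_rpow_neg_atTop (sub_pos.2 h)).congr' ?_
    filter_upwards [eventually_gt_atTop 0] with x hx
    rw [← Real.rpow_sub hx, neg_sub]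

/-- Potter's bound read backwards: scaling down from `y * t₁` by the factor `y⁻¹` bounds the fixed
number `T t₁` by `C * y ^ (1 + δ) * T (y * t₁)`. -/
theorem HeavyTail.exists_lower_bound {T : ℝ → ℝ} (h : HeavyTail T) {δ : ℝ} (hδ : 0 < δ)
    (hδ1 : δ < 1) : ∃ c > 0, ∀ y, 1 ≤ y → c * y ^ (-(1 + δ)) ≤ T y := by
  obtain ⟨C, t₀, hC, ht₀, hpot⟩ := h.exists_potter hδ hδ1
  have hC0 : 0 < C := one_pos.trans_le hC
  set t₁ := max t₀ 1
  refine ⟨T t₁ / C, div_pos (h.pos _) hC0, fun y hy => ?_⟩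
  have hy0 : 0 < y := one_pos.trans_le hy
  have h1 := hpot (y * t₁) ((le_max_left _ _).trans
    (le_mul_of_one_le_left (by positivity) hy)) y⁻¹ (inv_pos.2 hy0)
  have hmax : max (y⁻¹ ^ (-(1 + δ))) (y⁻¹ ^ (-(1 - δ))) = y ^ (1 + δ) := by
    rw [Real.inv_rpow hy0.le, Real.inv_rpow hy0.le, ← Real.rpow_neg hy0.le,
      ← Real.rpow_neg hy0.le, neg_neg, neg_neg]
    exact max_eq_left (Real.rpow_le_rpow_of_exponent_le hy (by linarith))
  rw [hmax, inv_mul_cancel_left₀ hy0.ne'] at h1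
  have h2 : T (y * t₁) ≤ T y := h.anti (le_mul_of_one_le_right hy0.le (le_max_right _ _))
  rw [Real.rpow_neg hy0.le, ← div_eq_mul_inv, div_div, div_le_iff₀ (by positivity)]
  refine h1.trans ?_
  calc C * y ^ (1 + δ) * T (y * t₁) ≤ C * y ^ (1 + δ) * T y := by gcongr
    _ = _ := by ring

/-- The limits `Y₀`, `Y₁` of the products with exponents `α`, `β`, assumed positive. -/
structure ProductLimits {Ω : Type*} [MeasurableSpace Ω] (P : Measure Ω) (X : ℕ → Ω → ℝ)
    (α β : ℕ → ℝ) (Y₀ Y₁ : Ω → ℝ) : Prop where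
  iid : HeavyTailedIID P X
  data : LPData α β
  tendsto_left : ∀ᵐ ω ∂P, Tendsto (fun n => ∏ i ∈ Finset.range n, X i ω ^ α i) atTop (𝓝 (Y₀ ω))
  tendsto_right : ∀ᵐ ω ∂P, Tendsto (fun n => ∏ i ∈ Finset.range n, X i ω ^ β i) atTop (𝓝 (Y₁ ω))
  pos_left : ∀ᵐ ω ∂P, 0 < Y₀ ω
  pos_right : ∀ᵐ ω ∂P, 0 < Y₁ ω

/-- A factorization of `Y₀`, `Y₁` into the powers of the variables indexed by `S` and independent
positive remainders `U`, `V`. -/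
structure Factorization {Ω : Type*} [MeasurableSpace Ω] (P : Measure Ω) (X : ℕ → Ω → ℝ)
    (α β : ℕ → ℝ) (Y₀ Y₁ : Ω → ℝ) (S : Finset ℕ) (U V : Ω → ℝ) : Prop where
  meas_left : Measurable U
  meas_right : Measurable V
  hasProd_left : ∀ᵐ ω ∂P, HasProd (fun m => X m ω ^ ((S : Set ℕ)ᶜ).indicator α m) (U ω)
  hasProd_right : ∀ᵐ ω ∂P, HasProd (fun m => X m ω ^ ((S : Set ℕ)ᶜ).indicator β m) (V ω)
  indep : IndepFun (fun ω (m : (S : Set ℕ)) => X m ω) (fun ω => (U ω, V ω)) P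
  eq_left : ∀ᵐ ω ∂P, Y₀ ω = (∏ m ∈ S, X m ω ^ α m) * U ω
  eq_right : ∀ᵐ ω ∂P, Y₁ ω = (∏ m ∈ S, X m ω ^ β m) * V ω
  pos_left : ∀ᵐ ω ∂P, 0 < U ω
  pos_right : ∀ᵐ ω ∂P, 0 < V ω

namespace ProductLimits

variable {Ω : Type*} [MeasurableSpace Ω] {P : Measure Ω} [IsProbabilityMeasure P]
  {X : ℕ → Ω → ℝ} {α β : ℕ → ℝ} {Y₀ Y₁ : Ω → ℝ}

theorem symm (L : ProductLimits P X α β Y₀ Y₁) : ProductLimits P X β α Y₁ Y₀ :=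
  ⟨L.1, L.2.symm, L.4, L.3, L.6, L.5⟩

theorem exists_factorization (L : ProductLimits P X α β Y₀ Y₁) (S : Finset ℕ) :
    ∃ U V, Factorization P X α β Y₀ Y₁ S U V := by
  obtain ⟨U, V, hU, hV, hUp, hVp, hind⟩ := L.iid.exists_remainders (S : Set ℕ)
    L.data.nonneg_left L.data.summable_left L.data.nonneg_right L.data.summable_right
  have e1 := HeavyTailedIID.eq_prod_mul_remainder L.tendsto_left hUp
  have e2 := HeavyTailedIID.eq_prod_mul_remainder L.tendsto_right hVp
  have key : ∀ (c : ℕ → ℝ) (Y U : Ω → ℝ), (∀ᵐ ω ∂P, 0 < Y ω) →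
      (∀ᵐ ω ∂P, Y ω = (∏ m ∈ S, X m ω ^ c m) * U ω) → ∀ᵐ ω ∂P, 0 < U ω := by
    intro c Y U h1 h2
    filter_upwards [h1, h2, L.iid.ae_nonneg] with ω g1 g2 g3
    rw [g2] at g1
    exact pos_of_mul_pos_right g1 (Finset.prod_nonneg fun m _ => Real.rpow_nonneg (g3 m) _)
  exact ⟨U, V, hU, hV, hUp, hVp, hind, e1, e2, key α Y₀ U L.pos_left e1, key β Y₁ V L.pos_right e2⟩

/-- A zero of `X i` with `α i > 0` would annihilate `Y₀`; identical distribution carries the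
conclusion to every index. -/
theorem ae_pos (L : ProductLimits P X α β Y₀ Y₁) : ∀ᵐ ω ∂P, ∀ m, 0 < X m ω := by
  obtain ⟨i, hi⟩ := L.data.exists_pos_left
  obtain ⟨U, V, F⟩ := L.exists_factorization {i}
  have h0 : ∀ᵐ ω ∂P, 0 < X i ω := by
    filter_upwards [L.pos_left, F.eq_left, L.iid.nonneg i] with ω h1 h2 h3
    refine h3.lt_of_ne' fun h => h1.ne' ?_
    rw [h2, Finset.prod_singleton, h, Real.zero_rpow hi.ne', zero_mul]
  refine ae_all_iff.2 fun m => ?_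
  have := ((L.iid.ident m).trans (L.iid.ident i).symm).symm
  exact this.ae_snd measurableSet_Ioi h0

theorem measureReal_joint_eq (S : Finset ℕ) {U V : Ω → ℝ}
    (F : Factorization P X α β Y₀ Y₁ S U V) (x y : ℝ) :
    P.real {ω | x < Y₀ ω ∧ y < Y₁ ω} = P.real {ω | x < (∏ m ∈ S, X m ω ^ α m) * U ω ∧
      y < (∏ m ∈ S, X m ω ^ β m) * V ω} := by
  refine measureReal_congr ?_
  filter_upwards [F.eq_left, F.eq_right] with ω h1 h2
  change (x < Y₀ ω ∧ y < Y₁ ω) = _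
  rw [h1, h2]
  rfl

/-- On the event, the weighted geometric mean `Y₀ ^ l * Y₁ ^ (1 - l)` exceeds `x`. Its `r`-th power
is a product with all exponents at most `r * q < 1`, hence integrable, and Markov's inequality
applies. -/
theorem exists_joint_tail_le (L : ProductLimits P X α β Y₀ Y₁) {l q r : ℝ} (hl0 : 0 ≤ l)
    (hl1 : l ≤ 1) (hr : 0 < r) (hq : ∀ m, l * α m + (1 - l) * β m ≤ q) (hq0 : 0 < q)
    (hrq : r * q < 1) :
    ∃ C, ∀ x, 0 < x → P.real {ω | x < Y₀ ω ∧ x < Y₁ ω} ≤ C * x ^ (-r) := by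
  obtain ⟨U, V, F⟩ := L.exists_factorization ∅
  have hU := F.meas_left
  have hV := F.meas_right
  set W : Ω → ℝ := fun ω => (U ω ^ l * V ω ^ (1 - l)) ^ r with hW
  have hWp : ∀ᵐ ω ∂P, HasProd (fun m => X m ω ^ ((l * α m + (1 - l) * β m) * r)) (W ω) := by
    filter_upwards [F.hasProd_left, F.hasProd_right, L.ae_pos] with ω h1 h2 h3
    have h4 := ((h1.rpow_of_nonneg (fun m => Real.rpow_nonneg (h3 m).le _) hl0).mul
      (h2.rpow_of_nonneg (fun m => Real.rpow_nonneg (h3 m).le _)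
        (sub_nonneg.2 hl1))).rpow_of_nonneg (r := r) (fun m => by
          have := (h3 m).le
          positivity) hr.le
    convert! h4 using 2 with m
    simp only [Finset.coe_empty, Set.compl_empty, Set.indicator_univ]
    rw [← Real.rpow_mul (h3 m).le, ← Real.rpow_mul (h3 m).le, ← Real.rpow_add (h3 m),
      ← Real.rpow_mul (h3 m).le]
    congr 1
    ring
  have hfin : ∫⁻ ω, ENNReal.ofReal (W ω) ∂P < ∞ := by
    have hnn : ∀ m, 0 ≤ l * α m + (1 - l) * β m := fun m =>
      add_nonneg (mul_nonneg hl0 (L.data.nonneg_left m))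
        (mul_nonneg (sub_nonneg.2 hl1) (L.data.nonneg_right m))
    refine L.iid.lintegral_prod_lt_top (p := r * q) (fun m => mul_nonneg (hnn m) hr.le)
      (((L.data.summable_left.mul_left l).add (L.data.summable_right.mul_left (1 - l))).mul_right r)
      (by positivity) hrq (fun m => ?_) hWp
    nlinarith [hq m]
  refine ⟨(∫⁻ ω, ENNReal.ofReal (W ω) ∂P).toReal, fun x hx => ?_⟩
  rw [measureReal_joint_eq ∅ F]
  simp only [Finset.prod_empty, one_mul]
  have hsub : {ω | x < U ω ∧ x < V ω} ⊆ {ω | ENNReal.ofReal (x ^ r) ≤ ENNReal.ofReal (W ω)} := by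
    rintro ω ⟨h1, h2⟩
    refine ENNReal.ofReal_le_ofReal (Real.rpow_le_rpow hx.le ?_ hr.le)
    calc x = x ^ l * x ^ (1 - l) := by rw [← Real.rpow_add hx]; simp
      _ ≤ U ω ^ l * V ω ^ (1 - l) := by
        have := hx.trans h1
        gcongr
  have hmk := mul_meas_ge_le_lintegral₀ (μ := P) (f := fun ω => ENNReal.ofReal (W ω))
    (by fun_prop) (ENNReal.ofReal (x ^ r))
  have h1 : ENNReal.ofReal (x ^ r) * P {ω | x < U ω ∧ x < V ω} ≤
      ∫⁻ ω, ENNReal.ofReal (W ω) ∂P := le_trans (by gcongr) hmk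
  have h2 := ENNReal.toReal_mono hfin.ne h1
  rw [ENNReal.toReal_mul, ENNReal.toReal_ofReal (by positivity)] at h2
  rw [Real.rpow_neg hx.le, ← div_eq_mul_inv, le_div_iff₀ (by positivity), mul_comm]
  exact h2

/-- Require `X m > x ^ κ m` for `m < N` and, independently, remainders above a fixed level `η`. The
strict slack in both constraints outweighs the factor `η` for large `x`. -/
theorem exists_le_joint_tail (L : ProductLimits P X α β Y₀ Y₁) {κ : ℕ → ℝ} {N : ℕ}
    (hκ : ∀ m, 0 ≤ κ m) (h1 : 1 < ∑ m ∈ Finset.range N, α m * κ m)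
    (h2 : 1 < ∑ m ∈ Finset.range N, β m * κ m) {δ : ℝ} (hδ : 0 < δ) (hδ1 : δ < 1) :
    ∃ c > 0, ∀ᶠ x in atTop, c * x ^ (-((1 + δ) * ∑ m ∈ Finset.range N, κ m)) ≤
      P.real {ω | x < Y₀ ω ∧ x < Y₁ ω} := by
  obtain ⟨U, V, F⟩ := L.exists_factorization (Finset.range N)
  obtain ⟨c, hc, hlow⟩ := L.iid.heavyTail.exists_lower_bound hδ hδ1
  obtain ⟨η, hη, hη2⟩ : ∃ η > 0, 0 < P.real {ω | η < U ω ∧ η < V ω} := by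
    by_contra! hcon
    have hnull : ∀ n : ℕ, P {ω | 1 / ((n : ℝ) + 1) < U ω ∧ 1 / ((n : ℝ) + 1) < V ω} = 0 :=
      fun n => (measureReal_eq_zero_iff (by finiteness)).1
        (le_antisymm (hcon _ Nat.one_div_pos_of_nat) measureReal_nonneg)
    have hU := ae_all_iff.2 fun n => measure_eq_zero_iff_ae_notMem.1 (hnull n)
    have hf : ∀ᵐ ω ∂P, False := by
      filter_upwards [hU, F.pos_left, F.pos_right] with ω g1 g2 g3
      obtain ⟨n, hn⟩ := exists_nat_one_div_lt (lt_min g2 g3)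
      exact g1 n ⟨hn.trans_le (min_le_left _ _), hn.trans_le (min_le_right _ _)⟩
    obtain ⟨ω, hω⟩ := hf.exists
    exact hω
  refine ⟨c ^ N * P.real {ω | η < U ω ∧ η < V ω}, by positivity, ?_⟩
  have hbig : ∀ s : ℝ, 1 < s → ∀ᶠ x in atTop, 1 < x ^ (s - 1) * η := fun s hs =>
    ((tendsto_rpow_atTop (sub_pos.2 hs)).atTop_mul_const hη).eventually_gt_atTop 1
  filter_upwards [hbig _ h1, hbig _ h2, eventually_ge_atTop 1] with x hx1 hx2 hx
  have hx0 : 0 < x := one_pos.trans_le hx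
  let A : Set (((Finset.range N : Finset ℕ) : Set ℕ) → ℝ) := {f | ∀ m : ((Finset.range N : Finset ℕ) : Set ℕ), x ^ κ m < f m}
  have hA : MeasurableSet A := by
    have : A = ⋂ m : ((Finset.range N : Finset ℕ) : Set ℕ), {f | x ^ κ m < f m} := by
      ext f
      simp [A]
    rw [this]
    exact MeasurableSet.iInter fun m => measurableSet_lt measurable_const (measurable_pi_apply m)
  let B : Set (ℝ × ℝ) := {p | η < p.1 ∧ η < p.2}
  have hB : MeasurableSet B := (measurableSet_lt measurable_const measurable_fst).inter
    (measurableSet_lt measurable_const measurable_snd)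
  have hind := F.indep.measure_inter_preimage_eq_mul A B hA hB
  have hprod : P.real ((fun ω (m : ((Finset.range N : Finset ℕ) : Set ℕ)) => X m ω) ⁻¹' A) =
      ∏ m ∈ Finset.range N, commonTail P X (x ^ κ m) := by
    have := L.iid.indep.measure_inter_preimage_eq_mul (Finset.range N)
      (sets := fun m => Set.Ioi (x ^ κ m)) fun m _ => measurableSet_Ioi
    have hset : (fun ω (m : ((Finset.range N : Finset ℕ) : Set ℕ)) => X m ω) ⁻¹' A =
        ⋂ m ∈ Finset.range N, X m ⁻¹' Set.Ioi (x ^ κ m) := by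
      ext ω
      simp [A]
    rw [hset, measureReal_def, this, ENNReal.toReal_prod]
    exact Finset.prod_congr rfl fun m _ => L.iid.tail_eq m _
  have hprodle : c ^ N * x ^ (-((1 + δ) * ∑ m ∈ Finset.range N, κ m)) ≤
      ∏ m ∈ Finset.range N, commonTail P X (x ^ κ m) := by
    calc c ^ N * x ^ (-((1 + δ) * ∑ m ∈ Finset.range N, κ m))
        = ∏ m ∈ Finset.range N, (c * (x ^ κ m) ^ (-(1 + δ))) := by
          rw [Finset.prod_mul_distrib, Finset.prod_const, Finset.card_range]
          congr 1
          simp_rw [← Real.rpow_mul hx0.le]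
          rw [← Real.rpow_sum_of_pos hx0, ← Finset.sum_mul]
          congr 1
          ring
      _ ≤ _ := Finset.prod_le_prod (fun m _ => by positivity) fun m _ =>
          hlow _ (Real.one_le_rpow hx (hκ m))
  have hlarge : ∀ (a : ℕ → ℝ) (ω : Ω) (u : ℝ), (∀ m, 0 ≤ a m) → η < u →
      (∀ m ∈ Finset.range N, x ^ κ m < X m ω) →
      1 < x ^ (∑ m ∈ Finset.range N, a m * κ m - 1) * η →
      x < (∏ m ∈ Finset.range N, X m ω ^ a m) * u := by
    intro a ω u ha hu hX hs
    have e : x ^ (∑ m ∈ Finset.range N, a m * κ m) ≤ ∏ m ∈ Finset.range N, X m ω ^ a m := by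
      rw [Real.rpow_sum_of_pos hx0]
      refine Finset.prod_le_prod (fun m _ => by positivity) fun m hm => ?_
      rw [mul_comm, Real.rpow_mul hx0.le]
      exact Real.rpow_le_rpow (by positivity) (hX m hm).le (ha m)
    rw [Real.rpow_sub_one hx0.ne', div_mul_eq_mul_div, one_lt_div hx0] at hs
    exact hs.trans_le (mul_le_mul e hu.le hη.le ((by positivity : (0 : ℝ) ≤ _).trans e))
  rw [measureReal_joint_eq _ F]
  calc c ^ N * P.real {ω | η < U ω ∧ η < V ω} * x ^ (-((1 + δ) * ∑ m ∈ Finset.range N, κ m))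
      = c ^ N * x ^ (-((1 + δ) * ∑ m ∈ Finset.range N, κ m)) *
        P.real {ω | η < U ω ∧ η < V ω} := by ring
    _ ≤ (∏ m ∈ Finset.range N, commonTail P X (x ^ κ m)) * P.real {ω | η < U ω ∧ η < V ω} := by
        gcongr
    _ = P.real (((fun ω (m : ((Finset.range N : Finset ℕ) : Set ℕ)) => X m ω) ⁻¹' A) ∩
        ((fun ω => (U ω, V ω)) ⁻¹' B)) := by
        rw [← hprod, measureReal_def, measureReal_def, measureReal_def, hind, ENNReal.toReal_mul]
        rfl
    _ ≤ _ := by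
        refine measureReal_mono fun ω hω => ?_
        obtain ⟨g1, g2, g3⟩ := hω
        have g1' : ∀ m ∈ Finset.range N, x ^ κ m < X m ω := fun m hm => g1 ⟨m, by simpa using hm⟩
        exact ⟨hlarge α ω _ L.data.nonneg_left g2 g1' hx1, hlarge β ω _ L.data.nonneg_right g3 g1' hx2⟩

theorem joint_tail_order (L : ProductLimits P X α β Y₀ Y₁) {κ : ℕ → ℝ} (hκ : LPSolution α β κ)
    {ε : ℝ} (hε : 0 < ε) :
    ((fun x : ℝ => P.real {ω | x < Y₀ ω ∧ x < Y₁ ω}) =o[atTop]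
        fun x : ℝ => x ^ (ε - ∑' i, κ i)) ∧
      ((fun x : ℝ => x ^ (-ε - ∑' i, κ i)) =o[atTop]
        fun x : ℝ => P.real {ω | x < Y₀ ω ∧ x < Y₁ ω}) := by
  obtain ⟨t, ht, -, hval, hdual⟩ := L.data.exists_solution
  have hK := hval κ hκ
  have hs := L.data.summable_solution hκ
  have hKpos : 0 < ∑' i, κ i := hK ▸ inv_pos.2 ht
  set K := ∑' i, κ i with hKdef
  have hKt : K * t = 1 := by rw [hK, inv_mul_cancel₀ ht.ne']
  constructor
  -- Any positive `r` strictly between `K - ε` and `K` would do. The dual error chosen next gives `r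
  -- * (t + error) = (1 + r * t) / 2 < 1`.
  · set r := max (K - ε / 2) (K / 2) with hr
    have hr0 : 0 < r := lt_of_lt_of_le (by positivity) (le_max_right _ _)
    have hrK : r < K := max_lt (by linarith) (by linarith)
    have hrt : r * t < 1 := by nlinarith
    obtain ⟨l, hl0, hl1, hm⟩ := hdual ((1 - r * t) / (2 * r)) (div_pos (by linarith) (by linarith))
    obtain ⟨C, hC⟩ := L.exists_joint_tail_le hl0 hl1 hr0 hm
      (add_pos ht (div_pos (by linarith) (by linarith))) (by
        have : r * (t + (1 - r * t) / (2 * r)) = (1 + r * t) / 2 := by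
          field_simp
          ring
        rw [this]
        linarith)
    refine IsBigO.trans_isLittleO (g := fun x : ℝ => x ^ (-r)) (IsBigO.of_bound C ?_)
      (isLittleO_rpow_rpow_atTop ?_)
    · filter_upwards [eventually_gt_atTop 0] with x hx
      rw [Real.norm_of_nonneg measureReal_nonneg, Real.norm_of_nonneg (by positivity)]
      exact hC x hx
    · have := le_max_left (K - ε / 2) (K / 2)
      linarith
  -- One factor `1 + δ` inflates `κ` so that a finite truncation is strictly feasible; the other is
  -- the loss in the tail lower bound.
  · obtain ⟨δ, hδ0, hδ1, hδ2⟩ : ∃ δ, 0 < δ ∧ δ < 1 ∧ (1 + δ) * ((1 + δ) * K) < ε + K := by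
      have hc : Tendsto (fun δ : ℝ => (1 + δ) * ((1 + δ) * K)) (𝓝[>] 0)
          (𝓝 ((1 + 0) * ((1 + 0) * K))) :=
        (Continuous.tendsto (by fun_prop) 0).mono_left nhdsWithin_le_nhds
      obtain ⟨δ, h1, h2⟩ := ((hc.eventually_lt_const (u := ε + K) (by linarith)).and
        (Ioo_mem_nhdsGT (one_pos (α := ℝ)))).exists
      exact ⟨δ, h2.1, h2.2, h1⟩
    obtain ⟨f1, f2⟩ := (L.data.feasible_iff hκ.1.1 hs).1 hκ.1
    have part : ∀ a : ℕ → ℝ, Summable (fun m => a m * κ m) → 1 ≤ ∑' m, a m * κ m →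
        ∀ᶠ N in atTop, 1 < ∑ m ∈ Finset.range N, a m * ((1 + δ) * κ m) := by
      intro a ha h1
      have ht := ha.hasSum.tendsto_sum_nat.const_mul (1 + δ)
      filter_upwards [ht.eventually_const_lt (show 1 < (1 + δ) * ∑' m, a m * κ m by nlinarith)]
        with N hN
      rw [Finset.mul_sum] at hN
      simpa only [mul_left_comm] using hN
    obtain ⟨N, hN1, hN2⟩ := ((part α (Summable.mul_of_nonneg_pointwise L.data.nonneg_left hκ.1.1
      L.data.summable_left hs) f1).and (part β (Summable.mul_of_nonneg_pointwise
      L.data.nonneg_right hκ.1.1 L.data.summable_right hs) f2)).exists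
    obtain ⟨c, hc, hle⟩ := L.exists_le_joint_tail (κ := fun m => (1 + δ) * κ m)
      (fun m => mul_nonneg (by linarith) (hκ.1.1 m)) hN1 hN2 hδ0 hδ1
    refine (isLittleO_rpow_rpow_atTop (b := -((1 + δ) * ∑ m ∈ Finset.range N, (1 + δ) * κ m))
      ?_).trans_isBigO (IsBigO.of_bound c⁻¹ ?_)
    · rw [← Finset.mul_sum]
      have : ∑ m ∈ Finset.range N, κ m ≤ K := hs.sum_le_tsum _ fun m _ => hκ.1.1 m
      have : (1 + δ) * ((1 + δ) * ∑ m ∈ Finset.range N, κ m) ≤ (1 + δ) * ((1 + δ) * K) := by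
        gcongr
      linarith
    · filter_upwards [hle, eventually_gt_atTop 0] with x hx hx0
      rw [Real.norm_of_nonneg measureReal_nonneg, Real.norm_of_nonneg (by positivity),
        inv_mul_eq_div, le_div_iff₀ hc, mul_comm]
      exact hx

end ProductLimits

/-! ### One dominating variable -/

/-- Only finitely many terms can come near `b`, so pointwise strict bounds become a uniform one. -/
theorem exists_lt_forall_le {f : ℕ → ℝ} (hf : Tendsto f atTop (𝓝 0)) {b : ℝ} (hb : 0 < b)
    {s : Set ℕ} (h : ∀ m ∈ s, f m < b) : ∃ p, 0 < p ∧ p < b ∧ ∀ m ∈ s, f m ≤ p := by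
  obtain ⟨N, hN⟩ := (hf.eventually_le_const (half_pos hb)).exists_forall_of_atTop
  have h1 : ∀ᶠ p in 𝓝[<] b, ∀ m ∈ s ∩ Set.Iio N, f m ≤ p :=
    (eventually_all_finite ((Set.finite_Iio N).inter_of_right s)).2 fun m hm =>
      nhdsWithin_le_nhds (eventually_ge_nhds (h m hm.1))
  obtain ⟨p, h2, h3⟩ := (h1.and (Ioo_mem_nhdsLT (half_lt_self hb))).exists
  refine ⟨p, (half_pos hb).trans h3.1, h3.2, fun m hm => ?_⟩
  rcases lt_or_ge m N with hmN | hmN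
  · exact h2 m ⟨hm, hmN⟩
  · exact (hN m hmN).trans h3.1.le

theorem hasProd_subtype_rpow_iff {x c : ℕ → ℝ} {p : ℕ → Prop} {s : Set ℕ} {y : ℝ}
    (hs : ∀ m, m ∈ s ↔ p m) : HasProd (fun m : {m // p m} => x m ^ c m) y ↔
      HasProd (fun m => x m ^ s.indicator c m) y := by
  have e : s = {m | p m} := Set.ext hs
  subst e
  change HasProd ((fun m => x m ^ c m) ∘ ((↑) : {m | p m} → ℕ)) y ↔ _
  rw [hasProd_subtype_iff_mulIndicator]
  congr! 1
  funext m
  by_cases h : p m <;> simp [h]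

/-! ### Moments of the remainders -/

namespace Factorization

variable {Ω : Type*} [MeasurableSpace Ω] {P : Measure Ω} [IsProbabilityMeasure P]
  {X : ℕ → Ω → ℝ} {α β : ℕ → ℝ} {Y₀ Y₁ : Ω → ℝ} {S : Finset ℕ} {U V : Ω → ℝ}

theorem hasProd_mul (F : Factorization P X α β Y₀ Y₁ S U V) (L : ProductLimits P X α β Y₀ Y₁)
    {θ₀ θ₁ : ℝ} (h₀ : 0 ≤ θ₀) (h₁ : 0 ≤ θ₁) :
    ∀ᵐ ω ∂P, HasProd (fun m => X m ω ^ ((S : Set ℕ)ᶜ).indicator (fun m => α m * θ₀ + β m * θ₁) m)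
      (U ω ^ θ₀ * V ω ^ θ₁) := by
  filter_upwards [F.hasProd_left, F.hasProd_right, L.ae_pos] with ω h1 h2 h3
  convert! (h1.rpow_of_nonneg (fun m => Real.rpow_nonneg (h3 m).le _) h₀).mul
    (h2.rpow_of_nonneg (fun m => Real.rpow_nonneg (h3 m).le _) h₁) using 2 with m
  rw [← Real.rpow_mul (h3 m).le, ← Real.rpow_mul (h3 m).le, ← Real.rpow_add (h3 m)]
  by_cases h : m ∈ S <;> simp [h]

theorem integrable_mul (F : Factorization P X α β Y₀ Y₁ S U V) (L : ProductLimits P X α β Y₀ Y₁)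
    {θ₀ θ₁ p : ℝ} (h₀ : 0 ≤ θ₀) (h₁ : 0 ≤ θ₁) (hp0 : 0 < p) (hp1 : p < 1)
    (hp : ∀ m, m ∉ S → α m * θ₀ + β m * θ₁ ≤ p) :
    Integrable (fun ω => U ω ^ θ₀ * V ω ^ θ₁) P := by
  have hU := F.meas_left
  have hV := F.meas_right
  have hfin := L.iid.lintegral_prod_lt_top
    (fun m => Set.indicator_nonneg (fun m _ => add_nonneg
      (mul_nonneg (L.data.nonneg_left m) h₀) (mul_nonneg (L.data.nonneg_right m) h₁)) m)
    (((L.data.summable_left.mul_right θ₀).add (L.data.summable_right.mul_right θ₁)).indicator _)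
    hp0 hp1 (fun m => by
      by_cases h : m ∈ S
      · simpa [h] using hp0.le
      · simpa [h] using hp m h) (F.hasProd_mul L h₀ h₁)
  refine ⟨by fun_prop, (hasFiniteIntegral_iff_ofReal ?_).2 hfin⟩
  filter_upwards [F.pos_left, F.pos_right] with ω h1 h2
  change (0 : ℝ) ≤ _
  positivity

end Factorization

theorem MeasureTheory.Integrable.of_rpow_bounds {Ω : Type*} [MeasurableSpace Ω] {P : Measure Ω}
    {W : Ω → ℝ} (hW : Measurable W) (hpos : ∀ᵐ ω ∂P, 0 < W ω) {δ : ℝ} (hδ : 0 < δ)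
    (h1 : Integrable (fun ω => W ω ^ (1 + δ)) P) (h2 : Integrable (fun ω => W ω ^ (1 - δ)) P) :
    Integrable W P := by
  refine (h1.add h2).mono' hW.aestronglyMeasurable ?_
  filter_upwards [hpos] with ω hω
  rw [Real.norm_of_nonneg hω.le]
  change W ω ≤ W ω ^ (1 + δ) + W ω ^ (1 - δ)
  have a1 : 0 < W ω ^ (1 + δ) := by positivity
  have a2 : 0 < W ω ^ (1 - δ) := by positivity
  rcases le_total (W ω) 1 with h | h
  · have := Real.rpow_le_rpow_of_exponent_ge hω h (show 1 - δ ≤ 1 by linarith)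
    rw [Real.rpow_one] at this
    linarith
  · have := Real.rpow_le_rpow_of_exponent_le h (show 1 ≤ 1 + δ by linarith)
    rw [Real.rpow_one] at this
    linarith

theorem ProbabilityTheory.IndepFun.measureReal_lt_eq_integral {Ω E : Type*} [MeasurableSpace Ω]
    [MeasurableSpace E] {P : Measure Ω} [IsProbabilityMeasure P] {X : Ω → ℝ} {Z : Ω → E}
    (hX : Measurable X) (hZ : Measurable Z) (hind : IndepFun X Z P) {T : ℝ → ℝ}
    (hT : ∀ x, P.real {ω | x < X ω} = T x) {w : E → ℝ} (hw : Measurable w) :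
    P.real {ω | w (Z ω) < X ω} = ∫ ω, T (w (Z ω)) ∂P := by
  have hTm : Measurable T := by
    have : Antitone T := fun x y hxy => by
      rw [← hT, ← hT]
      exact measureReal_mono fun ω (hω : y < X ω) => hxy.trans_lt hω
    exact this.measurable
  have hT0 : ∀ x, 0 ≤ T x := fun x => hT x ▸ measureReal_nonneg
  rw [integral_eq_lintegral_of_nonneg_ae (ae_of_all _ fun ω => hT0 _)
    (by fun_prop : Measurable fun ω => T (w (Z ω))).aestronglyMeasurable, measureReal_def]
  congr 1
  have hprod := (indepFun_iff_map_prod_eq_prod_map_map hZ.aemeasurable hX.aemeasurable).1 hind.symm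
  have hs : MeasurableSet {q : E × ℝ | w q.1 < q.2} :=
    measurableSet_lt (hw.comp measurable_fst) measurable_snd
  calc P {ω | w (Z ω) < X ω} = (P.map fun ω => (Z ω, X ω)) {q : E × ℝ | w q.1 < q.2} := by
        rw [Measure.map_apply (hZ.prodMk hX) hs]
        rfl
    _ = ∫⁻ z, (P.map X) (Set.Ioi (w z)) ∂(P.map Z) := by
        rw [hprod, Measure.prod_apply hs]
        rfl
    _ = ∫⁻ z, ENNReal.ofReal (T (w z)) ∂(P.map Z) := by
        refine lintegral_congr fun z => ?_
        rw [Measure.map_apply hX measurableSet_Ioi, ← hT, ofReal_measureReal]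
        rfl
    _ = _ := lintegral_map (by fun_prop) hZ

/-- Breiman's lemma: a heavy-tailed variable compared with independent thresholds. -/
theorem HeavyTail.tendsto_measureReal_div {T : ℝ → ℝ} (h : HeavyTail T) {Ω E : Type*}
    [MeasurableSpace Ω] [MeasurableSpace E] {P : Measure Ω} [IsProbabilityMeasure P] {X : Ω → ℝ}
    {Z : Ω → E} (hX : Measurable X) (hZ : Measurable Z) (hind : IndepFun X Z P)
    (hT : ∀ x, P.real {ω | x < X ω} = T x) {t : ℝ → ℝ} (ht : Tendsto t atTop atTop)
    {w : ℝ → E → ℝ} {v : E → ℝ} (hw : ∀ x, Measurable (w x))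
    (hpos : ∀ᵐ ω ∂P, 0 < v (Z ω)) (hle : ∀ x, ∀ᵐ ω ∂P, (v (Z ω))⁻¹ ≤ w x (Z ω))
    (hev : ∀ᵐ ω ∂P, ∀ᶠ x in atTop, w x (Z ω) = (v (Z ω))⁻¹) {δ : ℝ} (hδ : 0 < δ) (hδ1 : δ < 1)
    (h1 : Integrable (fun ω => v (Z ω) ^ (1 + δ)) P)
    (h2 : Integrable (fun ω => v (Z ω) ^ (1 - δ)) P) :
    Tendsto (fun x => P.real {ω | w x (Z ω) * t x < X ω} / T (t x)) atTop
      (𝓝 (∫ ω, v (Z ω) ∂P)) := by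
  obtain ⟨C, t₀, hC, ht₀, hpot⟩ := h.exists_potter hδ hδ1
  have hTm : Measurable T := h.anti.measurable
  have e : (fun x => P.real {ω | w x (Z ω) * t x < X ω} / T (t x)) =
      fun x => ∫ ω, T (w x (Z ω) * t x) / T (t x) ∂P := by
    funext x
    rw [hind.measureReal_lt_eq_integral hX hZ hT (w := fun z => w x z * t x)
      ((hw x).mul_const _), integral_div]
  rw [e]
  -- Since `w` is at least `v⁻¹`, monotonicity and Potter's bound at `c = v⁻¹` give a majorant by `v
  -- ^ (1 + δ)` and `v ^ (1 - δ)`. A threshold above `v⁻¹` for finite `x` is harmless, because it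
  -- eventually equals `v⁻¹`.
  refine tendsto_integral_filter_of_dominated_convergence
    (fun ω => C * (v (Z ω) ^ (1 + δ) + v (Z ω) ^ (1 - δ))) (Eventually.of_forall fun x => ?_) ?_
    ((h1.add h2).const_mul C) ?_
  · have := (hw x).comp hZ
    exact (by fun_prop : Measurable fun ω => T (w x (Z ω) * t x) / T (t x)).aestronglyMeasurable
  · filter_upwards [ht.eventually_ge_atTop t₀] with x hx
    filter_upwards [hpos, hle x] with ω g1 g2
    have htx : 0 < t x := ht₀.trans_le hx
    rw [Real.norm_of_nonneg (div_nonneg (h.nonneg _) (h.nonneg _)), div_le_iff₀ (h.pos _)]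
    refine (h.anti (mul_le_mul_of_nonneg_right g2 htx.le)).trans
      ((hpot _ hx _ (inv_pos.2 g1)).trans ?_)
    refine mul_le_mul_of_nonneg_right (mul_le_mul_of_nonneg_left ?_ (by linarith)) (h.nonneg _)
    rw [Real.inv_rpow g1.le, Real.inv_rpow g1.le, ← Real.rpow_neg g1.le, ← Real.rpow_neg g1.le,
      neg_neg, neg_neg]
    exact max_le_add_of_nonneg (by positivity) (by positivity)
  · filter_upwards [hpos, hev] with ω g1 g2
    have h3 := (h.rv.2.2 _ (inv_pos.2 g1)).comp ht
    rw [Real.rpow_neg_one, inv_inv] at h3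
    refine h3.congr' ?_
    filter_upwards [g2] with x hx
    simp [hx]

/-! ### Breiman asymptotics around a single variable -/

namespace ProductLimits

variable {Ω : Type*} [MeasurableSpace Ω] {P : Measure Ω} [IsProbabilityMeasure P]
  {X : ℕ → Ω → ℝ} {α β κ : ℕ → ℝ} {Y₀ Y₁ : Ω → ℝ} {i : ℕ} {U V : Ω → ℝ}

theorem _root_.Factorization.indep_single (F : Factorization P X α β Y₀ Y₁ {i} U V) :
    IndepFun (X i) (fun ω => (U ω, V ω)) P :=
  F.indep.comp (measurable_pi_apply (⟨i, by simp⟩ : ((({i} : Finset ℕ) : Set ℕ)))) measurable_id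

theorem lt_rpow_mul_iff {y z x b : ℝ} (hy : 0 < y) (hz : 0 < z) (hx : 0 < x) (hb : 0 < b) :
    x < y ^ b * z ↔ (x / z) ^ (1 / b) < y := by
  rw [← div_lt_iff₀ hz, ← Real.rpow_lt_rpow_iff (z := 1 / b) (by positivity) (by positivity) (by
    positivity), ← Real.rpow_mul hy.le, mul_one_div_cancel hb.ne', Real.rpow_one]

/-- Asymptotics if one variable dominates and only the constraint on `Y₁` is tight. -/
theorem tendsto_of_lt (L : ProductLimits P X α β Y₀ Y₁) (hκ : LPUniqueSolution α β κ)
    (hi : 0 < κ i) (hz : ∀ j, j ≠ i → κ j = 0) (hlt : β i < α i)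
    (F : Factorization P X α β Y₀ Y₁ {i} U V) :
    Integrable (fun ω => V ω ^ (1 / β i)) P ∧ ∀ s₀ s₁ : ℝ, 0 < s₀ → 0 < s₁ →
      Tendsto (fun x : ℝ => P.real {ω | s₀ * x < Y₀ ω ∧ s₁ * x < Y₁ ω} /
        P.real {ω | x ^ κ i < X i ω}) atTop
        (𝓝 ((∫ ω, V ω ^ (1 / β i) ∂P) * s₁ ^ (-1 / β i))) := by
  have hβκ := L.data.min_mul_eq_one_of_one_pos hκ hi hz hlt.le
  have hβ : 0 < β i := pos_of_mul_pos_left (hβκ ▸ one_pos) hi.le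
  have hα : 0 < α i := hβ.trans hlt
  have hκi : κ i = 1 / β i := by rw [eq_div_iff hβ.ne', mul_comm]; exact hβκ
  have hU := F.meas_left
  have hV := F.meas_right
  obtain ⟨p, hp0, hpβ, hp⟩ := exists_lt_forall_le L.data.summable_right.tendsto_atTop_zero hβ
    (s := {i}ᶜ) fun m hm => L.data.right_lt_of_one_pos hκ hi hz hlt hm
  obtain ⟨δ, hδ0, hδ1, hδ⟩ : ∃ δ, 0 < δ ∧ δ < 1 ∧ (1 + δ) * (p / β i) < 1 := by
    have hc : Tendsto (fun δ : ℝ => (1 + δ) * (p / β i)) (𝓝[>] 0) (𝓝 ((1 + 0) * (p / β i))) :=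
      (Continuous.tendsto (by fun_prop) 0).mono_left nhdsWithin_le_nhds
    obtain ⟨δ, h1, h2⟩ := ((hc.eventually_lt_const (u := 1) (by
      rw [add_zero, one_mul, div_lt_one hβ]; exact hpβ)).and
      (Ioo_mem_nhdsGT (one_pos (α := ℝ)))).exists
    exact ⟨δ, h2.1, h2.2, h1⟩
  have hint : ∀ r, 0 < r → r ≤ 1 + δ → Integrable (fun ω => (V ω ^ (1 / β i)) ^ r) P := by
    intro r hr hr1
    have := F.integrable_mul L (θ₀ := 0) (θ₁ := r / β i) (p := (1 + δ) * (p / β i)) le_rfl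
      (by positivity) (by positivity) hδ fun m hm => by
        have := hp m (by simpa using hm)
        calc α m * 0 + β m * (r / β i) ≤ p * ((1 + δ) / β i) := by
              rw [mul_zero, zero_add]
              gcongr
          _ = _ := by ring
    refine this.congr ?_
    filter_upwards [F.pos_right] with ω h
    rw [Real.rpow_zero, one_mul, ← Real.rpow_mul h.le]
    congr 1
    ring
  refine ⟨.of_rpow_bounds (by fun_prop) (F.pos_right.mono fun ω h => by positivity) hδ0
    (hint _ (by linarith) le_rfl) (hint _ (by linarith) (by linarith)), fun s₀ s₁ hs₀ hs₁ => ?_⟩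
  have hs : ∀ r : ℝ, Integrable (fun ω => (V ω ^ (1 / β i)) ^ r) P →
      Integrable (fun ω => (V ω ^ (1 / β i) * s₁ ^ (-1 / β i)) ^ r) P := fun r hr => by
    refine (hr.mul_const ((s₁ ^ (-1 / β i)) ^ r)).congr ?_
    filter_upwards [F.pos_right] with ω h
    rw [Real.mul_rpow (by positivity) (by positivity)]
  have hinv : ∀ z, 0 < z → (z ^ (1 / β i) * s₁ ^ (-1 / β i))⁻¹ = (s₁ / z) ^ (1 / β i) := by
    intro z hz
    rw [Real.div_rpow hs₁.le hz.le, mul_inv, neg_div, Real.rpow_neg hs₁.le, inv_inv, mul_comm,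
      ← div_eq_mul_inv]
  have hmain := L.iid.heavyTail.tendsto_measureReal_div (L.iid.meas i)
    (Z := fun ω => (U ω, V ω)) (hU.prodMk hV) F.indep_single (L.iid.tail_eq i)
    (t := fun x => x ^ κ i) (tendsto_rpow_atTop hi)
    -- The maximum collects the thresholds that `Y₀` and `Y₁` impose on `X i / x ^ κ i`. The first
    -- is of order `x ^ (1 / α i - 1 / β i)`, which tends to zero, so eventually only the second
    -- remains.
    (w := fun x z => max ((s₀ * x / z.1) ^ (1 / α i) / x ^ κ i)
      (z.2 ^ (1 / β i) * s₁ ^ (-1 / β i))⁻¹)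
    (v := fun z => z.2 ^ (1 / β i) * s₁ ^ (-1 / β i)) (fun x => by fun_prop)
    (F.pos_right.mono fun ω h => by positivity) (fun x => ae_of_all _ fun ω => le_max_right _ _)
    ?_ hδ0 hδ1 (hs _ (hint _ (by linarith) le_rfl)) (hs _ (hint _ (by linarith) (by linarith)))
  · rw [integral_mul_const] at hmain
    refine hmain.congr' ?_
    filter_upwards [eventually_gt_atTop 0] with x hx
    rw [L.iid.tail_eq i]
    congr 1
    rw [measureReal_joint_eq {i} F]
    refine measureReal_congr ?_
    filter_upwards [F.pos_left, F.pos_right, L.ae_pos] with ω h1 h2 h3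
    have hxκ : 0 < x ^ κ i := by positivity
    change (max ((s₀ * x / U ω) ^ (1 / α i) / x ^ κ i) (V ω ^ (1 / β i) * s₁ ^ (-1 / β i))⁻¹ *
      x ^ κ i < X i ω) = (s₀ * x < (∏ m ∈ {i}, X m ω ^ α m) * U ω ∧
        s₁ * x < (∏ m ∈ {i}, X m ω ^ β m) * V ω)
    rw [max_mul_of_nonneg _ _ hxκ.le, max_lt_iff, div_mul_cancel₀ _ hxκ.ne', Finset.prod_singleton,
      Finset.prod_singleton, lt_rpow_mul_iff (h3 i) h1 (by positivity) hα,
      lt_rpow_mul_iff (h3 i) h2 (by positivity) hβ, hinv _ h2, hκi,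
      ← Real.mul_rpow (by positivity) hx.le, div_mul_eq_mul_div]
  · filter_upwards [F.pos_left, F.pos_right] with ω h1 h2
    have hlim : Tendsto (fun x : ℝ => (s₀ / U ω) ^ (1 / α i) * x ^ (-(1 / β i - 1 / α i))) atTop
        (𝓝 ((s₀ / U ω) ^ (1 / α i) * 0)) :=
      (tendsto_rpow_neg_atTop (sub_pos.2 (one_div_lt_one_div_of_lt hβ hlt))).const_mul _
    rw [mul_zero] at hlim
    have hvpos : 0 < (V ω ^ (1 / β i) * s₁ ^ (-1 / β i))⁻¹ := by positivity
    filter_upwards [hlim.eventually_lt_const hvpos, eventually_gt_atTop 0] with x hx hx0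
    refine max_eq_right (le_trans (le_of_eq ?_) hx.le)
    rw [mul_div_right_comm, Real.mul_rpow (by positivity) hx0.le, hκi, mul_div_assoc,
      ← Real.rpow_sub hx0, neg_sub]

/-- Asymptotics if one variable dominates and both constraints are tight. -/
theorem tendsto_of_eq (L : ProductLimits P X α β Y₀ Y₁) (hκ : LPUniqueSolution α β κ)
    (hi : 0 < κ i) (hz : ∀ j, j ≠ i → κ j = 0) (heq : α i = β i)
    (F : Factorization P X α β Y₀ Y₁ {i} U V) {s₀ s₁ : ℝ} (hs₀ : 0 < s₀) (hs₁ : 0 < s₁) :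
    Integrable (fun ω => min (s₀⁻¹ * U ω) (s₁⁻¹ * V ω) ^ (1 / β i)) P ∧
      Tendsto (fun x : ℝ => P.real {ω | s₀ * x < Y₀ ω ∧ s₁ * x < Y₁ ω} /
        P.real {ω | x ^ κ i < X i ω}) atTop
        (𝓝 (∫ ω, min (s₀⁻¹ * U ω) (s₁⁻¹ * V ω) ^ (1 / β i) ∂P)) := by
  have hβκ := L.data.min_mul_eq_one_of_one_pos hκ hi hz heq.ge
  have hβ : 0 < β i := pos_of_mul_pos_left (hβκ ▸ one_pos) hi.le
  have hκi : κ i = 1 / β i := by rw [eq_div_iff hβ.ne', mul_comm]; exact hβκ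
  have hU := F.meas_left
  have hV := F.meas_right
  obtain ⟨l, hl0, hl1, p', hpβ', hp'⟩ := L.data.exists_weight_of_one_pos hκ hi hz heq
  obtain ⟨p, hp0, hpβ, hp⟩ : ∃ p, 0 < p ∧ p < β i ∧ ∀ m, m ≠ i → l * α m + (1 - l) * β m ≤ p :=
    ⟨max p' (β i / 2), lt_of_lt_of_le (half_pos hβ) (le_max_right _ _),
      max_lt hpβ' (by linarith), fun m hm => (hp' m hm).trans (le_max_left _ _)⟩
  obtain ⟨δ, hδ0, hδ1, hδ⟩ : ∃ δ, 0 < δ ∧ δ < 1 ∧ (1 + δ) * (p / β i) < 1 := by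
    have hc : Tendsto (fun δ : ℝ => (1 + δ) * (p / β i)) (𝓝[>] 0) (𝓝 ((1 + 0) * (p / β i))) :=
      (Continuous.tendsto (by fun_prop) 0).mono_left nhdsWithin_le_nhds
    obtain ⟨δ, h1, h2⟩ := ((hc.eventually_lt_const (u := 1) (by
      rw [add_zero, one_mul, div_lt_one hβ]; exact hpβ)).and
      (Ioo_mem_nhdsGT (one_pos (α := ℝ)))).exists
    exact ⟨δ, h2.1, h2.2, h1⟩
  have hmin : ∀ᵐ ω ∂P, 0 < min (s₀⁻¹ * U ω) (s₁⁻¹ * V ω) := by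
    filter_upwards [F.pos_left, F.pos_right] with ω h1 h2
    exact lt_min (by positivity) (by positivity)
  have hint : ∀ r, 0 < r → r ≤ 1 + δ →
      Integrable (fun ω => (min (s₀⁻¹ * U ω) (s₁⁻¹ * V ω) ^ (1 / β i)) ^ r) P := by
    intro r hr hr1
    have hl1' := sub_nonneg.2 hl1
    -- The minimum is at most the geometric mean with the dual weights `l` and `1 - l`; these make
    -- every remaining exponent at most `(1 + δ) * (p / β i) < 1`, although either product alone
    -- might fail to have the moment.
    have := F.integrable_mul L (θ₀ := l * (r / β i)) (θ₁ := (1 - l) * (r / β i))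
      (p := (1 + δ) * (p / β i)) (by positivity) (by positivity) (by positivity) hδ fun m hm => by
        have := hp m (by simpa using hm)
        calc α m * (l * (r / β i)) + β m * ((1 - l) * (r / β i))
            = (l * α m + (1 - l) * β m) * (r / β i) := by ring
          _ ≤ p * ((1 + δ) / β i) := by gcongr
          _ = _ := by ring
    refine (this.const_mul ((s₀⁻¹) ^ (l * (r / β i)) * (s₁⁻¹) ^ ((1 - l) * (r / β i)))).mono'
      (by fun_prop : Measurable _).aestronglyMeasurable ?_
    filter_upwards [F.pos_left, F.pos_right, hmin] with ω h1 h2 h3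
    rw [Real.norm_of_nonneg (by positivity), ← Real.rpow_mul h3.le]
    set m := min (s₀⁻¹ * U ω) (s₁⁻¹ * V ω) with hm
    calc m ^ (1 / β i * r) = m ^ (l * (r / β i)) * m ^ ((1 - l) * (r / β i)) := by
          rw [← Real.rpow_add h3]
          congr 1
          ring
      _ ≤ (s₀⁻¹ * U ω) ^ (l * (r / β i)) * (s₁⁻¹ * V ω) ^ ((1 - l) * (r / β i)) := by
          gcongr
          · exact min_le_left _ _
          · exact min_le_right _ _
      _ = _ := by
          rw [Real.mul_rpow (by positivity) h1.le, Real.mul_rpow (by positivity) h2.le]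
          ring
  have i1 := hint (1 + δ) (by linarith) le_rfl
  have i2 := hint (1 - δ) (by linarith) (by linarith)
  have hpos : ∀ᵐ ω ∂P, 0 < min (s₀⁻¹ * U ω) (s₁⁻¹ * V ω) ^ (1 / β i) :=
    hmin.mono fun ω h => by positivity
  refine ⟨.of_rpow_bounds (by fun_prop) hpos hδ0 i1 i2, ?_⟩
  have hmain := L.iid.heavyTail.tendsto_measureReal_div (L.iid.meas i)
    (Z := fun ω => (U ω, V ω)) (hU.prodMk hV) F.indep_single (L.iid.tail_eq i)
    (t := fun x => x ^ κ i) (tendsto_rpow_atTop hi)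
    (w := fun _ z => (min (s₀⁻¹ * z.1) (s₁⁻¹ * z.2) ^ (1 / β i))⁻¹)
    (v := fun z => min (s₀⁻¹ * z.1) (s₁⁻¹ * z.2) ^ (1 / β i)) (fun x => by fun_prop)
    hpos (fun x => ae_of_all _ fun ω => le_rfl)
    (ae_of_all _ fun ω => Eventually.of_forall fun x => rfl) hδ0 hδ1 i1 i2
  refine hmain.congr' ?_
  filter_upwards [eventually_gt_atTop 0] with x hx
  rw [L.iid.tail_eq i]
  congr 1
  rw [measureReal_joint_eq {i} F]
  refine measureReal_congr ?_
  filter_upwards [F.pos_left, F.pos_right, L.ae_pos, hmin] with ω h1 h2 h3 h4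
  change ((min (s₀⁻¹ * U ω) (s₁⁻¹ * V ω) ^ (1 / β i))⁻¹ * x ^ κ i < X i ω) =
    (s₀ * x < (∏ m ∈ {i}, X m ω ^ α m) * U ω ∧ s₁ * x < (∏ m ∈ {i}, X m ω ^ β m) * V ω)
  rw [hκi, ← Real.inv_rpow h4.le, ← Real.mul_rpow (by positivity) hx.le,
    ← div_eq_inv_mul, ← lt_rpow_mul_iff (h3 i) h4 hx hβ, Finset.prod_singleton,
    Finset.prod_singleton, heq, mul_min_of_nonneg _ _ (by have := h3 i; positivity), lt_min_iff,
    mul_left_comm, lt_inv_mul_iff₀ hs₀, mul_left_comm, lt_inv_mul_iff₀ hs₁]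

end ProductLimits

/-! ### Two dominating variables -/

/-- Logarithmic coordinates `s = exp (-A)` will make the power constraints linear. -/
theorem lintegral_Ioi_eq_lintegral_exp_neg (g : ℝ → ℝ≥0∞) :
    ∫⁻ s in Set.Ioi 0, g s = ∫⁻ A, ENNReal.ofReal (Real.exp (-A)) * g (Real.exp (-A)) := by
  have himg : (fun A : ℝ => Real.exp (-A)) '' Set.univ = Set.Ioi 0 := by
    ext s
    simp only [Set.image_univ, Set.mem_range, Set.mem_Ioi]
    refine ⟨?_, fun hs => ⟨-Real.log s, by rw [neg_neg, Real.exp_log hs]⟩⟩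
    rintro ⟨A, rfl⟩
    exact Real.exp_pos _
  have := lintegral_image_eq_lintegral_abs_deriv_mul (f := fun A : ℝ => Real.exp (-A))
    (f' := fun A => -Real.exp (-A)) MeasurableSet.univ
    (fun A _ => by simpa using ((hasDerivAt_neg A).exp).hasDerivWithinAt (s := Set.univ))
    (fun A _ B _ h => by simpa using h) g
  rw [himg, Measure.restrict_univ] at this
  simpa only [abs_neg, abs_of_pos (Real.exp_pos _)] using this

theorem lintegral_linear_comp {a b c d : ℝ} (hdet : a * d - b * c ≠ 0) {H : ℝ × ℝ → ℝ≥0∞}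
    (hH : Measurable H) :
    ∫⁻ r : ℝ × ℝ, H (a * r.1 + b * r.2, c * r.1 + d * r.2) =
      ENNReal.ofReal |(a * d - b * c)⁻¹| * ∫⁻ r, H r := by
  let f : ℝ × ℝ →ₗ[ℝ] ℝ × ℝ :=
    Matrix.toLin (Module.Basis.finTwoProd ℝ) (Module.Basis.finTwoProd ℝ) !![a, b; c, d]
  have hdetf : LinearMap.det f = a * d - b * c := by
    rw [LinearMap.det_toLin, Matrix.det_fin_two_of]
  have hf : ∀ r, f r = (a * r.1 + b * r.2, c * r.1 + d * r.2) := fun r =>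
    Matrix.toLin_finTwoProd_apply a b c d r
  have hfm : Measurable f := f.continuous_of_finiteDimensional.measurable
  have hmap := Measure.map_linearMap_addHaar_eq_smul_addHaar (volume : Measure (ℝ × ℝ))
    (f := f) (by rwa [hdetf])
  rw [hdetf] at hmap
  rw [← smul_eq_mul, ← lintegral_smul_measure, ← hmap, lintegral_map hH hfm]
  simp_rw [hf]

/-- With `p = a A + b B` and `q = c A + d B`, the hypotheses on `y₀`, `y₁` say that `A + B = y₀ p +
y₁ q`. The density `exp (-(A + B))` thus factors in the new coordinates, at the price of the
Jacobian. -/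
theorem lintegral_neg_log_linear {a b c d y₀ y₁ : ℝ} (hdet : a * d - b * c ≠ 0)
    (h1 : a * y₀ + c * y₁ = 1) (h2 : b * y₀ + d * y₁ = 1) {G : ℝ × ℝ → ℝ≥0∞} (hG : Measurable G) :
    ∫⁻ r, G (-(a * Real.log r.1 + b * Real.log r.2), -(c * Real.log r.1 + d * Real.log r.2))
        ∂((volume.restrict (Set.Ioi 0)).prod (volume.restrict (Set.Ioi 0))) =
      ENNReal.ofReal |(a * d - b * c)⁻¹| *
        ∫⁻ r : ℝ × ℝ, ENNReal.ofReal (Real.exp (-(y₀ * r.1 + y₁ * r.2))) * G r := by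
  rw [lintegral_prod _ (by fun_prop), ← lintegral_linear_comp hdet (by fun_prop),
    Measure.volume_eq_prod, lintegral_prod _ (by fun_prop), lintegral_Ioi_eq_lintegral_exp_neg]
  refine lintegral_congr fun A => ?_
  rw [lintegral_Ioi_eq_lintegral_exp_neg, ← lintegral_const_mul _ (by fun_prop)]
  refine lintegral_congr fun B => ?_
  rw [← mul_assoc, ← ENNReal.ofReal_mul (Real.exp_pos _).le, ← Real.exp_add]
  simp only [Real.log_exp]
  have e : -A + -B = -(y₀ * (a * A + b * B) + y₁ * (c * A + d * B)) := by
    linear_combination A * h1 + B * h2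
  rw [e]
  congr 3 <;> ring

theorem lintegral_exp_neg_mul_Ioi {y c : ℝ} (hy : 0 < y) :
    ∫⁻ p in Set.Ioi c, ENNReal.ofReal (Real.exp (-(y * p))) =
      ENNReal.ofReal (Real.exp (-(y * c)) / y) := by
  have hint : IntegrableOn (fun p => Real.exp (-y * p)) (Set.Ioi c) :=
    integrableOn_exp_mul_Ioi (neg_lt_zero.2 hy) c
  simp_rw [neg_mul] at hint
  rw [← ofReal_integral_eq_lintegral_ofReal hint (ae_of_all _ fun p => (Real.exp_pos _).le)]
  have := integral_exp_mul_Ioi (neg_lt_zero.2 hy) c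
  simp_rw [neg_mul] at this
  rw [this, neg_div_neg_eq]

theorem lintegral_exp_neg_quadrant {y₀ y₁ c₀ c₁ : ℝ} (h₀ : 0 < y₀) (h₁ : 0 < y₁) :
    ∫⁻ r : ℝ × ℝ, ENNReal.ofReal (Real.exp (-(y₀ * r.1 + y₁ * r.2))) *
        {r : ℝ × ℝ | c₀ < r.1 ∧ c₁ < r.2}.indicator 1 r =
      ENNReal.ofReal (Real.exp (-(y₀ * c₀)) / y₀ * (Real.exp (-(y₁ * c₁)) / y₁)) := by
  have e : ∀ r : ℝ × ℝ, ENNReal.ofReal (Real.exp (-(y₀ * r.1 + y₁ * r.2))) *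
        {r : ℝ × ℝ | c₀ < r.1 ∧ c₁ < r.2}.indicator 1 r =
      (Set.Ioi c₀).indicator (fun p => ENNReal.ofReal (Real.exp (-(y₀ * p)))) r.1 *
      (Set.Ioi c₁).indicator (fun p => ENNReal.ofReal (Real.exp (-(y₁ * p)))) r.2 := fun r => by
    rw [neg_add, Real.exp_add, ENNReal.ofReal_mul (Real.exp_pos _).le]
    by_cases g1 : c₀ < r.1 <;> by_cases g2 : c₁ < r.2 <;> simp [g1, g2]
  have hm : ∀ y c : ℝ, Measurable
      ((Set.Ioi c).indicator fun p => ENNReal.ofReal (Real.exp (-(y * p)))) := fun y c =>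
    (by fun_prop : Measurable fun p : ℝ => ENNReal.ofReal (Real.exp (-(y * p)))).indicator
      measurableSet_Ioi
  simp_rw [e]
  rw [Measure.volume_eq_prod, lintegral_prod_mul (hm y₀ c₀).aemeasurable (hm y₁ c₁).aemeasurable,
    lintegral_indicator measurableSet_Ioi, lintegral_indicator measurableSet_Ioi,
    lintegral_exp_neg_mul_Ioi h₀, lintegral_exp_neg_mul_Ioi h₁, ← ENNReal.ofReal_mul (by positivity)]

/-- Coupling of two independent heavy-tailed variables with Lebesgue measure on the quadrant. -/
theorem HeavyTail.lintegral_comp_div_two {T : ℝ → ℝ} (h : HeavyTail T) {Ω E : Type*}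
    [MeasurableSpace Ω] [MeasurableSpace E] {P : Measure Ω} [IsProbabilityMeasure P]
    {X X' : Ω → ℝ} {Z : Ω → E} (hX : Measurable X) (hX' : Measurable X') (hZ : Measurable Z)
    (hXX' : IndepFun X X' P) (hind : IndepFun (fun ω => (X ω, X' ω)) Z P)
    (hT : ∀ x, P.real {ω | x < X ω} = T x) (hT' : ∀ x, P.real {ω | x < X' ω} = T x)
    {t t' : ℝ} (ht : 0 < t) (ht' : 0 < t') {φ : (ℝ × ℝ) × E → ℝ≥0∞} (hφ : Measurable φ)
    (hφ0 : ∀ a b z, a ≤ 0 ∨ b ≤ 0 → φ ((a, b), z) = 0) :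
    ∫⁻ ω, φ ((X ω / t, X' ω / t'), Z ω) ∂P =
      ENNReal.ofReal (T t * T t') * ∫⁻ p, φ ((scaledQuantile T t p.2.1,
        scaledQuantile T t' p.2.2), Z p.1)
          ∂(P.prod ((volume.restrict (Set.Ioi 0)).prod (volume.restrict (Set.Ioi 0)))) := by
  have hq := h.measurable_scaledQuantile ht
  have hq' := h.measurable_scaledQuantile ht'
  have hmap : (P.map fun ω => ((X ω, X' ω), Z ω)) =
      ((P.map X).prod (P.map X')).prod (P.map Z) := by
    rw [(indepFun_iff_map_prod_eq_prod_map_map (hX.prodMk hX').aemeasurable hZ.aemeasurable).1 hind,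
      (indepFun_iff_map_prod_eq_prod_map_map hX.aemeasurable hX'.aemeasurable).1 hXX']
  have hp1 : IsProbabilityMeasure (P.map X) := Measure.isProbabilityMeasure_map hX.aemeasurable
  have hp2 : IsProbabilityMeasure (P.map X') := Measure.isProbabilityMeasure_map hX'.aemeasurable
  have hp3 : IsProbabilityMeasure (P.map Z) := Measure.isProbabilityMeasure_map hZ.aemeasurable
  have hψ : Measurable fun r : (ℝ × ℝ) × E => φ ((r.1.1 / t, r.1.2 / t'), r.2) := by fun_prop
  calc ∫⁻ ω, φ ((X ω / t, X' ω / t'), Z ω) ∂P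
      = ∫⁻ r, φ ((r.1.1 / t, r.1.2 / t'), r.2) ∂(((P.map X).prod (P.map X')).prod (P.map Z)) := by
        rw [← hmap, lintegral_map hψ (by fun_prop)]
    _ = ∫⁻ z, ∫⁻ a, ∫⁻ b, φ ((a / t, b / t'), z) ∂(P.map X') ∂(P.map X) ∂(P.map Z) := by
        rw [lintegral_prod_symm _ hψ.aemeasurable]
        refine lintegral_congr fun z => ?_
        rw [lintegral_prod _ (by fun_prop)]
    _ = ∫⁻ z, ∫⁻ a, ENNReal.ofReal (T t') * (∫⁻ s in Set.Ioi 0,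
          φ ((a / t, scaledQuantile T t' s), z)) ∂(P.map X) ∂(P.map Z) := by
        refine lintegral_congr fun z => lintegral_congr fun a => ?_
        rw [lintegral_map (by fun_prop) hX', h.lintegral_comp_div hX' hT' ht'
          (g := fun b => φ ((a / t, b), z)) (by fun_prop) fun b hb => hφ0 _ _ _ (Or.inr hb)]
    _ = ∫⁻ z, ENNReal.ofReal (T t) * (∫⁻ s in Set.Ioi 0, ENNReal.ofReal (T t') *
          ∫⁻ s' in Set.Ioi 0, φ ((scaledQuantile T t s, scaledQuantile T t' s'), z))
            ∂(P.map Z) := by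
        refine lintegral_congr fun z => ?_
        have hm : Measurable fun a => ENNReal.ofReal (T t') * ∫⁻ s in Set.Ioi 0,
            φ ((a, scaledQuantile T t' s), z) :=
          (Measurable.lintegral_prod_right' (f := fun r : ℝ × ℝ =>
            φ ((r.1, scaledQuantile T t' r.2), z)) (by fun_prop)).const_mul _
        rw [lintegral_map (f := fun a => ENNReal.ofReal (T t') * ∫⁻ s in Set.Ioi 0,
            φ ((a / t, scaledQuantile T t' s), z)) (hm.comp (measurable_id.div_const t)) hX,
          h.lintegral_comp_div hX hT ht hm fun a ha => ?_]
        simp [hφ0 a _ z (Or.inl ha)]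
    _ = ENNReal.ofReal (T t * T t') * ∫⁻ z, ∫⁻ r, φ ((scaledQuantile T t r.1,
          scaledQuantile T t' r.2), z)
          ∂((volume.restrict (Set.Ioi 0)).prod (volume.restrict (Set.Ioi 0))) ∂(P.map Z) := by
        rw [ENNReal.ofReal_mul (h.nonneg t), ← lintegral_const_mul _
          (Measurable.lintegral_prod_right' (f := fun r : E × (ℝ × ℝ) =>
            φ ((scaledQuantile T t r.2.1, scaledQuantile T t' r.2.2), r.1)) (by fun_prop))]
        refine lintegral_congr fun z => ?_
        rw [lintegral_prod _ (by fun_prop), mul_assoc, ← lintegral_const_mul _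
          (Measurable.lintegral_prod_right' (f := fun r : ℝ × ℝ =>
            φ ((scaledQuantile T t r.1, scaledQuantile T t' r.2), z)) (by fun_prop))]
    _ = _ := by
        rw [lintegral_map (Measurable.lintegral_prod_right' (f := fun r : E × (ℝ × ℝ) =>
            φ ((scaledQuantile T t r.2.1, scaledQuantile T t' r.2.2), r.1)) (by fun_prop)) hZ,
          lintegral_prod _ (by fun_prop)]

/-- Applied to coordinate lines, this shows that the boundary of the joint constraint set is
negligible, as convergence of its indicator requires. -/
theorem measure_neg_log_linear_null {a b c d y₀ y₁ : ℝ} (hdet : a * d - b * c ≠ 0)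
    (h1 : a * y₀ + c * y₁ = 1) (h2 : b * y₀ + d * y₁ = 1) {N : Set (ℝ × ℝ)}
    (hN : MeasurableSet N) (hN0 : volume N = 0) :
    ((volume.restrict (Set.Ioi 0)).prod (volume.restrict (Set.Ioi 0)))
      {r : ℝ × ℝ | (-(a * Real.log r.1 + b * Real.log r.2),
        -(c * Real.log r.1 + d * Real.log r.2)) ∈ N} = 0 := by
  have hm : MeasurableSet {r : ℝ × ℝ | (-(a * Real.log r.1 + b * Real.log r.2),
      -(c * Real.log r.1 + d * Real.log r.2)) ∈ N} :=
    (by fun_prop : Measurable fun r : ℝ × ℝ => (-(a * Real.log r.1 + b * Real.log r.2),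
      -(c * Real.log r.1 + d * Real.log r.2))) hN
  rw [← lintegral_indicator_one hm]
  have := lintegral_neg_log_linear hdet h1 h2 (G := N.indicator 1)
    (measurable_one.indicator hN)
  refine Eq.trans ?_ (this.trans ?_)
  · rfl
  · have h0 : ∀ᵐ r : ℝ × ℝ, r ∉ N := measure_eq_zero_iff_ae_notMem.1 hN0
    rw [lintegral_congr_ae (g := fun _ => 0) (h0.mono fun r hr => by simp [hr])]
    simp

/-- The points `((A, B), (u, v))` of the open quadrant with `s₀ < A ^ a * B ^ b * u` and
`s₁ < A ^ c * B ^ d * v`. -/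
def jointSet (a b c d s₀ s₁ : ℝ) : Set ((ℝ × ℝ) × (ℝ × ℝ)) :=
  {r | 0 < r.1.1 ∧ 0 < r.1.2 ∧ s₀ < r.1.1 ^ a * r.1.2 ^ b * r.2.1 ∧
    s₁ < r.1.1 ^ c * r.1.2 ^ d * r.2.2}

section jointSet

variable {a b c d s₀ s₁ : ℝ}

theorem measurableSet_jointSet : MeasurableSet (jointSet a b c d s₀ s₁) := by
  have m1 : MeasurableSet {r : (ℝ × ℝ) × (ℝ × ℝ) | 0 < r.1.1} :=
    measurableSet_lt measurable_const (by fun_prop)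
  have m2 : MeasurableSet {r : (ℝ × ℝ) × (ℝ × ℝ) | 0 < r.1.2} :=
    measurableSet_lt measurable_const (by fun_prop)
  have m3 : MeasurableSet {r : (ℝ × ℝ) × (ℝ × ℝ) | s₀ < r.1.1 ^ a * r.1.2 ^ b * r.2.1} :=
    measurableSet_lt measurable_const (by fun_prop)
  have m4 : MeasurableSet {r : (ℝ × ℝ) × (ℝ × ℝ) | s₁ < r.1.1 ^ c * r.1.2 ^ d * r.2.2} :=
    measurableSet_lt measurable_const (by fun_prop)
  exact m1.inter (m2.inter (m3.inter m4))

theorem lt_rpow_mul_rpow_mul_iff {A B u : ℝ} (hA : 0 < A) (hB : 0 < B) (hu : 0 < u)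
    (hs : 0 < s₀) :
    s₀ < A ^ a * B ^ b * u ↔ Real.log (s₀ / u) < a * Real.log A + b * Real.log B := by
  rw [← div_lt_iff₀ hu, ← Real.log_lt_log_iff (by positivity) (by positivity),
    Real.log_mul (by positivity) (by positivity), Real.log_rpow hA, Real.log_rpow hB]

theorem mem_jointSet_iff {A B u v : ℝ} (hA : 0 < A) (hB : 0 < B) (hu : 0 < u) (hv : 0 < v)
    (hs₀ : 0 < s₀) (hs₁ : 0 < s₁) : ((A, B), (u, v)) ∈ jointSet a b c d s₀ s₁ ↔
      Real.log (s₀ / u) < a * Real.log A + b * Real.log B ∧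
        Real.log (s₁ / v) < c * Real.log A + d * Real.log B := by
  rw [← lt_rpow_mul_rpow_mul_iff hA hB hu hs₀, ← lt_rpow_mul_rpow_mul_iff hA hB hv hs₁]
  simp [jointSet, hA, hB]

/-- Raising the two constraints to powers and multiplying them bounds the indicator by a product in
which the powers of `A` and `B` can be prescribed. This is the source of the integrable majorant. -/
theorem one_le_of_mem_jointSet {A B u v θ₀ θ₁ e₁ e₂ : ℝ} (hu : 0 < u) (hv : 0 < v) (hs₀ : 0 < s₀)
    (hs₁ : 0 < s₁) (hθ₀ : 0 ≤ θ₀) (hθ₁ : 0 ≤ θ₁) (he₁ : a * θ₀ + c * θ₁ = e₁)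
    (he₂ : b * θ₀ + d * θ₁ = e₂) (h : ((A, B), (u, v)) ∈ jointSet a b c d s₀ s₁) :
    1 ≤ (u / s₀) ^ θ₀ * (v / s₁) ^ θ₁ * (A ^ e₁ * B ^ e₂) := by
  obtain ⟨hA, hB, h1, h2⟩ := h
  dsimp only at hA hB h1 h2
  have g1 : 1 ≤ (A ^ a * B ^ b * (u / s₀)) ^ θ₀ := by
    refine Real.one_le_rpow ?_ hθ₀
    rw [← mul_div_assoc, one_le_div hs₀]
    exact h1.le
  have g2 : 1 ≤ (A ^ c * B ^ d * (v / s₁)) ^ θ₁ := by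
    refine Real.one_le_rpow ?_ hθ₁
    rw [← mul_div_assoc, one_le_div hs₁]
    exact h2.le
  refine (one_le_mul_of_one_le_of_one_le g1 g2).trans_eq ?_
  rw [← he₁, ← he₂, Real.mul_rpow (by positivity) (by positivity),
    Real.mul_rpow (by positivity) (by positivity), Real.mul_rpow (by positivity) (by positivity),
    Real.mul_rpow (by positivity) (by positivity), Real.rpow_add hA, Real.rpow_add hB,
    Real.rpow_mul hA.le, Real.rpow_mul hA.le, Real.rpow_mul hB.le, Real.rpow_mul hB.le]
  ring

theorem tendsto_indicator_jointSet {u v A B : ℝ} {A' B' : ℝ → ℝ} (hA : 0 < A) (hB : 0 < B)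
    (hu : 0 < u) (hv : 0 < v) (hs₀ : 0 < s₀) (hs₁ : 0 < s₁)
    (hA' : Tendsto A' atTop (𝓝 A)) (hB' : Tendsto B' atTop (𝓝 B))
    (h₀ : a * Real.log A + b * Real.log B ≠ Real.log (s₀ / u))
    (h₁ : c * Real.log A + d * Real.log B ≠ Real.log (s₁ / v)) :
    Tendsto (fun x => (jointSet a b c d s₀ s₁).indicator (1 : (ℝ × ℝ) × (ℝ × ℝ) → ℝ≥0∞) ((A' x, B' x), (u, v)))
      atTop (𝓝 ((jointSet a b c d s₀ s₁).indicator 1 ((A, B), (u, v)))) := by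
  have hlA := hA'.log hA.ne'
  have hlB := hB'.log hB.ne'
  have key : ∀ p q k : ℝ, p * Real.log A + q * Real.log B ≠ k →
      ∀ᶠ x in atTop, (k < p * Real.log (A' x) + q * Real.log (B' x) ↔
        k < p * Real.log A + q * Real.log B) := by
    intro p q k hk
    have ht : Tendsto (fun x => p * Real.log (A' x) + q * Real.log (B' x)) atTop
        (𝓝 (p * Real.log A + q * Real.log B)) := (hlA.const_mul p).add (hlB.const_mul q)
    rcases lt_or_gt_of_ne hk with hlt | hlt
    · filter_upwards [ht.eventually_lt_const hlt] with x hx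
      simp [hx.not_gt, hlt.not_gt]
    · filter_upwards [ht.eventually_const_lt hlt] with x hx
      simp [hx, hlt]
  refine tendsto_const_nhds.congr' ?_
  filter_upwards [key a b _ h₀, key c d _ h₁, hA'.eventually_const_lt hA,
    hB'.eventually_const_lt hB] with x g1 g2 g3 g4
  have : ((A, B), (u, v)) ∈ jointSet a b c d s₀ s₁ ↔
      ((A' x, B' x), (u, v)) ∈ jointSet a b c d s₀ s₁ := by
    rw [mem_jointSet_iff hA hB hu hv hs₀ hs₁, mem_jointSet_iff g3 g4 hu hv hs₀ hs₁, g1, g2]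
  by_cases hm : ((A, B), (u, v)) ∈ jointSet a b c d s₀ s₁
  · rw [Set.indicator_of_mem hm, Set.indicator_of_mem (this.1 hm)]
    rfl
  · rw [Set.indicator_of_notMem hm, Set.indicator_of_notMem fun h => hm (this.2 h)]

end jointSet

/-- Breiman's lemma for two heavy-tailed variables and an independent pair of multipliers. -/
theorem HeavyTail.tendsto_lintegral_jointSet {T : ℝ → ℝ} (h : HeavyTail T) {Ω : Type*}
    [MeasurableSpace Ω] {P : Measure Ω} [IsProbabilityMeasure P]
    {X X' U V : Ω → ℝ} (hX : Measurable X) (hX' : Measurable X') (hU : Measurable U)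
    (hV : Measurable V) (hXX' : IndepFun X X' P)
    (hind : IndepFun (fun ω => (X ω, X' ω)) (fun ω => (U ω, V ω)) P)
    (hT : ∀ x, P.real {ω | x < X ω} = T x) (hT' : ∀ x, P.real {ω | x < X' ω} = T x)
    (hU0 : ∀ᵐ ω ∂P, 0 < U ω) (hV0 : ∀ᵐ ω ∂P, 0 < V ω)
    {t t' : ℝ → ℝ} (ht : Tendsto t atTop atTop) (ht' : Tendsto t' atTop atTop)
    {a b c d y₀ y₁ s₀ s₁ η : ℝ} (hdet : a * d - b * c ≠ 0)
    (h1 : a * y₀ + c * y₁ = 1) (h2 : b * y₀ + d * y₁ = 1) (hy₀ : 0 < y₀) (hy₁ : 0 < y₁)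
    (hs₀ : 0 < s₀) (hs₁ : 0 < s₁) (hη : 0 < η) (hη1 : η < 1)
    (hint : ∀ e₁ ∈ ({1 - η, 1 + η} : Finset ℝ), ∀ e₂ ∈ ({1 - η, 1 + η} : Finset ℝ),
      ∃ θ₀ θ₁, 0 ≤ θ₀ ∧ 0 ≤ θ₁ ∧ a * θ₀ + c * θ₁ = e₁ ∧ b * θ₀ + d * θ₁ = e₂ ∧
        Integrable (fun ω => U ω ^ θ₀ * V ω ^ θ₁) P) :
    Tendsto (fun x => (∫⁻ ω, (jointSet a b c d s₀ s₁).indicator 1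
        ((X ω / t x, X' ω / t' x), (U ω, V ω)) ∂P) / ENNReal.ofReal (T (t x) * T (t' x))) atTop
      (𝓝 (∫⁻ ω, ENNReal.ofReal (|(a * d - b * c)⁻¹| *
        ((U ω / s₀) ^ y₀ / y₀ * ((V ω / s₁) ^ y₁ / y₁))) ∂P)) := by
  classical
  set ν : Measure ℝ := volume.restrict (Set.Ioi 0) with hν
  set φ : (ℝ × ℝ) × (ℝ × ℝ) → ℝ≥0∞ := (jointSet a b c d s₀ s₁).indicator 1 with hφdef
  have hφ : Measurable φ := measurable_one.indicator measurableSet_jointSet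
  have hφ0 : ∀ A B z, A ≤ 0 ∨ B ≤ 0 → φ ((A, B), z) = 0 := fun A B z hz =>
    Set.indicator_of_notMem (fun hm => hz.elim hm.1.not_ge hm.2.1.not_ge) _
  obtain ⟨t₀, g, ht₀, hg, hgfin, hgb⟩ := h.exists_scaledQuantile_bound hη hη1
  choose! θ₀ θ₁ hθ₀ hθ₁ he₁ he₂ hθint using hint
  set E : Finset ℝ := {1 - η, 1 + η} with hE
  -- Which of the powers `1 - η`, `1 + η` is the smaller depends on the point, independently for the
  -- two quantiles; hence the majorant `k` sums over all four pairs of exponents.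
  have hEmin : ∀ A : ℝ, ∃ e ∈ E, min (A ^ (1 - η)) (A ^ (1 + η)) = A ^ e := fun A => by
    rcases min_choice (A ^ (1 - η)) (A ^ (1 + η)) with h | h
    · exact ⟨1 - η, by simp [hE], h⟩
    · exact ⟨1 + η, by simp [hE], h⟩
  let k : Ω → ℝ≥0∞ := fun ω => ∑ e₁ ∈ E, ∑ e₂ ∈ E,
    ENNReal.ofReal ((U ω / s₀) ^ θ₀ e₁ e₂ * (V ω / s₁) ^ θ₁ e₁ e₂)
  have hk : Measurable k := by fun_prop
  have hkfin : ∫⁻ ω, k ω ∂P < ∞ := by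
    simp only [k]
    rw [lintegral_finsetSum _ fun e₁ _ => by fun_prop]
    refine ENNReal.sum_lt_top.2 fun e₁ he1 => ?_
    rw [lintegral_finsetSum _ fun e₂ _ => by fun_prop]
    refine ENNReal.sum_lt_top.2 fun e₂ he2 => ?_
    have hi := (hθint e₁ he1 e₂ he2).const_mul ((s₀ ^ θ₀ e₁ e₂ * s₁ ^ θ₁ e₁ e₂)⁻¹)
    refine lt_of_le_of_lt (lintegral_mono_ae ?_) hi.lintegral_lt_top
    filter_upwards [hU0, hV0] with ω g1 g2
    refine (ENNReal.ofReal_le_ofReal (le_of_eq ?_))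
    rw [Real.div_rpow g1.le hs₀.le, Real.div_rpow g2.le hs₁.le]
    field_simp
  have hae1 : ∀ᵐ p ∂(P.prod (ν.prod ν)), 0 < U p.1 ∧ 0 < V p.1 :=
    Measure.quasiMeasurePreserving_fst.ae (hU0.and hV0)
  have hνpos : ∀ᵐ s ∂ν, 0 < s := ae_restrict_mem measurableSet_Ioi
  have hae2 : ∀ᵐ p ∂(P.prod (ν.prod ν)), 0 < p.2.1 ∧ 0 < p.2.2 :=
    Measure.quasiMeasurePreserving_snd.ae
      ((Measure.quasiMeasurePreserving_fst.ae hνpos).and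
        (Measure.quasiMeasurePreserving_snd.ae hνpos))
  -- For fixed remainders the limit points on the boundary form a null set, so the indicator
  -- converges almost everywhere.
  have hae3 : ∀ᵐ p ∂(P.prod (ν.prod ν)),
      -(a * Real.log p.2.1 + b * Real.log p.2.2) ≠ Real.log (s₀ / U p.1) ∧
      -(c * Real.log p.2.1 + d * Real.log p.2.2) ≠ Real.log (s₁ / V p.1) := by
    have m1 : MeasurableSet {p : Ω × ℝ × ℝ |
        -(a * Real.log p.2.1 + b * Real.log p.2.2) = Real.log (s₀ / U p.1)} :=
      measurableSet_eq_fun (by fun_prop) (by fun_prop)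
    have m2 : MeasurableSet {p : Ω × ℝ × ℝ |
        -(c * Real.log p.2.1 + d * Real.log p.2.2) = Real.log (s₁ / V p.1)} :=
      measurableSet_eq_fun (by fun_prop) (by fun_prop)
    refine Eventually.and (measure_eq_zero_iff_ae_notMem.1
      ((Measure.measure_prod_null m1).2 (ae_of_all _ fun ω => ?_)))
      (measure_eq_zero_iff_ae_notMem.1
      ((Measure.measure_prod_null m2).2 (ae_of_all _ fun ω => ?_)))
    · exact measure_neg_log_linear_null hdet h1 h2 (N := {r | r.1 = Real.log (s₀ / U ω)})
        (measurableSet_eq_fun measurable_fst measurable_const) (by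
          rw [show {r : ℝ × ℝ | r.1 = Real.log (s₀ / U ω)} =
            {Real.log (s₀ / U ω)} ×ˢ Set.univ by ext; simp, Measure.volume_eq_prod,
            Measure.prod_prod, Real.volume_singleton, zero_mul])
    · exact measure_neg_log_linear_null hdet h1 h2 (N := {r | r.2 = Real.log (s₁ / V ω)})
        (measurableSet_eq_fun measurable_snd measurable_const) (by
          rw [show {r : ℝ × ℝ | r.2 = Real.log (s₁ / V ω)} =
            Set.univ ×ˢ {Real.log (s₁ / V ω)} by ext; simp, Measure.volume_eq_prod,
            Measure.prod_prod, Real.volume_singleton, mul_zero])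
  have hlim : Tendsto (fun x => ∫⁻ p, φ ((scaledQuantile T (t x) p.2.1,
      scaledQuantile T (t' x) p.2.2), (U p.1, V p.1)) ∂(P.prod (ν.prod ν))) atTop
      (𝓝 (∫⁻ p, φ ((p.2.1⁻¹, p.2.2⁻¹), (U p.1, V p.1)) ∂(P.prod (ν.prod ν)))) := by
    refine tendsto_lintegral_filter_of_dominated_convergence
      (fun p => k p.1 * (g p.2.1 * g p.2.2)) ?_ ?_ ?_ ?_
    · filter_upwards [ht.eventually_gt_atTop 0, ht'.eventually_gt_atTop 0] with x hx hx'
      have := h.measurable_scaledQuantile hx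
      have := h.measurable_scaledQuantile hx'
      fun_prop
    · filter_upwards [ht.eventually_ge_atTop t₀, ht'.eventually_ge_atTop t₀] with x hx hx'
      filter_upwards [hae1, hae2] with p hp1 hp2
      by_cases hm : ((scaledQuantile T (t x) p.2.1, scaledQuantile T (t' x) p.2.2),
          (U p.1, V p.1)) ∈ jointSet a b c d s₀ s₁
      · rw [hφdef, Set.indicator_of_mem hm, Pi.one_apply]
        obtain ⟨e₁, hm1, hmin1⟩ := hEmin (scaledQuantile T (t x) p.2.1)
        obtain ⟨e₂, hm2, hmin2⟩ := hEmin (scaledQuantile T (t' x) p.2.2)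
        have hone := one_le_of_mem_jointSet hp1.1 hp1.2 hs₀ hs₁ (hθ₀ e₁ hm1 e₂ hm2)
          (hθ₁ e₁ hm1 e₂ hm2) (he₁ e₁ hm1 e₂ hm2) (he₂ e₁ hm1 e₂ hm2) hm
        have b1 := hgb _ hx _ hp2.1
        have b2 := hgb _ hx' _ hp2.2
        rw [hmin1] at b1
        rw [hmin2] at b2
        have q1 := scaledQuantile_nonneg T (t x) p.2.1
        have q2 := scaledQuantile_nonneg T (t' x) p.2.2
        obtain ⟨u1, v1⟩ := hp1
        calc (1 : ℝ≥0∞) ≤ ENNReal.ofReal ((U p.1 / s₀) ^ θ₀ e₁ e₂ * (V p.1 / s₁) ^ θ₁ e₁ e₂ *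
              (scaledQuantile T (t x) p.2.1 ^ e₁ * scaledQuantile T (t' x) p.2.2 ^ e₂)) :=
              ENNReal.one_le_ofReal.2 hone
          _ = ENNReal.ofReal ((U p.1 / s₀) ^ θ₀ e₁ e₂ * (V p.1 / s₁) ^ θ₁ e₁ e₂) *
              (ENNReal.ofReal (scaledQuantile T (t x) p.2.1 ^ e₁) *
                ENNReal.ofReal (scaledQuantile T (t' x) p.2.2 ^ e₂)) := by
              rw [← ENNReal.ofReal_mul (by positivity), ← ENNReal.ofReal_mul (by positivity)]
          _ ≤ k p.1 * (g p.2.1 * g p.2.2) := by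
              gcongr
              exact (Finset.single_le_sum (f := fun e₂ => ENNReal.ofReal
                ((U p.1 / s₀) ^ θ₀ e₁ e₂ * (V p.1 / s₁) ^ θ₁ e₁ e₂)) (fun _ _ => zero_le)
                hm2).trans (Finset.single_le_sum (f := fun e₁ => ∑ e₂ ∈ E, ENNReal.ofReal
                ((U p.1 / s₀) ^ θ₀ e₁ e₂ * (V p.1 / s₁) ^ θ₁ e₁ e₂)) (fun _ _ => zero_le) hm1)
      · rw [hφdef, Set.indicator_of_notMem hm]
        exact zero_le
    · rw [lintegral_prod_mul (g := fun r : ℝ × ℝ => g r.1 * g r.2) hk.aemeasurable (by fun_prop),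
        lintegral_prod_mul hg.aemeasurable hg.aemeasurable]
      exact (ENNReal.mul_lt_top hkfin (ENNReal.mul_lt_top hgfin hgfin)).ne
    · filter_upwards [hae1, hae2, hae3] with p hp1 hp2 hp3
      refine tendsto_indicator_jointSet (inv_pos.2 hp2.1) (inv_pos.2 hp2.2) hp1.1 hp1.2 hs₀ hs₁
        ((h.tendsto_scaledQuantile hp2.1).comp ht) ((h.tendsto_scaledQuantile hp2.2).comp ht') ?_ ?_
      · rw [Real.log_inv, Real.log_inv]
        convert hp3.1 using 1
        ring
      · rw [Real.log_inv, Real.log_inv]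
        convert hp3.2 using 1
        ring
  -- For fixed `u` and `v` the inner integral is that of `exp (-(y₀ p + y₁ q))` over the quadrant
  -- with corner `(log (s₀ / u), log (s₁ / v))`, times the Jacobian.
  have hval : ∫⁻ p, φ ((p.2.1⁻¹, p.2.2⁻¹), (U p.1, V p.1)) ∂(P.prod (ν.prod ν)) =
      ∫⁻ ω, ENNReal.ofReal (|(a * d - b * c)⁻¹| *
        ((U ω / s₀) ^ y₀ / y₀ * ((V ω / s₁) ^ y₁ / y₁))) ∂P := by
    rw [lintegral_prod _ (by fun_prop)]
    refine lintegral_congr_ae ?_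
    filter_upwards [hU0, hV0] with ω hu hv
    have hm : MeasurableSet {r : ℝ × ℝ | Real.log (s₀ / U ω) < r.1 ∧ Real.log (s₁ / V ω) < r.2} :=
      (measurableSet_lt measurable_const measurable_fst).inter
        (measurableSet_lt measurable_const measurable_snd)
    have e := lintegral_neg_log_linear hdet h1 h2 (G := {r : ℝ × ℝ | Real.log (s₀ / U ω) < r.1 ∧
      Real.log (s₁ / V ω) < r.2}.indicator 1) (measurable_one.indicator hm)
    rw [lintegral_exp_neg_quadrant hy₀ hy₁, ← ENNReal.ofReal_mul (abs_nonneg _)] at e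
    have hexp : ∀ s u y : ℝ, 0 < s → 0 < u → Real.exp (-(y * Real.log (s / u))) = (u / s) ^ y := by
      intro s u y hs hu
      rw [Real.rpow_def_of_pos (by positivity), ← inv_div u s, Real.log_inv]
      congr 1
      ring
    rw [hexp _ _ _ hs₀ hu, hexp _ _ _ hs₁ hv] at e
    refine Eq.trans (lintegral_congr_ae ?_) e
    have hpos : ∀ᵐ r ∂(ν.prod ν), 0 < r.1 ∧ 0 < r.2 :=
      (Measure.quasiMeasurePreserving_fst.ae hνpos).and
        (Measure.quasiMeasurePreserving_snd.ae hνpos)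
    filter_upwards [hpos] with r hr
    have hiff := mem_jointSet_iff (a := a) (b := b) (c := c) (d := d) (inv_pos.2 hr.1)
      (inv_pos.2 hr.2) hu hv hs₀ hs₁
    rw [Real.log_inv, Real.log_inv, mul_neg, mul_neg, mul_neg, mul_neg, ← neg_add, ← neg_add]
      at hiff
    simp only [hφdef, Set.indicator_apply, hiff, Set.mem_ofPred_eq]
    rfl
  rw [hval] at hlim
  refine hlim.congr' ?_
  filter_upwards [ht.eventually_gt_atTop 0, ht'.eventually_gt_atTop 0] with x hx hx'
  rw [h.lintegral_comp_div_two hX hX' (hU.prodMk hV) hXX' hind hT hT' hx hx' hφ hφ0]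
  rw [mul_comm, ENNReal.mul_div_cancel_right]
  · exact (ENNReal.ofReal_pos.2 (mul_pos (h.pos _) (h.pos _))).ne'
  · exact ENNReal.ofReal_ne_top

theorem eventually_mul_lt (c : ℝ) {k : ℝ} (hk : 0 < k) : ∀ᶠ η in 𝓝[>] (0 : ℝ), η * c < k := by
  have h : Tendsto (fun η : ℝ => η * c) (𝓝[>] 0) (𝓝 (0 * c)) :=
    (Continuous.tendsto (by fun_prop) 0).mono_left nhdsWithin_le_nhds
  exact h.eventually_lt_const (by simpa using hk)

theorem abs_sub_div_sub_le {e₁ e₂ η u v D : ℝ} (h1 : |e₁ - 1| ≤ η) (h2 : |e₂ - 1| ≤ η)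
    (hu : 0 ≤ u) (hv : 0 ≤ v) :
    |(e₁ * u - e₂ * v) / D - (u - v) / D| ≤ η * ((u + v) / |D|) := by
  rw [← sub_div, abs_div, ← mul_div_assoc]
  refine div_le_div_of_nonneg_right ?_ (abs_nonneg _)
  have h1 := abs_le.1 h1
  have h2 := abs_le.1 h2
  refine abs_le.2 ⟨?_, ?_⟩ <;> nlinarith

/-! ### Sharp joint tail with two dominating variables -/

namespace ProductLimits

variable {Ω : Type*} [MeasurableSpace Ω] {P : Measure Ω} [IsProbabilityMeasure P]
  {X : ℕ → Ω → ℝ} {α β κ : ℕ → ℝ} {Y₀ Y₁ : Ω → ℝ} {i j : ℕ} {U V : Ω → ℝ}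

/-- Tightness of both constraints makes the powers of `x ^ κ i` and `x ^ κ j` multiply to exactly
`x`, so the scaled event does not depend on `x` otherwise. -/
theorem mem_jointSet_scaled_iff {x s₀ s₁ u v p q : ℝ} (hx : 0 < x) (hp : 0 < p) (hq : 0 < q)
    (h0 : α i * κ i + α j * κ j = 1) (h1 : β i * κ i + β j * κ j = 1) :
    ((p / x ^ κ i, q / x ^ κ j), (u, v)) ∈ jointSet (α i) (α j) (β i) (β j) s₀ s₁ ↔
      s₀ * x < p ^ α i * q ^ α j * u ∧ s₁ * x < p ^ β i * q ^ β j * v := by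
  have key : ∀ (a : ℕ → ℝ) (w : ℝ), a i * κ i + a j * κ j = 1 →
      (p / x ^ κ i) ^ a i * (q / x ^ κ j) ^ a j * w = p ^ a i * q ^ a j * w / x := by
    intro a w ha
    have e : x = (x ^ κ i) ^ a i * (x ^ κ j) ^ a j := by
      rw [← Real.rpow_mul hx.le, ← Real.rpow_mul hx.le, ← Real.rpow_add hx, mul_comm (κ i),
        mul_comm (κ j), ha, Real.rpow_one]
    rw [Real.div_rpow hp.le (by positivity), Real.div_rpow hq.le (by positivity), div_mul_div_comm,
      ← e, div_mul_eq_mul_div]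
  have hp' : 0 < p / x ^ κ i := by positivity
  have hq' : 0 < q / x ^ κ j := by positivity
  simp only [jointSet, Set.mem_ofPred_eq, hp', hq', true_and, key α u h0, key β v h1,
    lt_div_iff₀ hx]

/-- Solving the two-by-two system for `e₁`, `e₂` near one gives exponents near the dual solution
`(y₀, y₁)`. They remain nonnegative, and the reduced costs remain uniformly below one, so the
remainders keep the needed moments. -/
theorem exists_tilting (L : ProductLimits P X α β Y₀ Y₁) (hκ : LPUniqueSolution α β κ)
    (hij : i ≠ j) (hi : 0 < κ i) (hj : 0 < κ j) (F : Factorization P X α β Y₀ Y₁ {i, j} U V) :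
    Integrable (fun ω => U ω ^ ((β j - β i) / (α i * β j - α j * β i)) *
        V ω ^ ((α i - α j) / (α i * β j - α j * β i))) P ∧
      ∃ η : ℝ, 0 < η ∧ η < 1 ∧ ∀ e₁ e₂ : ℝ, |e₁ - 1| ≤ η → |e₂ - 1| ≤ η →
        ∃ θ₀ θ₁, 0 ≤ θ₀ ∧ 0 ≤ θ₁ ∧ α i * θ₀ + β i * θ₁ = e₁ ∧ α j * θ₀ + β j * θ₁ = e₂ ∧
          Integrable (fun ω => U ω ^ θ₀ * V ω ^ θ₁) P := by
  have hdet := L.data.det_ne_zero_of_two_pos hκ hij hi hj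
  have hy₀ := L.data.dual_left_pos hκ hij hi hj
  have hy₁ := L.data.dual_right_pos hκ hij hi hj
  have hα := L.data.nonneg_left
  have hβ := L.data.nonneg_right
  have hγ : ∀ m, m ∉ ({i, j} : Finset ℕ) →
      (α m * (β j - β i) + β m * (α i - α j)) / (α i * β j - α j * β i) < 1 := fun m hm => by
    simp only [Finset.mem_insert, Finset.mem_singleton, not_or] at hm
    exact L.data.reduced_cost_lt_one hκ hij hi hj hm.1 hm.2
  set Δ := α i * β j - α j * β i with hΔ
  set y₀ := (β j - β i) / Δ with hy₀def
  set y₁ := (α i - α j) / Δ with hy₁def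
  have hγy : ∀ m, (α m * (β j - β i) + β m * (α i - α j)) / Δ = α m * y₀ + β m * y₁ :=
    fun m => by rw [hy₀def, hy₁def]; ring
  obtain ⟨p, hp0, hp1, hp⟩ := exists_lt_forall_le (f := fun m => α m * y₀ + β m * y₁)
    ((L.data.summable_left.mul_right y₀).add (L.data.summable_right.mul_right y₁)).tendsto_atTop_zero
    one_pos (s := {m | m ∉ ({i, j} : Finset ℕ)}) fun m hm => by
      rw [← hγy]
      exact hγ m hm
  refine ⟨F.integrable_mul L hy₀.le hy₁.le hp0 hp1 hp, ?_⟩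
  set c₀ := (β j + β i) / |Δ| with hc₀
  set c₁ := (α i + α j) / |Δ| with hc₁
  have hc₀0 : 0 ≤ c₀ := div_nonneg (add_nonneg (hβ j) (hβ i)) (abs_nonneg _)
  have hc₁0 : 0 ≤ c₁ := div_nonneg (add_nonneg (hα i) (hα j)) (abs_nonneg _)
  -- The perturbed exponents differ from the dual ones by at most `η c₀` and `η c₁`. The first two
  -- conditions keep them nonnegative; the third lets each reduced cost grow by at most `(1 - p) /
  -- 2`, using that a coefficient is at most the sum of its series.
  obtain ⟨η, g1, g2, g3, g4⟩ := ((eventually_mul_lt c₀ hy₀).and ((eventually_mul_lt c₁ hy₁).and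
    ((eventually_mul_lt ((∑' m, α m) * c₀ + (∑' m, β m) * c₁)
      (show 0 < (1 - p) / 2 by linarith)).and (Ioo_mem_nhdsGT (one_pos (α := ℝ)))))).exists
  have hη : 0 < η := g4.1
  refine ⟨η, hη, g4.2, fun e₁ e₂ he₁ he₂ => ?_⟩
  have b0 := abs_sub_div_sub_le (D := Δ) he₁ he₂ (hβ j) (hβ i)
  have b1 := abs_sub_div_sub_le (D := Δ) he₂ he₁ (hα i) (hα j)
  rw [← hy₀def, ← hc₀] at b0
  rw [← hy₁def, ← hc₁] at b1
  set θ₀ := (e₁ * β j - e₂ * β i) / Δ with hθ₀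
  set θ₁ := (e₂ * α i - e₁ * α j) / Δ with hθ₁
  have b0' := abs_le.1 b0
  have b1' := abs_le.1 b1
  have hθ₀0 : 0 ≤ θ₀ := by linarith
  have hθ₁0 : 0 ≤ θ₁ := by linarith
  refine ⟨θ₀, θ₁, hθ₀0, hθ₁0, ?_, ?_, F.integrable_mul L hθ₀0 hθ₁0 (p := (1 + p) / 2)
    (by linarith) (by linarith) fun m hm => ?_⟩
  · rw [hθ₀, hθ₁]
    field_simp
    rw [hΔ]
    ring
  · rw [hθ₀, hθ₁]
    field_simp
    rw [hΔ]
    ring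
  · have h1 : α m * θ₀ ≤ α m * y₀ + (∑' m, α m) * (η * c₀) := by
      have : α m * (θ₀ - y₀) ≤ (∑' m, α m) * (η * c₀) :=
        (mul_le_mul_of_nonneg_left b0'.2 (hα m)).trans (mul_le_mul_of_nonneg_right
          (L.data.summable_left.le_tsum m fun k _ => hα k) (by positivity))
      linarith
    have h2 : β m * θ₁ ≤ β m * y₁ + (∑' m, β m) * (η * c₁) := by
      have : β m * (θ₁ - y₁) ≤ (∑' m, β m) * (η * c₁) :=
        (mul_le_mul_of_nonneg_left b1'.2 (hβ m)).trans (mul_le_mul_of_nonneg_right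
          (L.data.summable_right.le_tsum m fun k _ => hβ k) (by positivity))
      linarith
    have h3 : α m * y₀ + β m * y₁ ≤ p := hp m hm
    nlinarith

theorem _root_.Factorization.indep_pair (F : Factorization P X α β Y₀ Y₁ {i, j} U V) :
    IndepFun (fun ω => (X i ω, X j ω)) (fun ω => (U ω, V ω)) P :=
  F.indep.comp (φ := fun f : (((({i, j} : Finset ℕ) : Set ℕ)) → ℝ) =>
    (f ⟨i, by simp⟩, f ⟨j, by simp⟩)) (by fun_prop) measurable_id

/-- Asymptotics if two variables dominate. -/
theorem tendsto_of_two_pos (L : ProductLimits P X α β Y₀ Y₁) (hκ : LPUniqueSolution α β κ)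
    (hij : i ≠ j) (hi : 0 < κ i) (hj : 0 < κ j) (F : Factorization P X α β Y₀ Y₁ {i, j} U V)
    {s₀ s₁ : ℝ} (hs₀ : 0 < s₀) (hs₁ : 0 < s₁) :
    Tendsto (fun x : ℝ => P.real {ω | s₀ * x < Y₀ ω ∧ s₁ * x < Y₁ ω} /
        (P.real {ω | x ^ κ i < X i ω} * P.real {ω | x ^ κ j < X j ω})) atTop
      (𝓝 (|α i * β j - α j * β i| / ((α i - α j) * (β j - β i)) *
        (∫ ω, U ω ^ ((β j - β i) / (α i * β j - α j * β i)) *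
          V ω ^ ((α i - α j) / (α i * β j - α j * β i)) ∂P) *
        s₀ ^ ((β i - β j) / (α i * β j - α j * β i)) *
        s₁ ^ ((α j - α i) / (α i * β j - α j * β i)))) := by
  obtain ⟨hint, η, hη, hη1, htilt⟩ := L.exists_tilting hκ hij hi hj F
  have hdet := L.data.det_ne_zero_of_two_pos hκ hij hi hj
  have hy₀ := L.data.dual_left_pos hκ hij hi hj
  have hy₁ := L.data.dual_right_pos hκ hij hi hj
  have hU := F.meas_left
  have hV := F.meas_right
  set Δ := α i * β j - α j * β i with hΔ
  set y₀ := (β j - β i) / Δ with hy₀def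
  set y₁ := (α i - α j) / Δ with hy₁def
  have hE : ∀ e ∈ ({1 - η, 1 + η} : Finset ℝ), |e - 1| ≤ η := fun e he => by
    simp only [Finset.mem_insert, Finset.mem_singleton] at he
    rcases he with rfl | rfl
    · simp [abs_of_pos hη]
    · simp [abs_of_pos hη]
  have hmain := L.iid.heavyTail.tendsto_lintegral_jointSet (L.iid.meas i) (L.iid.meas j) hU hV
    (L.iid.indep.indepFun hij) F.indep_pair (L.iid.tail_eq i) (L.iid.tail_eq j) F.pos_left
    F.pos_right (tendsto_rpow_atTop hi) (tendsto_rpow_atTop hj) hdet (y₀ := y₀) (y₁ := y₁)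
    (by
      rw [hy₀def, hy₁def]
      field_simp
      rw [hΔ]
      ring) (by
      rw [hy₀def, hy₁def]
      field_simp
      rw [hΔ]
      ring) hy₀ hy₁ hs₀ hs₁ hη hη1 fun e₁ he₁ e₂ he₂ => htilt e₁ e₂ (hE e₁ he₁) (hE e₂ he₂)
  set C := |Δ⁻¹| * (s₀ ^ (-y₀) / y₀ * (s₁ ^ (-y₁) / y₁)) with hC
  have hlimint : ∫⁻ ω, ENNReal.ofReal (|Δ⁻¹| *
      ((U ω / s₀) ^ y₀ / y₀ * ((V ω / s₁) ^ y₁ / y₁))) ∂P =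
      ENNReal.ofReal (C * ∫ ω, U ω ^ y₀ * V ω ^ y₁ ∂P) := by
    rw [← integral_const_mul, ofReal_integral_eq_lintegral_ofReal (hint.const_mul C)]
    · refine lintegral_congr_ae ?_
      filter_upwards [F.pos_left, F.pos_right] with ω h1 h2
      congr 1
      rw [Real.div_rpow h1.le hs₀.le, Real.div_rpow h2.le hs₁.le, hC, Real.rpow_neg hs₀.le,
        Real.rpow_neg hs₁.le]
      field_simp
    · filter_upwards [F.pos_left, F.pos_right] with ω h1 h2
      change (0 : ℝ) ≤ _
      positivity
  rw [hlimint] at hmain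
  have hnn : 0 ≤ C * ∫ ω, U ω ^ y₀ * V ω ^ y₁ ∂P := by
    refine mul_nonneg (by positivity) (integral_nonneg_of_ae ?_)
    filter_upwards [F.pos_left, F.pos_right] with ω h1 h2
    change (0 : ℝ) ≤ _
    positivity
  have hreal := (ENNReal.tendsto_toReal ENNReal.ofReal_ne_top).comp hmain
  rw [ENNReal.toReal_ofReal hnn] at hreal
  -- The stated constant agrees with the integral because `(α i - α j) * (β j - β i) = y₀ * y₁ * Δ ^
  -- 2`.
  have hconst : |Δ| / ((α i - α j) * (β j - β i)) * (∫ ω, U ω ^ y₀ * V ω ^ y₁ ∂P) *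
      s₀ ^ ((β i - β j) / Δ) * s₁ ^ ((α j - α i) / Δ) = C * ∫ ω, U ω ^ y₀ * V ω ^ y₁ ∂P := by
    have e1 : (β i - β j) / Δ = -y₀ := by rw [hy₀def]; ring
    have e2 : (α j - α i) / Δ = -y₁ := by rw [hy₁def]; ring
    have e3 : α i - α j = y₁ * Δ := by rw [hy₁def]; field_simp
    have e4 : β j - β i = y₀ * Δ := by rw [hy₀def]; field_simp
    rw [e1, e2, e3, e4, hC, abs_inv]
    have e5 : y₁ * Δ * (y₀ * Δ) = y₁ * y₀ * (|Δ| * |Δ|) := by rw [abs_mul_abs_self]; ring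
    rw [e5]
    have := abs_pos.2 hdet
    field_simp
  rw [hconst]
  refine hreal.congr' ?_
  filter_upwards [eventually_gt_atTop 0] with x hx
  have hm : Measurable fun ω => ((X i ω / x ^ κ i, X j ω / x ^ κ j), (U ω, V ω)) := by
    have := L.iid.meas i
    have := L.iid.meas j
    fun_prop
  rw [Function.comp_apply, ENNReal.toReal_div, L.iid.tail_eq, L.iid.tail_eq,
    ENNReal.toReal_ofReal
      (mul_nonneg (L.iid.heavyTail.nonneg _) (L.iid.heavyTail.nonneg _))]
  congr 1
  rw [measureReal_joint_eq {i, j} F, measureReal_def]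
  congr 1
  have e : ∫⁻ ω, (jointSet (α i) (α j) (β i) (β j) s₀ s₁).indicator 1
      ((X i ω / x ^ κ i, X j ω / x ^ κ j), (U ω, V ω)) ∂P =
      P ((fun ω => ((X i ω / x ^ κ i, X j ω / x ^ κ j), (U ω, V ω))) ⁻¹'
        jointSet (α i) (α j) (β i) (β j) s₀ s₁) := by
    rw [← lintegral_indicator_one (hm measurableSet_jointSet)]
    rfl
  rw [e]
  refine measure_congr ?_
  filter_upwards [L.ae_pos] with ω h3
  refine propext ((mem_jointSet_scaled_iff hx (h3 i) (h3 j)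
    (L.data.tight_left_of_two_pos hκ hij hi hj)
    (L.data.tight_right_of_two_pos hκ hij hi hj)).trans ?_)
  change _ ↔ s₀ * x < (∏ m ∈ {i, j}, X m ω ^ α m) * U ω ∧
    s₁ * x < (∏ m ∈ {i, j}, X m ω ^ β m) * V ω
  rw [Finset.prod_pair hij, Finset.prod_pair hij]

end ProductLimits

/-! ### The theorem -/

/-- The normalization `N` cancels when the limit at `s` is divided by the limit at `1`. -/
theorem isRegularlyVaryingRV_of_tendsto {Ω : Type*} [MeasurableSpace Ω] {P : Measure Ω}
    [IsProbabilityMeasure P] {Y : Ω → ℝ} {N : ℝ → ℝ} {c ρ : ℝ} (hc : 0 < c)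
    (h : ∀ s, 0 < s → Tendsto (fun x => P.real {ω | s * x < Y ω} / N x) atTop (𝓝 (c * s ^ ρ))) :
    IsRegularlyVaryingRV P Y ρ := by
  have hanti : Antitone fun x => P.real {ω | x < Y ω} := fun x y hxy =>
    measureReal_mono fun ω (hω : y < Y ω) => hxy.trans_lt hω
  have h1 : Tendsto (fun x => P.real {ω | x < Y ω} / N x) atTop (𝓝 c) := by
    simpa using h 1 one_pos
  have hne : ∀ᶠ x in atTop, P.real {ω | x < Y ω} / N x ≠ 0 :=
    (h1.eventually_const_lt hc).mono fun x hx => hx.ne'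
  refine ⟨hanti.measurable, hne.mono fun x hx => measureReal_nonneg.lt_of_ne' fun h0 =>
    hx (by rw [h0, zero_div]), fun s hs => ?_⟩
  have h2 := (h s hs).div h1 hc.ne'
  rw [mul_div_cancel_left₀ _ hc.ne'] at h2
  refine h2.congr' ?_
  filter_upwards [hne] with x hx
  have hN : N x ≠ 0 := fun h0 => hx (by rw [h0, div_zero])
  exact div_div_div_cancel_right₀ hN _ _

theorem integral_pos_of_ae_pos {Ω : Type*} [MeasurableSpace Ω] {P : Measure Ω}
    [IsProbabilityMeasure P] {f : Ω → ℝ} (hf : Integrable f P) (hpos : ∀ᵐ ω ∂P, 0 < f ω) :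
    0 < ∫ ω, f ω ∂P := by
  refine (integral_pos_iff_support_of_nonneg_ae (hpos.mono fun ω h => h.le) hf).2 ?_
  have : ∀ᵐ ω ∂P, ω ∈ Function.support f := hpos.mono fun ω h => h.ne'
  refine pos_iff_ne_zero.2 fun h0 => ?_
  obtain ⟨ω, h1, h2⟩ := (this.and (measure_eq_zero_iff_ae_notMem.1 h0)).exists
  exact h2 h1

theorem Factorization.ae_hasProd_subtype {Ω : Type*} [MeasurableSpace Ω] {P : Measure Ω}
    [IsProbabilityMeasure P] {X : ℕ → Ω → ℝ} {α β c : ℕ → ℝ} {Y₀ Y₁ : Ω → ℝ} {S : Finset ℕ}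
    {U V : Ω → ℝ} (F : Factorization P X α β Y₀ Y₁ S U V) (L : ProductLimits P X α β Y₀ Y₁)
    {θ₀ θ₁ : ℝ} (h₀ : 0 ≤ θ₀) (h₁ : 0 ≤ θ₁) {p : ℕ → Prop} (hp : ∀ m, m ∉ S ↔ p m)
    (hc : ∀ m, c m = α m * θ₀ + β m * θ₁) :
    ∀ᵐ ω ∂P, HasProd (fun m : {m // p m} => X m ω ^ c m) (U ω ^ θ₀ * V ω ^ θ₁) := by
  filter_upwards [F.hasProd_mul L h₀ h₁] with ω h
  obtain rfl : c = fun m => α m * θ₀ + β m * θ₁ := funext hc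
  have hs : ∀ m, m ∈ ((S : Set ℕ)ᶜ) ↔ p m := fun m => by
    rw [← hp m, Set.mem_compl_iff, Finset.mem_coe]
  exact (hasProd_subtype_rpow_iff (x := fun m => X m ω) (c := fun m => α m * θ₀ + β m * θ₁)
    hs).2 h

theorem multipliable_and_integral_congr {Ω ι : Type*} [MeasurableSpace Ω] {P : Measure Ω}
    {f : ι → Ω → ℝ} {g : Ω → ℝ} (h : ∀ᵐ ω ∂P, HasProd (fun m => f m ω) (g ω))
    (hg : Integrable g P) :
    (∀ᵐ ω ∂P, Multipliable fun m => f m ω) ∧ Integrable (fun ω => ∏' m, f m ω) P ∧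
      ∫ ω, ∏' m, f m ω ∂P = ∫ ω, g ω ∂P := by
  have e : g =ᵐ[P] fun ω => ∏' m, f m ω := h.mono fun ω hω => hω.tprod_eq.symm
  exact ⟨h.mono fun ω hω => hω.multipliable, hg.congr e, integral_congr_ae e.symm⟩

/-! ### Assembling the limit formulas and regular variation of the minimum -/

namespace ProductLimits

variable {Ω : Type*} [MeasurableSpace Ω] {P : Measure Ω} [IsProbabilityMeasure P]
  {X : ℕ → Ω → ℝ} {α β κ : ℕ → ℝ} {Y₀ Y₁ : Ω → ℝ} {i j : ℕ}

theorem two_pos_asymptotics (L : ProductLimits P X α β Y₀ Y₁) (hκ : LPUniqueSolution α β κ)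
    (hij : i ≠ j) (hi : 0 < κ i) (hj : 0 < κ j) :
    (∀ᵐ ω ∂P, Multipliable fun m : {m : ℕ // m ≠ i ∧ m ≠ j} =>
      X m ω ^ ((α m * (β j - β i) + β m * (α i - α j)) / (α i * β j - α j * β i))) ∧
    Integrable (fun ω => ∏' m : {m : ℕ // m ≠ i ∧ m ≠ j},
      X m ω ^ ((α m * (β j - β i) + β m * (α i - α j)) / (α i * β j - α j * β i))) P ∧
    ∀ s₀ s₁ : ℝ, 0 < s₀ → 0 < s₁ →
      Tendsto (fun x : ℝ => P.real {ω | s₀ * x < Y₀ ω ∧ s₁ * x < Y₁ ω} /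
          (P.real {ω | x ^ κ i < X i ω} * P.real {ω | x ^ κ j < X j ω})) atTop
        (𝓝 (|α i * β j - α j * β i| / ((α i - α j) * (β j - β i)) *
          (∫ ω, ∏' m : {m : ℕ // m ≠ i ∧ m ≠ j},
            X m ω ^ ((α m * (β j - β i) + β m * (α i - α j)) /
              (α i * β j - α j * β i)) ∂P) *
          s₀ ^ ((β i - β j) / (α i * β j - α j * β i)) *
          s₁ ^ ((α j - α i) / (α i * β j - α j * β i)))) := by
  obtain ⟨U, V, F⟩ := L.exists_factorization {i, j}
  obtain ⟨hint, -⟩ := L.exists_tilting hκ hij hi hj F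
  obtain ⟨h1, h2, h3⟩ := multipliable_and_integral_congr (F.ae_hasProd_subtype L
    (c := fun m => (α m * (β j - β i) + β m * (α i - α j)) / (α i * β j - α j * β i))
    (L.data.dual_left_pos hκ hij hi hj).le (L.data.dual_right_pos hκ hij hi hj).le
    (p := fun m => m ≠ i ∧ m ≠ j) (fun m => by simp) fun m => by ring) hint
  refine ⟨h1, h2, fun s₀ s₁ hs₀ hs₁ => ?_⟩
  rw [h3]
  exact L.tendsto_of_two_pos hκ hij hi hj F hs₀ hs₁

theorem one_pos_asymptotics_of_eq (L : ProductLimits P X α β Y₀ Y₁)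
    (hκ : LPUniqueSolution α β κ) (hi : 0 < κ i) (hz : ∀ j, j ≠ i → κ j = 0) (heq : α i = β i) :
    (∀ᵐ ω ∂P, Multipliable fun j : {j : ℕ // j ≠ i} => X j ω ^ α j) ∧
    (∀ᵐ ω ∂P, Multipliable fun j : {j : ℕ // j ≠ i} => X j ω ^ β j) ∧
    ∀ s₀ s₁ : ℝ, 0 < s₀ → 0 < s₁ →
      Integrable (fun ω => (min (s₀⁻¹ * ∏' j : {j : ℕ // j ≠ i}, X j ω ^ α j)
        (s₁⁻¹ * ∏' j : {j : ℕ // j ≠ i}, X j ω ^ β j)) ^ (1 / β i)) P ∧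
      Tendsto (fun x : ℝ => P.real {ω | s₀ * x < Y₀ ω ∧ s₁ * x < Y₁ ω} /
          P.real {ω | x ^ κ i < X i ω}) atTop
        (𝓝 (∫ ω, (min (s₀⁻¹ * ∏' j : {j : ℕ // j ≠ i}, X j ω ^ α j)
          (s₁⁻¹ * ∏' j : {j : ℕ // j ≠ i}, X j ω ^ β j)) ^ (1 / β i) ∂P)) := by
  obtain ⟨U, V, F⟩ := L.exists_factorization {i}
  have hU := F.ae_hasProd_subtype L (c := α) zero_le_one le_rfl (p := fun m => m ≠ i)
    (fun m => by simp) fun m => by ring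
  have hV := F.ae_hasProd_subtype L (c := β) le_rfl zero_le_one (p := fun m => m ≠ i)
    (fun m => by simp) fun m => by ring
  simp only [Real.rpow_one, Real.rpow_zero, one_mul, mul_one] at hU hV
  refine ⟨hU.mono fun ω h => h.multipliable, hV.mono fun ω h => h.multipliable,
    fun s₀ s₁ hs₀ hs₁ => ?_⟩
  obtain ⟨h1, h2⟩ := L.tendsto_of_eq hκ hi hz heq F hs₀ hs₁
  have e : (fun ω => min (s₀⁻¹ * U ω) (s₁⁻¹ * V ω) ^ (1 / β i)) =ᵐ[P]
      fun ω => (min (s₀⁻¹ * ∏' j : {j : ℕ // j ≠ i}, X j ω ^ α j)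
        (s₁⁻¹ * ∏' j : {j : ℕ // j ≠ i}, X j ω ^ β j)) ^ (1 / β i) := by
    filter_upwards [hU, hV] with ω g1 g2
    rw [g1.tprod_eq, g2.tprod_eq]
  rw [integral_congr_ae e.symm]
  exact ⟨h1.congr e, h2⟩

theorem one_pos_asymptotics_of_lt (L : ProductLimits P X α β Y₀ Y₁)
    (hκ : LPUniqueSolution α β κ) (hi : 0 < κ i) (hz : ∀ j, j ≠ i → κ j = 0) (hlt : β i < α i) :
    (∀ᵐ ω ∂P, Multipliable fun j : {j : ℕ // j ≠ i} => X j ω ^ (β j / β i)) ∧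
    Integrable (fun ω => ∏' j : {j : ℕ // j ≠ i}, X j ω ^ (β j / β i)) P ∧
    ∀ s₀ s₁ : ℝ, 0 < s₀ → 0 < s₁ →
      Tendsto (fun x : ℝ => P.real {ω | s₀ * x < Y₀ ω ∧ s₁ * x < Y₁ ω} /
          P.real {ω | x ^ κ i < X i ω}) atTop
        (𝓝 ((∫ ω, ∏' j : {j : ℕ // j ≠ i}, X j ω ^ (β j / β i) ∂P) * s₁ ^ (-1 / β i))) := by
  obtain ⟨U, V, F⟩ := L.exists_factorization {i}
  obtain ⟨hint, hlim⟩ := L.tendsto_of_lt hκ hi hz hlt F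
  have hV := F.ae_hasProd_subtype L (c := fun j => β j / β i) (θ₀ := 0) (θ₁ := 1 / β i) le_rfl
    (one_div_nonneg.2 (L.data.nonneg_right i)) (p := fun m => m ≠ i)
    (fun m => by simp) fun m => by ring
  simp only [Real.rpow_zero, one_mul] at hV
  obtain ⟨h1, h2, h3⟩ := multipliable_and_integral_congr hV hint
  exact ⟨h1, h2, fun s₀ s₁ hs₀ hs₁ => by rw [h3]; exact hlim s₀ s₁ hs₀ hs₁⟩

theorem one_pos_asymptotics_of_gt (L : ProductLimits P X α β Y₀ Y₁)
    (hκ : LPUniqueSolution α β κ) (hi : 0 < κ i) (hz : ∀ j, j ≠ i → κ j = 0) (hlt : α i < β i) :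
    (∀ᵐ ω ∂P, Multipliable fun j : {j : ℕ // j ≠ i} => X j ω ^ (α j / α i)) ∧
    Integrable (fun ω => ∏' j : {j : ℕ // j ≠ i}, X j ω ^ (α j / α i)) P ∧
    ∀ s₀ s₁ : ℝ, 0 < s₀ → 0 < s₁ →
      Tendsto (fun x : ℝ => P.real {ω | s₀ * x < Y₀ ω ∧ s₁ * x < Y₁ ω} /
          P.real {ω | x ^ κ i < X i ω}) atTop
        (𝓝 ((∫ ω, ∏' j : {j : ℕ // j ≠ i}, X j ω ^ (α j / α i) ∂P) * s₀ ^ (-1 / α i))) := by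
  obtain ⟨h1, h2, h3⟩ := L.symm.one_pos_asymptotics_of_lt hκ.symm hi hz hlt
  refine ⟨h1, h2, fun s₀ s₁ hs₀ hs₁ => ?_⟩
  simpa only [and_comm] using h3 s₁ s₀ hs₁ hs₀

theorem isRegularlyVaryingRV_min_of_lt (L : ProductLimits P X α β Y₀ Y₁)
    (hκ : LPUniqueSolution α β κ) (hi : 0 < κ i) (hz : ∀ j, j ≠ i → κ j = 0) (hlt : β i < α i) :
    IsRegularlyVaryingRV P (fun ω => min (Y₀ ω) (Y₁ ω)) (-κ i) := by
  obtain ⟨U, V, F⟩ := L.exists_factorization {i}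
  obtain ⟨hint, hlim⟩ := L.tendsto_of_lt hκ hi hz hlt F
  have hβκ := L.data.min_mul_eq_one_of_one_pos hκ hi hz hlt.le
  have hβ : 0 < β i := pos_of_mul_pos_left (hβκ ▸ one_pos) hi.le
  have hκi : -κ i = -1 / β i := by rw [eq_div_iff hβ.ne']; linarith
  refine isRegularlyVaryingRV_of_tendsto (N := fun x => P.real {ω | x ^ κ i < X i ω})
    (integral_pos_of_ae_pos hint (F.pos_right.mono fun ω h => by positivity)) fun s hs => ?_
  rw [hκi]
  simpa only [lt_min_iff] using hlim s s hs hs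

theorem isRegularlyVaryingRV_min_of_one_pos (L : ProductLimits P X α β Y₀ Y₁)
    (hκ : LPUniqueSolution α β κ) (hi : 0 < κ i) (hz : ∀ j, j ≠ i → κ j = 0) :
    IsRegularlyVaryingRV P (fun ω => min (Y₀ ω) (Y₁ ω)) (-κ i) := by
  rcases lt_trichotomy (β i) (α i) with hlt | heq | hlt
  · exact L.isRegularlyVaryingRV_min_of_lt hκ hi hz hlt
  · obtain ⟨U, V, F⟩ := L.exists_factorization {i}
    have hβκ := L.data.min_mul_eq_one_of_one_pos hκ hi hz heq.le
    have hβ : 0 < β i := pos_of_mul_pos_left (hβκ ▸ one_pos) hi.le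
    have hκi : -κ i = -(1 / β i) := by rw [neg_inj, eq_div_iff hβ.ne']; linarith
    have hint := (L.tendsto_of_eq hκ hi hz heq.symm F one_pos one_pos).1
    have hpos : ∀ᵐ ω ∂P, 0 < min (U ω) (V ω) := by
      filter_upwards [F.pos_left, F.pos_right] with ω h1 h2
      exact lt_min h1 h2
    simp only [inv_one, one_mul] at hint
    refine isRegularlyVaryingRV_of_tendsto (N := fun x => P.real {ω | x ^ κ i < X i ω})
      (integral_pos_of_ae_pos hint (hpos.mono fun ω h => by positivity)) fun s hs => ?_
    have := (L.tendsto_of_eq hκ hi hz heq.symm F hs hs).2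
    have e : ∫ ω, min (s⁻¹ * U ω) (s⁻¹ * V ω) ^ (1 / β i) ∂P =
        (∫ ω, min (U ω) (V ω) ^ (1 / β i) ∂P) * s ^ (-κ i) := by
      rw [← integral_mul_const]
      refine integral_congr_ae ?_
      filter_upwards [hpos] with ω h
      rw [← mul_min_of_nonneg _ _ (inv_pos.2 hs).le, Real.mul_rpow (inv_pos.2 hs).le h.le, hκi,
        Real.inv_rpow hs.le, ← Real.rpow_neg hs.le, mul_comm]
    rw [e] at this
    simpa only [lt_min_iff] using this
  · simpa only [min_comm] using L.symm.isRegularlyVaryingRV_min_of_lt hκ.symm hi hz hlt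

theorem isRegularlyVaryingRV_min_of_two_pos (L : ProductLimits P X α β Y₀ Y₁)
    (hκ : LPUniqueSolution α β κ) (hij : i ≠ j) (hi : 0 < κ i) (hj : 0 < κ j) :
    IsRegularlyVaryingRV P (fun ω => min (Y₀ ω) (Y₁ ω)) (-(κ i + κ j)) := by
  obtain ⟨U, V, F⟩ := L.exists_factorization {i, j}
  obtain ⟨hint, -⟩ := L.exists_tilting hκ hij hi hj F
  have hdet := L.data.det_ne_zero_of_two_pos hκ hij hi hj
  have hy₀ := L.data.dual_left_pos hκ hij hi hj
  have hy₁ := L.data.dual_right_pos hκ hij hi hj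
  have t0 := L.data.tight_left_of_two_pos hκ hij hi hj
  have t1 := L.data.tight_right_of_two_pos hκ hij hi hj
  have hE := integral_pos_of_ae_pos hint (by
    filter_upwards [F.pos_left, F.pos_right] with ω h1 h2
    positivity)
  have hpos : 0 < |α i * β j - α j * β i| / ((α i - α j) * (β j - β i)) := by
    refine div_pos (abs_pos.2 hdet) ?_
    have e := mul_pos (mul_pos hy₀ hy₁) (mul_self_pos.2 hdet)
    have e' : (β j - β i) / (α i * β j - α j * β i) * ((α i - α j) / (α i * β j - α j * β i)) *
        ((α i * β j - α j * β i) * (α i * β j - α j * β i)) = (α i - α j) * (β j - β i) := by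
      generalize α i * β j - α j * β i = Δ at hdet ⊢
      field_simp
    rwa [e'] at e
  refine isRegularlyVaryingRV_of_tendsto
    (N := fun x => P.real {ω | x ^ κ i < X i ω} * P.real {ω | x ^ κ j < X j ω})
    (mul_pos hpos hE) fun s hs => ?_
  have hlim := L.tendsto_of_two_pos hκ hij hi hj F hs hs
  -- Strong duality: the dual value `y₀ + y₁` equals the primal value `κ i + κ j`, because both
  -- constraints are tight.
  have hexp : (β i - β j) / (α i * β j - α j * β i) + (α j - α i) / (α i * β j - α j * β i) =
      -(κ i + κ j) := by
    rw [← add_div, div_eq_iff hdet]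
    linear_combination (β j - β i) * t0 + (α i - α j) * t1
  rw [mul_assoc _ (s ^ _) (s ^ _), ← Real.rpow_add hs, hexp] at hlim
  simpa only [lt_min_iff] using hlim

theorem isRegularlyVaryingRV_min (L : ProductLimits P X α β Y₀ Y₁)
    (hκ : LPUniqueSolution α β κ) :
    IsRegularlyVaryingRV P (fun ω => min (Y₀ ω) (Y₁ ω)) (-∑' i, κ i) := by
  obtain ⟨i, hi⟩ : ∃ i, 0 < κ i := by
    by_contra! hcon
    have h0 : ∀ i, κ i = 0 := fun i => le_antisymm (hcon i) (hκ.1.1.1 i)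
    have := hκ.1.1.2.1
    simp [h0] at this
  by_cases hj : ∃ j, j ≠ i ∧ 0 < κ j
  · obtain ⟨j, hji, hj⟩ := hj
    have := L.data.tsum_mul_of_two_pos hκ hji.symm hi hj 1
    simp only [Pi.one_apply, one_mul] at this
    rw [this]
    exact L.isRegularlyVaryingRV_min_of_two_pos hκ hji.symm hi hj
  · push Not at hj
    have hz : ∀ j, j ≠ i → κ j = 0 := fun j h => le_antisymm (hj j h) (hκ.1.1.1 j)
    rw [tsum_eq_single i hz]
    exact L.isRegularlyVaryingRV_min_of_one_pos hκ hi hz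

end ProductLimits

theorem mainTheorem4 {Ω : Type*} [MeasurableSpace Ω] (P : Measure Ω) [IsProbabilityMeasure P]
    (X : ℕ → Ω → ℝ) (α β : ℕ → ℝ)
    (hXmeas : ∀ i, Measurable (X i))
    (hXindep : iIndepFun X P)
    (hXident : ∀ i, IdentDistrib (X i) (X 0) P P)
    (hXnonneg : ∀ i, ∀ᵐ ω ∂P, 0 ≤ X i ω)
    (hXrv : ∀ i, IsRegularlyVaryingRV P (X i) (-1))
    (hα : ∀ i, 0 ≤ α i) (hβ : ∀ i, 0 ≤ β i)
    (hαsup : 0 < ⨆ i, α i) (hβsup : 0 < ⨆ i, β i)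
    (hαsum : Summable α) (hβsum : Summable β) :
    -- almost sure convergence of the products
    (∀ᵐ ω ∂P, ∃ y : ℝ, Tendsto (fun n => ∏ i ∈ Finset.range n, X i ω ^ α i) atTop (𝓝 y)) ∧
    (∀ᵐ ω ∂P, ∃ y : ℝ, Tendsto (fun n => ∏ i ∈ Finset.range n, X i ω ^ β i) atTop (𝓝 y)) ∧
    -- the linear program has a solution
    (∃ κ, LPSolution α β κ) ∧
    -- statements on the limiting random variables, if these are a.s. strictly positive
    ∀ Y₀ Y₁ : Ω → ℝ,
      (∀ᵐ ω ∂P, Tendsto (fun n => ∏ i ∈ Finset.range n, X i ω ^ α i) atTop (𝓝 (Y₀ ω))) →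
      (∀ᵐ ω ∂P, Tendsto (fun n => ∏ i ∈ Finset.range n, X i ω ^ β i) atTop (𝓝 (Y₁ ω))) →
      (∀ᵐ ω ∂P, 0 < Y₀ ω) → (∀ᵐ ω ∂P, 0 < Y₁ ω) →
      (∀ κ, LPUniqueSolution α β κ →
        {i | 0 < κ i}.encard ≤ 2 ∧
        IsRegularlyVaryingRV P (fun ω => min (Y₀ ω) (Y₁ ω)) (-∑' i, κ i) ∧
        -- (i) two positive components
        (∀ i j, i ≠ j → 0 < κ i → 0 < κ j →
          (∀ᵐ ω ∂P, Multipliable fun m : {m : ℕ // m ≠ i ∧ m ≠ j} =>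
            X m ω ^ ((α m * (β j - β i) + β m * (α i - α j)) / (α i * β j - α j * β i))) ∧
          Integrable (fun ω => ∏' m : {m : ℕ // m ≠ i ∧ m ≠ j},
            X m ω ^ ((α m * (β j - β i) + β m * (α i - α j)) / (α i * β j - α j * β i))) P ∧
          ∀ s₀ s₁ : ℝ, 0 < s₀ → 0 < s₁ →
            Tendsto (fun x : ℝ => P.real {ω | s₀ * x < Y₀ ω ∧ s₁ * x < Y₁ ω} /
                (P.real {ω | x ^ κ i < X i ω} * P.real {ω | x ^ κ j < X j ω})) atTop
              (𝓝 (|α i * β j - α j * β i| / ((α i - α j) * (β j - β i)) *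
                (∫ ω, ∏' m : {m : ℕ // m ≠ i ∧ m ≠ j},
                  X m ω ^ ((α m * (β j - β i) + β m * (α i - α j)) /
                    (α i * β j - α j * β i)) ∂P) *
                s₀ ^ ((β i - β j) / (α i * β j - α j * β i)) *
                s₁ ^ ((α j - α i) / (α i * β j - α j * β i))))) ∧
        -- (ii) exactly one positive component
        (∀ i, 0 < κ i → (∀ j, j ≠ i → κ j = 0) →
          (α i = β i →
            (∀ᵐ ω ∂P, Multipliable fun j : {j : ℕ // j ≠ i} => X j ω ^ α j) ∧
            (∀ᵐ ω ∂P, Multipliable fun j : {j : ℕ // j ≠ i} => X j ω ^ β j) ∧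
            ∀ s₀ s₁ : ℝ, 0 < s₀ → 0 < s₁ →
              Integrable (fun ω => (min (s₀⁻¹ * ∏' j : {j : ℕ // j ≠ i}, X j ω ^ α j)
                (s₁⁻¹ * ∏' j : {j : ℕ // j ≠ i}, X j ω ^ β j)) ^ (1 / β i)) P ∧
              Tendsto (fun x : ℝ => P.real {ω | s₀ * x < Y₀ ω ∧ s₁ * x < Y₁ ω} /
                  P.real {ω | x ^ κ i < X i ω}) atTop
                (𝓝 (∫ ω, (min (s₀⁻¹ * ∏' j : {j : ℕ // j ≠ i}, X j ω ^ α j)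
                  (s₁⁻¹ * ∏' j : {j : ℕ // j ≠ i}, X j ω ^ β j)) ^ (1 / β i) ∂P))) ∧
          (β i < α i →
            (∀ᵐ ω ∂P, Multipliable fun j : {j : ℕ // j ≠ i} => X j ω ^ (β j / β i)) ∧
            Integrable (fun ω => ∏' j : {j : ℕ // j ≠ i}, X j ω ^ (β j / β i)) P ∧
            ∀ s₀ s₁ : ℝ, 0 < s₀ → 0 < s₁ →
              Tendsto (fun x : ℝ => P.real {ω | s₀ * x < Y₀ ω ∧ s₁ * x < Y₁ ω} /
                  P.real {ω | x ^ κ i < X i ω}) atTop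
                (𝓝 ((∫ ω, ∏' j : {j : ℕ // j ≠ i}, X j ω ^ (β j / β i) ∂P) *
                  s₁ ^ (-1 / β i)))) ∧
          (α i < β i →
            (∀ᵐ ω ∂P, Multipliable fun j : {j : ℕ // j ≠ i} => X j ω ^ (α j / α i)) ∧
            Integrable (fun ω => ∏' j : {j : ℕ // j ≠ i}, X j ω ^ (α j / α i)) P ∧
            ∀ s₀ s₁ : ℝ, 0 < s₀ → 0 < s₁ →
              Tendsto (fun x : ℝ => P.real {ω | s₀ * x < Y₀ ω ∧ s₁ * x < Y₁ ω} /
                  P.real {ω | x ^ κ i < X i ω}) atTop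
                (𝓝 ((∫ ω, ∏' j : {j : ℕ // j ≠ i}, X j ω ^ (α j / α i) ∂P) *
                  s₀ ^ (-1 / α i)))))) ∧
      -- (iii) the order of the joint tail, for any solution
      (∀ κ, LPSolution α β κ → Summable κ ∧ ∀ ε : ℝ, 0 < ε →
        ((fun x : ℝ => P.real {ω | x < Y₀ ω ∧ x < Y₁ ω}) =o[atTop]
          fun x : ℝ => x ^ (ε - ∑' i, κ i)) ∧
        ((fun x : ℝ => x ^ (-ε - ∑' i, κ i)) =o[atTop]
          fun x : ℝ => P.real {ω | x < Y₀ ω ∧ x < Y₁ ω})) := by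
  have H : HeavyTailedIID P X := ⟨hXmeas, hXindep, hXident, hXnonneg, hXrv 0⟩
  have hex : ∀ a : ℕ → ℝ, 0 < ⨆ i, a i → ∃ i, 0 < a i := fun a ha => by
    by_contra! hcon
    exact ha.not_ge (Real.iSup_nonpos hcon)
  have D : LPData α β := ⟨hα, hβ, hαsum, hβsum, hex α hαsup, hex β hβsup⟩
  refine ⟨?_, ?_, ?_, fun Y₀ Y₁ hY₀ hY₁ hp₀ hp₁ => ?_⟩
  · exact (H.ae_multipliable hα hαsum).mono fun ω ⟨y, hy⟩ => ⟨y, hy.tendsto_prod_nat⟩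
  · exact (H.ae_multipliable hβ hβsum).mono fun ω ⟨y, hy⟩ => ⟨y, hy.tendsto_prod_nat⟩
  · obtain ⟨t, -, h, -⟩ := D.exists_solution
    exact h
  have L : ProductLimits P X α β Y₀ Y₁ := ⟨H, D, hY₀, hY₁, hp₀, hp₁⟩
  refine ⟨fun κ hκ => ⟨D.encard_pos_le_two hκ, L.isRegularlyVaryingRV_min hκ,
    fun i j hij hi hj => L.two_pos_asymptotics hκ hij hi hj,
    fun i hi hz => ⟨L.one_pos_asymptotics_of_eq hκ hi hz, L.one_pos_asymptotics_of_lt hκ hi hz,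
      L.one_pos_asymptotics_of_gt hκ hi hz⟩⟩,
    fun κ hκ => ⟨D.summable_solution hκ, fun ε hε => L.joint_tail_order hκ hε⟩⟩
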